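/- **Conventions.** Fix integers $1\le p<q$ with $p\mid q$, and let $\mathbf{BS}(p,q)=\langle a,t\mid ta^pt^{-1}=a^q\rangle$, $A=a^{-1}$, $T=t^{-1}$; $\sim$ denotes equality in $\mathbf{BS}(p,q)$. An integer $\alpha$ stands for $a^\alpha$, $\|\alpha\|$ is the geodesic length of $a^\alpha$ over $\{t,T,a,A\}$, and $\mathrm{llnf}$ is the length-lexicographical normal form for $t<T<a<A$. For $u=\alpha_0\theta_1\alpha_1\cdots\theta_k\alpha_k$ with $\alpha_i\in\mathbb Z$, $\theta_i\in\{t,T\}$, put $\|u\|=k+\sum_i\|\alpha_i\|$. The number of sinks $s(u)$ is the number of $i\in\{0,\dots,k\}$ such that $\theta_i\ne t$ and $\theta_{i+1}\neq T$ (conditions on the undefined $\theta_0,\theta_{k+1}$ hold). The word $u$ is Britton-reduced if it has no factor $t(\mu p)T$ or $T(\mu q)t$ with $\mu\in\mathbb Z$. The height of position $i$ is the number of $t$ minus the number of $T$ among $\theta_1,\dots,\theta_i$; the peak is the last position $i$ of maximal height, and $u=u_1\alpha_iu_2$ is the corresponding factorization. Order the symbols $t<T<\alpha$ ($\alpha\in\mathbb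 Z$), integers by absolute value and, of $\pm\alpha$, the nonnegative one first, and let $\le_\Delta$ be the length-lexicographical order on sequences of these symbols (zero coefficients $\alpha_i$ are written as symbols). The Britton peak normal form of $g$ is the Britton-reduced $u\sim g$ such that $\|u\|$ is the geodesic length of $g$ and, among these, $u_1$ is $\le_\Delta$-minimal and then the formal inverse $\overline{u_2}$ is $\le_\Delta$-minimal; $\mathrm{pnf}(g)$ is the word $\mathrm{llnf}(\alpha_0)\theta_1\mathrm{llnf}(\alpha_1)\cdots\theta_k\mathrm{llnf}(\alpha_k)$ over $\{t,T,a,A\}$. A word $v$ over $\{t,T,a,A\}$ is in peak normal form if $v=\mathrm{pnf}(v)$. A standard valley is a Britton-reduced $V=\alpha_1\theta_1\cdots\alpha_k\theta_k0$ whose maximal height and whose height at the last position are both $0$, such that $|\alpha_i|<q$ for all $i$ and $|\alpha_i|<p$ whenever $\theta_i=T$. Its range $R(V)\subseteq p\mathbb Z$ is defined recursively by $R(0)=\{0\}$, $R(UW)=R(U)+R(W)$ for $U\neq0\neq W$, and $$R(\alpha TU\beta t)=\{\mu p:\ \exists\,\sigma\in R(U),\ \varepsilon,\alpha',\beta'\in\mathbb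 Z:\ \alpha=\varepsilon p+\alpha',\ |\alpha'|<p,\ \sigma+\varepsilon q+\beta=\mu q+\beta',\ |\beta'|<q\}.$$ **Theorem 7.5.** There are a constant $C$ and a program for a random access machine (depending only on $p,q$; arithmetic operations on integers with at most $C(\|V\|+1)$ bits take one step) which, on input a standard valley $V$ given as the sequence of its $\alpha_i$ and $\theta_i$, halts after at most $C\,s(V)(\|V\|+s(V))$ steps and outputs all $\rho\in R(V)$, each with a word $V_\rho$ over $\{t,T,a,A\}$ in peak normal form such that $V\sim V_\rho\,\rho$. These words satisfy $$\mathrm{pnf}(Vw)=\min\{V_\rho\,\mathrm{pnf}(\rho w)\mid\rho\in R(V)\}$$ for every $w\in\mathbb Z*\{t,T\}^*$ such that $tw$ is Britton-reduced. Here words are compared first by length, then by their Britton reductions $u$ (first $u_1$, then $\overline{u_2}$, with respect to $\le_\Delta$; the Britton reduction is carried out letter by letter from right to left), then lexicographically with respect to $t<T<a<A$. -/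

import Mathlib

/-! ### Baumslag-Solitar groups, words and geodesic length -/

inductive Gen
  | a
  | t

/-- The defining relation `t a^p t⁻¹ = a^q`. -/
def bsRels (p q : ℕ) : Set (FreeGroup Gen) :=
  {FreeGroup.of Gen.t * FreeGroup.of Gen.a ^ p * (FreeGroup.of Gen.t)⁻¹ *
    (FreeGroup.of Gen.a ^ q)⁻¹}

abbrev BS (p q : ℕ) : Type := PresentedGroup (bsRels p q)

def bsA (p q : ℕ) : BS p q := PresentedGroup.of Gen.a

def bsT (p q : ℕ) : BS p q := PresentedGroup.of Gen.t

/-- The four letters; `T` and `A` are the formal inverses of `t` and `a`. -/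
inductive Letter
  | t
  | T
  | a
  | A
  deriving DecidableEq

/-- Position of a letter in the order `t < T < a < A`. -/
def Letter.rank : Letter → ℕ
  | .t => 0
  | .T => 1
  | .a => 2
  | .A => 3

def Letter.val (p q : ℕ) : Letter → BS p q
  | .t => bsT p q
  | .T => (bsT p q)⁻¹
  | .a => bsA p q
  | .A => (bsA p q)⁻¹

/-- The group element represented by a word over the four letters. -/
def wordVal (p q : ℕ) (v : List Letter) : BS p q :=
  (v.map (Letter.val p q)).prod

/-- Geodesic length of a group element. -/
noncomputable def geoLen (p q : ℕ) (g : BS p q) : ℕ :=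
  sInf {n | ∃ v : List Letter, wordVal p q v = g ∧ v.length = n}

/-- The lexicographic (strict) order on words over the four letters. -/
def LexLt (v v' : List Letter) : Prop :=
  List.Lex (fun x y : Letter => x.rank < y.rank) v v'

/-- The length-lexicographic (strict) order on words over the four letters. -/
def LenLexLt (v v' : List Letter) : Prop :=
  List.Shortlex (fun x y : Letter => x.rank < y.rank) v v'

/-- `v` is the length-lexicographically first word representing `g`. -/
def IsLlnf (p q : ℕ) (g : BS p q) (v : List Letter) : Prop :=
  wordVal p q v = g ∧ ∀ v', wordVal p q v' = g → ¬ LenLexLt v' v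

/-- The length-lexicographic normal form. -/
noncomputable def llnf (p q : ℕ) (g : BS p q) : List Letter :=
  Classical.epsilon (IsLlnf p q g)

/-! ### The free product `ℤ * {t, T}*` -/

inductive Dir
  | t
  | T
  deriving DecidableEq

def Dir.sign : Dir → ℤ
  | .t => 1
  | .T => -1

def Dir.bar : Dir → Dir
  | .t => .T
  | .T => .t

def Dir.letter : Dir → Letter
  | .t => .t
  | .T => .T

/-- Elements `α₀ θ₁ α₁ ⋯ θₖ αₖ` of `ℤ * {t, T}*`: `single α` is the integer `α`, and
`cons α θ u` is `α θ u`. -/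
inductive ZWord
  | single (α : ℤ)
  | cons (α : ℤ) (θ : Dir) (u : ZWord)
  deriving DecidableEq

namespace ZWord

/-- The sequence `θ₁, …, θₖ`. -/
def dirs : ZWord → List Dir
  | single _ => []
  | cons _ θ u => θ :: u.dirs

/-- The sequence `α₀, …, αₖ`. -/
def coeffs : ZWord → List ℤ
  | single α => [α]
  | cons α _ u => α :: u.coeffs

/-- The integer `αₖ`. -/
def last : ZWord → ℤ
  | single α => α
  | cons _ _ u => u.last

/-- The product `ρ u` of an integer `ρ` and `u`. -/
def lmul (ρ : ℤ) : ZWord → ZWord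
  | single α => single (ρ + α)
  | cons α θ u => cons (ρ + α) θ u

/-- The product in `ℤ * {t, T}*`. -/
def mul : ZWord → ZWord → ZWord
  | single α, v => v.lmul α
  | cons α θ u, v => cons α θ (u.mul v)

instance : Mul ZWord := ⟨mul⟩

/-- The group element represented by `u`. -/
def val (p q : ℕ) : ZWord → BS p q
  | single α => bsA p q ^ α
  | cons α θ u => bsA p q ^ α * bsT p q ^ θ.sign * u.val p q

/-- The norm `k + ‖α₀‖ + ⋯ + ‖αₖ‖`, where `‖α‖` is the geodesic length of `a^α`. -/
noncomputable def norm (p q : ℕ) : ZWord → ℕ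
  | single α => geoLen p q (bsA p q ^ α)
  | cons α _ u => geoLen p q (bsA p q ^ α) + 1 + u.norm p q

/-- `θ_i`, if `1 ≤ i ≤ k`. -/
def dirAt (u : ZWord) : ℕ → Option Dir
  | 0 => none
  | i + 1 => u.dirs[i]?

/-- The number of sinks, i.e. of positions `0 ≤ i ≤ k` with `θ_i ≠ t` and `θ_{i+1} ≠ T`
(where `θ_0` and `θ_{k+1}` are undefined, hence different from `t` and `T`). -/
def sinks (u : ZWord) : ℕ :=
  ((Finset.range (u.dirs.length + 1)).filter
    (fun i => u.dirAt i ≠ some Dir.t ∧ u.dirAt (i + 1) ≠ some Dir.T)).card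

/-- No factor `t (μp) T` or `T (μq) t` occurs. -/
def BrittonReduced (p q : ℕ) : ZWord → Prop
  | single _ => True
  | cons _ _ (single _) => True
  | cons _ θ (cons β θ' u) =>
      ¬ (θ = Dir.t ∧ θ' = Dir.T ∧ (p : ℤ) ∣ β) ∧
      ¬ (θ = Dir.T ∧ θ' = Dir.t ∧ (q : ℤ) ∣ β) ∧
      BrittonReduced p q (cons β θ' u)

/-- The height of position `i`: the number of `t` minus the number of `T` among `θ₁, …, θᵢ`. -/
def heightAt (u : ZWord) (i : ℕ) : ℤ := ((u.dirs.take i).map Dir.sign).sum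

/-- The peak: the largest position at which the height is maximal. -/
def peak (u : ZWord) : ℕ :=
  Nat.findGreatest
    (fun i => ∀ j, j ≤ u.dirs.length → u.heightAt j ≤ u.heightAt i) u.dirs.length

/-- The height of `u`: the maximal height of a position. -/
def height (u : ZWord) : ℤ := u.heightAt u.peak

/-- Valleys (for Britton-reduced `u`): height `0`, and the last position has height `0`. -/
def IsValley (u : ZWord) : Prop := u.height = 0 ∧ u.heightAt u.dirs.length = 0

/-- Standard valleys `α₁ θ₁ ⋯ αₖ θₖ β`: Britton-reduced valleys with `β = 0`, `|αᵢ| < q`, and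
`|αᵢ| < p` if `θᵢ = T`. -/
structure IsStandardValley (p q : ℕ) (u : ZWord) : Prop where
  reduced : u.BrittonReduced p q
  valley : u.IsValley
  last_eq : u.last = 0
  bounds : ∀ x ∈ u.coeffs.zip u.dirs, |x.1| < (q : ℤ) ∧ (x.2 = Dir.T → |x.1| < (p : ℤ))

end ZWord

/-! ### Peak normal forms -/

/-- The alphabet `Δ = {t, T} ∪ ℤ`. -/
inductive DSym
  | dir (θ : Dir)
  | int (α : ℤ)
  deriving DecidableEq

def DSym.bar : DSym → DSym
  | .dir θ => .dir θ.bar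
  | .int α => .int (-α)

/-- The strict order on `Δ`: `t < T < α` for all integers `α`; integers are ordered by absolute
value, and of `α` and `-α` the nonnegative one comes first. -/
def DSym.Lt : DSym → DSym → Prop
  | .dir θ, .dir θ' => θ = Dir.t ∧ θ' = Dir.T
  | .dir _, .int _ => True
  | .int _, .dir _ => False
  | .int α, .int β => |α| < |β| ∨ (|α| = |β| ∧ β < α)

/-- The length-lexicographic (strict) order on words over `Δ`. -/
def DeltaLt (x y : List DSym) : Prop := List.Shortlex DSym.Lt x y

namespace ZWord

/-- The part `u₁ = α₀ θ₁ α₁ ⋯ α_{i-1} θ_i` of `u = u₁ α_i u₂`, where `i` is the peak. -/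
def leftPart (u : ZWord) : List DSym :=
  ((u.coeffs.zip u.dirs).take u.peak).flatMap (fun x => [DSym.int x.1, DSym.dir x.2])

/-- The part `u₂ = θ_{i+1} α_{i+1} ⋯ θ_k α_k` of `u = u₁ α_i u₂`, where `i` is the peak. -/
def rightPart (u : ZWord) : List DSym :=
  ((u.dirs.zip u.coeffs.tail).drop u.peak).flatMap (fun x => [DSym.dir x.1, DSym.int x.2])

/-- The formal inverse of `u₂`. -/
def rightPartBar (u : ZWord) : List DSym := (u.rightPart.map DSym.bar).reverse

/-- First compare `u₁`, then the formal inverse of `u₂`. -/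
def PeakLt (u u' : ZWord) : Prop :=
  DeltaLt u.leftPart u'.leftPart ∨
    (u.leftPart = u'.leftPart ∧ DeltaLt u.rightPartBar u'.rightPartBar)

/-- `u` is a Britton-reduced form of `g` whose norm is the geodesic length of `g`. -/
def IsMinimalFor (p q : ℕ) (g : BS p q) (u : ZWord) : Prop :=
  u.BrittonReduced p q ∧ u.val p q = g ∧ u.norm p q = geoLen p q g

/-- `u` is the Britton peak normal form of `g`. -/
def IsBrittonPnf (p q : ℕ) (g : BS p q) (u : ZWord) : Prop :=
  u.IsMinimalFor p q g ∧ ∀ u' : ZWord, u'.IsMinimalFor p q g → ¬ PeakLt u' u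

/-- The word `llnf(α₀) θ₁ llnf(α₁) ⋯ θₖ llnf(αₖ)`. -/
noncomputable def expand (p q : ℕ) : ZWord → List Letter
  | single α => llnf p q (bsA p q ^ α)
  | cons α θ u => llnf p q (bsA p q ^ α) ++ θ.letter :: u.expand p q

end ZWord

/-- The peak normal form of (any word representing) `g`. -/
noncomputable def pnf (p q : ℕ) (g : BS p q) : List Letter :=
  (haveI : Nonempty ZWord := ⟨ZWord.single 0⟩
   Classical.epsilon (ZWord.IsBrittonPnf p q g)).expand p q

/-- Multiplication of a Britton-reduced `u` by a letter `θ` from the left, followed by a Britton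
reduction step if one has become possible. -/
def ZWord.pushDir (p q : ℕ) : Dir → ZWord → ZWord
  | .t, .cons β .T u =>
      if (p : ℤ) ∣ β then u.lmul (β / p * q) else .cons 0 .t (.cons β .T u)
  | .T, .cons β .t u =>
      if (q : ℤ) ∣ β then u.lmul (β / q * p) else .cons 0 .T (.cons β .t u)
  | θ, u => .cons 0 θ u

/-- A Britton reduction of a word over the four letters, carried out from right to left. For a
geodesic word `x₀ θ₁ x₁ ⋯ θₖ xₖ` with `xᵢ` horocyclic, `xᵢ = a^(αᵢ)` in the group, and
`α₀ θ₁ α₁ ⋯ θₖ αₖ` Britton-reduced, this is `α₀ θ₁ α₁ ⋯ θₖ αₖ`. -/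
def britton (p q : ℕ) : List Letter → ZWord
  | [] => .single 0
  | .a :: v => (britton p q v).lmul 1
  | .A :: v => (britton p q v).lmul (-1)
  | .t :: v => (britton p q v).pushDir p q Dir.t
  | .T :: v => (britton p q v).pushDir p q Dir.T

/-- The (strict, total) order on words in which peak normal forms are minimal: first compare the
lengths, then the Britton reductions as for Britton peak normal forms (first `u₁`, then the formal
inverse of `u₂`), then lexicographically. -/
def WordLt (p q : ℕ) (v v' : List Letter) : Prop :=
  v.length < v'.length ∨
    (v.length = v'.length ∧
      ((britton p q v).PeakLt (britton p q v') ∨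
        ((britton p q v).leftPart = (britton p q v').leftPart ∧
          (britton p q v).rightPartBar = (britton p q v').rightPartBar ∧
          LexLt v v')))

/-- `v` is the minimum of the set `S` of words. -/
def IsMinWord (p q : ℕ) (v : List Letter) (S : Set (List Letter)) : Prop :=
  v ∈ S ∧ ∀ v' ∈ S, ¬ WordLt p q v' v

/-! ### The range of a standard valley -/

/-- `InRange p q V ρ` says `ρ ∈ R(V)`. The range is defined along the decompositions of a
standard valley: `V = 0`, `V = U W` with `U ≠ 0 ≠ W`, and `V = α T U β t`. -/
inductive InRange (p q : ℕ) : ZWord → ℤ → Prop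
  | zero : InRange p q (.single 0) 0
  | mul (U W : ZWord) (σ τ : ℤ) (hU : U ≠ .single 0) (hW : W ≠ .single 0)
      (hσ : InRange p q U σ) (hτ : InRange p q W τ) : InRange p q (U * W) (σ + τ)
  | nest (U : ZWord) (α β σ ε α' μ β' : ℤ) (hσ : InRange p q U σ)
      (hα : α = ε * p + α') (hα' : |α'| < (p : ℤ))
      (hβ : σ + ε * q + β = μ * q + β') (hβ' : |β'| < (q : ℤ)) :
      InRange p q (.cons α .T (U * .cons β .t (.single 0))) (μ * p)

/-! ### The machine model: unit-cost random access machine with bounded word size -/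

/-- Arithmetic operations; `quo` and `rem` are Euclidean division with remainder on `ℤ`. -/
inductive ArithOp
  | plus
  | minus
  | times
  | quo
  | rem

def ArithOp.eval : ArithOp → ℤ → ℤ → ℤ
  | .plus, x, y => x + y
  | .minus, x, y => x - y
  | .times, x, y => x * y
  | .quo, x, y => x / y
  | .rem, x, y => x % y

/-- A memory state: integer registers, integer arrays (a program refers to finitely many registers
and arrays), and the output written so far. -/
structure Mem where
  reg : ℕ → ℤ
  arr : ℕ → ℤ → ℤ
  out : List ℤ

def Mem.setReg (m : Mem) (x : ℕ) (c : ℤ) : Mem :=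
  { m with reg := Function.update m.reg x c }

def Mem.setArr (m : Mem) (b : ℕ) (i c : ℤ) : Mem :=
  { m with arr := Function.update m.arr b (Function.update (m.arr b) i c) }

/-- Programs. Registers `x y z : ℕ` and arrays `b : ℕ` are fixed in the program text. -/
inductive Prog
  | skip
  | const (x : ℕ) (c : ℤ)
  | arith (o : ArithOp) (x y z : ℕ)
  | load (x b i : ℕ)
  | store (b i x : ℕ)
  | emit (x : ℕ)
  | seq (P Q : Prog)
  | ifLt (x y : ℕ) (P Q : Prog)
  | whileLt (x y : ℕ) (P : Prog)

/-- `Run W P m n m'`: started in state `m`, the program `P` halts in state `m'` after `n` steps,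
where no integer of absolute value larger than `W` is computed. Every elementary instruction and
every evaluation of a test `x < y` is one step. -/
inductive Run (W : ℤ) : Prog → Mem → ℕ → Mem → Prop
  | skip (m) : Run W .skip m 1 m
  | const (m x c) (h : |c| ≤ W) : Run W (.const x c) m 1 (m.setReg x c)
  | arith (m o x y z) (h : |ArithOp.eval o (m.reg y) (m.reg z)| ≤ W) :
      Run W (.arith o x y z) m 1 (m.setReg x (ArithOp.eval o (m.reg y) (m.reg z)))
  | load (m x b i) : Run W (.load x b i) m 1 (m.setReg x (m.arr b (m.reg i)))
  | store (m b i x) : Run W (.store b i x) m 1 (m.setArr b (m.reg i) (m.reg x))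
  | emit (m x) : Run W (.emit x) m 1 { m with out := m.out ++ [m.reg x] }
  | seq (m₁ m₂ m₃ P Q n n') (h : Run W P m₁ n m₂) (h' : Run W Q m₂ n' m₃) :
      Run W (.seq P Q) m₁ (n + n') m₃
  | ifTrue (m m' x y P Q n) (hlt : m.reg x < m.reg y) (h : Run W P m n m') :
      Run W (.ifLt x y P Q) m (n + 1) m'
  | ifFalse (m m' x y P Q n) (hge : ¬ m.reg x < m.reg y) (h : Run W Q m n m') :
      Run W (.ifLt x y P Q) m (n + 1) m'
  | whileDone (m x y P) (hge : ¬ m.reg x < m.reg y) : Run W (.whileLt x y P) m 1 m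
  | whileStep (m₁ m₂ m₃ x y P n n') (hlt : m₁.reg x < m₁.reg y) (h : Run W P m₁ n m₂)
      (h' : Run W (.whileLt x y P) m₂ n' m₃) : Run W (.whileLt x y P) m₁ (n + n' + 1) m₃

/-- The initial state for the input `α₀ θ₁ α₁ ⋯ θₖ αₖ`: register `0` holds `k`, array `0` holds
`α₀, …, αₖ` from address `0` on, array `1` holds `θ₁, …, θₖ` (coded by `1` for `t` and `-1` for
`T`) from address `0` on, and everything else is `0`. -/
def inputMem (u : ZWord) : Mem where
  reg := fun x => if x = 0 then (u.dirs.length : ℤ) else 0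
  arr := fun b i =>
    if 0 ≤ i then
      if b = 0 then u.coeffs.getD i.toNat 0
      else if b = 1 then (u.dirs.map Dir.sign).getD i.toNat 0
      else 0
    else 0
  out := []

/-- The output for a list of integers `ρ` and a family of words `V_ρ`: for each `ρ` in turn, the
integer `ρ`, the length of `V_ρ`, and the letters of `V_ρ` (coded by `0, 1, 2, 3`). -/
def outputCode (L : List ℤ) (Vf : ℤ → List Letter) : List ℤ :=
  L.flatMap (fun ρ => ρ :: ((Vf ρ).length : ℤ) :: (Vf ρ).map (fun x => (x.rank : ℤ)))

/-!
The group `BS(p, q)` is the HNN extension of `⟨a⟩ ≅ ℤ` whose stable letter `t` conjugates `a ^ p`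
to `a ^ q`. By Britton's lemma, two Britton-reduced words with the same value have the same letters
`t`, `T`, and they differ only by multiples of `p` and `q` that are moved across these letters
(`ZWord.shift_of_val_eq`).

**Splitting off the valley.** A valley `V` that is followed by `w`, where `t w` is Britton-reduced,
lies before the peak of `V w`. A multiple of `q` before `t` can be moved across this letter, and
since `p ∣ q`, a multiple of `p` can be moved across a whole valley. Both moves go towards the peak
and do not increase the length, so that in a Britton peak normal form the integers before the peak
satisfy the bounds of a standard valley (`ZWord.IsBrittonPnf.bounded`). Hence the normal form of
`V w` starts with a word `V'` that satisfies these bounds and that equals `V a ^ (-p r)` for some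
`r`. Such a `V'` is called a bounded representation of `V` (`Valley.Rep`); the exponents `p r` that
occur are exactly the elements of the range (`Valley.inRange_iff`). It follows that the normal form
of `V w` is `V_ρ` followed by that of `a ^ ρ w`, for some `ρ` in the range and `V_ρ` the normal
form of `V a ^ (-ρ)` (`Valley.exists_pnf_split`). As all the words `V_ρ pnf(ρ w)` represent `V w`,
and the normal form is a minimal word for its value (`not_wordLt_pnf`), the minimum formula
results.

**Computing the words `V_ρ`.** The normal form of `V a ^ (-p r)` is a bounded representation `V'`
with some exponent `p r'`, followed by the normal form of `a ^ (p (r' - r))`. Among these words the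
one is sought that minimizes first the norm and then `V'` in the order of the sequences over `Δ`.
Both criteria are put into one integer, the norm times `(2 q) ^ k` plus a numeral in base `2 q`
whose digits give the integers of `V'` (`Valley.isBrittonPnf_of_minimal`). Such keys are additive
once each digit is weighted by its position (`listKey`). Viewing `V` as a binary tree (`Valley`),
the minimal key for each exponent is computed by a single scan from left to right with a stack of
tables: a letter `T` starts a new table, and a letter `t` combines the two topmost ones
(`loopTo_valley`, `exec_scan`). As `2 p ≤ q`, a valley with `n` sinks has only exponents `p r` with
`|r| ≤ 6 n` (`KeyBound`), and a combination has only boundedly many carries, so combining two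
tables costs the product of their sizes. Summed up over the binary tree this is `O(s (k + s))` for
`k` letters and `s` sinks (`combCount_le`, `Valley.size_le_sinks`).

The normal forms of the powers `a ^ n` that occur are computed one after another: for large `|n|`
it is one of two words `t a ^ (p m) T a ^ (n - q m)` (`aNf_eq_hopWord`), since a factor `T y t` of
a geodesic never represents a power of `a`. From the keys the words are decoded digit by digit
(`exec_output`). All integers have `O(k + 1)` bits (`exists_wordSize`).

Programs are written with integer expressions instead of three-address instructions, and `Exec`
records their effect, their number of steps and the size of the integers.
-/


/-! ### Baumslag–Solitar groups as HNN extensions -/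

/-- The exponent `θ.lhs` with `a ^ θ.lhs θ = θ a ^ θ.rhs`: `q` for `t` and `p` for `T`. -/
def Dir.lhs (p q : ℕ) : Dir → ℤ
  | .t => q
  | .T => p

/-- The exponent `θ.rhs` with `a ^ θ.lhs θ = θ a ^ θ.rhs`: `p` for `t` and `q` for `T`. -/
def Dir.rhs (p q : ℕ) : Dir → ℤ
  | .t => p
  | .T => q

/-- The exponent `±1` of `θ`, as a unit. -/
def Dir.unit : Dir → ℤˣ
  | .t => 1
  | .T => -1

@[simp] lemma Dir.lhs_t (p q : ℕ) : Dir.t.lhs p q = q := rfl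
@[simp] lemma Dir.lhs_T (p q : ℕ) : Dir.T.lhs p q = p := rfl
@[simp] lemma Dir.rhs_t (p q : ℕ) : Dir.t.rhs p q = p := rfl
@[simp] lemma Dir.rhs_T (p q : ℕ) : Dir.T.rhs p q = q := rfl

section Group

variable {p q : ℕ}

lemma bsT_mul_bsA (p q : ℕ) : bsT p q * bsA p q ^ p = bsA p q ^ q * bsT p q := by
  have h : bsT p q * bsA p q ^ p * (bsT p q)⁻¹ * (bsA p q ^ q)⁻¹ = 1 := by
    have := PresentedGroup.one_of_mem (rels := bsRels p q)
      (x := FreeGroup.of Gen.t * FreeGroup.of Gen.a ^ p * (FreeGroup.of Gen.t)⁻¹ *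
        (FreeGroup.of Gen.a ^ q)⁻¹) rfl
    simpa [bsT, bsA, PresentedGroup.of] using this
  rw [mul_inv_eq_one, mul_inv_eq_iff_eq_mul] at h
  exact h

lemma bsT_mul_bsA_zpow (p q : ℕ) (μ : ℤ) :
    bsT p q * bsA p q ^ (p * μ) = bsA p q ^ (q * μ) * bsT p q := by
  have h : SemiconjBy (bsT p q) (bsA p q ^ p) (bsA p q ^ q) := bsT_mul_bsA p q
  have := h.zpow_right μ
  rw [← zpow_natCast, ← zpow_natCast, ← zpow_mul, ← zpow_mul] at this
  exact this

/-- Multiples of `θ.lhs` move across `θ`. -/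
lemma zpow_mul_dir (θ : Dir) (μ : ℤ) :
    bsA p q ^ (μ * θ.lhs p q) * bsT p q ^ θ.sign = bsT p q ^ θ.sign * bsA p q ^ (μ * θ.rhs p q) := by
  have h := bsT_mul_bsA_zpow p q μ
  cases θ
  · simp only [Dir.sign, zpow_one, Dir.lhs, Dir.rhs]
    rw [mul_comm μ, mul_comm μ, h]
  · simp only [Dir.sign, zpow_neg, zpow_one, Dir.lhs, Dir.rhs]
    rw [mul_inv_eq_iff_eq_mul, mul_assoc, eq_inv_mul_iff_mul_eq, mul_comm μ, mul_comm μ, h]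

lemma zpowGroupHom_int_injective {n : ℕ} (hn : n ≠ 0) :
    Function.Injective (zpowGroupHom (α := Multiplicative ℤ) n) := by
  intro x y h
  have : (n : ℤ) * x.toAdd = n * y.toAdd := by simpa using congrArg Multiplicative.toAdd h
  exact Multiplicative.toAdd.injective (mul_left_cancel₀ (by exact_mod_cast hn) this)

/-- The isomorphism `a ^ p ↦ a ^ q` between the associated subgroups. -/
noncomputable def assocEquiv (hp : p ≠ 0) (hq : q ≠ 0) :
    (zpowGroupHom (α := Multiplicative ℤ) p).range ≃*
      (zpowGroupHom (α := Multiplicative ℤ) q).range :=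
  (MonoidHom.ofInjective (zpowGroupHom_int_injective hp)).symm.trans
    (MonoidHom.ofInjective (zpowGroupHom_int_injective hq))

lemma assocEquiv_apply (hp : p ≠ 0) (hq : q ≠ 0) (x : Multiplicative ℤ) :
    (assocEquiv hp hq ⟨zpowGroupHom p x, x, rfl⟩ : Multiplicative ℤ) = x ^ q := by
  have : (⟨zpowGroupHom p x, x, rfl⟩ : (zpowGroupHom (α := Multiplicative ℤ) p).range) =
      MonoidHom.ofInjective (zpowGroupHom_int_injective hp) x := rfl
  rw [this]
  simp only [assocEquiv, MulEquiv.trans_apply, MulEquiv.symm_apply_apply]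
  rw [MonoidHom.ofInjective_apply]
  simp

/-- The HNN extension isomorphic to `BS p q`. -/
abbrev BSHNN (hp : p ≠ 0) (hq : q ≠ 0) : Type :=
  HNNExtension (Multiplicative ℤ) _ _ (assocEquiv (p := p) (q := q) hp hq)

/-- The homomorphism to the HNN extension that sends `a` to the generator of the base group and `t`
to the stable letter. Its injectivity is not needed. -/
noncomputable def toHNN (hp : p ≠ 0) (hq : q ≠ 0) : BS p q →* BSHNN hp hq :=
  PresentedGroup.toGroup (rels := bsRels p q)
    (f := fun g => match g with
      | .a => HNNExtension.of (Multiplicative.ofAdd 1)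
      | .t => HNNExtension.t) (by
    intro r hr
    rw [bsRels, Set.mem_singleton_iff] at hr
    subst hr
    have h := HNNExtension.t_mul_of (φ := assocEquiv hp hq)
      ⟨zpowGroupHom (p : ℤ) (Multiplicative.ofAdd 1), Multiplicative.ofAdd 1, rfl⟩
    rw [assocEquiv_apply] at h
    simp only [zpowGroupHom_apply, zpow_natCast, map_pow] at h
    simp only [map_mul, map_pow, map_inv, FreeGroup.lift_apply_of]
    rw [h]
    group)

lemma toHNN_a (hp : p ≠ 0) (hq : q ≠ 0) (α : ℤ) :
    toHNN hp hq (bsA p q ^ α) = HNNExtension.of (Multiplicative.ofAdd α) := by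
  have h : toHNN hp hq (bsA p q) = HNNExtension.of (Multiplicative.ofAdd 1) := by
    simp [toHNN, bsA, PresentedGroup.toGroup.of]
  rw [map_zpow, h, ← map_zpow, ← ofAdd_zsmul]
  simp

lemma toHNN_t (hp : p ≠ 0) (hq : q ≠ 0) :
    toHNN hp hq (bsT p q) = HNNExtension.t := by
  simp [toHNN, bsT, PresentedGroup.toGroup.of]

end Group

namespace ZWord

variable {p q : ℕ}

/-- The integer `α₀`. -/
def head : ZWord → ℤ
  | single α => α
  | cons α _ _ => α

/-- The list of pairs `(θᵢ, αᵢ)` in the format of `HNNExtension.NormalWord.ReducedWord`. -/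
def hnnList : ZWord → List (ℤˣ × Multiplicative ℤ)
  | single _ => []
  | cons _ θ u => (θ.unit, Multiplicative.ofAdd u.head) :: u.hnnList

lemma mem_range_zpow {n : ℕ} {x : ℤ} :
    Multiplicative.ofAdd x ∈ (zpowGroupHom (α := Multiplicative ℤ) n).range ↔ (n : ℤ) ∣ x := by
  constructor
  · rintro ⟨y, hy⟩
    exact ⟨y.toAdd, by simpa using (congrArg Multiplicative.toAdd hy).symm⟩
  · rintro ⟨y, rfl⟩
    exact ⟨Multiplicative.ofAdd y, by simp [← ofAdd_nsmul]⟩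

/-- Britton-reduced words satisfy the condition on reduced words of the HNN extension. -/
lemma hnnList_chain {u : ZWord} (h : u.BrittonReduced p q) :
    u.hnnList.IsChain (fun a b => a.2 ∈ HNNExtension.toSubgroup
      (zpowGroupHom (α := Multiplicative ℤ) p).range
      (zpowGroupHom (α := Multiplicative ℤ) q).range a.1 → a.1 = b.1) := by
  match u, h with
  | single _, _ => simp [hnnList]
  | cons _ _ (single _), _ => simp [hnnList]
  | cons α θ (cons β θ' u), h =>
    have ih := hnnList_chain h.2.2
    have h1 := h.1
    have h2 := h.2.1
    rw [hnnList, hnnList]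
    rw [hnnList] at ih
    refine List.isChain_cons_cons.2 ⟨?_, ih⟩
    cases θ <;> cases θ'
    · exact fun _ => rfl
    · exact fun h => absurd ⟨rfl, rfl, mem_range_zpow.1 h⟩ h1
    · exact fun h => absurd ⟨rfl, rfl, mem_range_zpow.1 h⟩ h2
    · exact fun _ => rfl

lemma toHNN_val (hp : p ≠ 0) (hq : q ≠ 0) (u : ZWord) :
    toHNN hp hq (u.val p q) = HNNExtension.of (Multiplicative.ofAdd u.head) *
      (u.hnnList.map (fun x => HNNExtension.t ^ (x.1 : ℤ) * HNNExtension.of x.2)).prod := by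
  induction u with
  | single α => simp [val, hnnList, head, ← toHNN_a hp hq]
  | cons α θ u ih =>
    rw [val, map_mul, map_mul, ih, toHNN_a]
    simp only [hnnList, List.map_cons, List.prod_cons, head]
    cases θ <;> simp [Dir.sign, Dir.unit, toHNN_t, mul_assoc]

/-- `Shift c u v`: the words `a ^ c u` and `v` have the same directions, and `v` arises from
`a ^ c u` by moving multiples across the directions from left to right. -/
def Shift (p q : ℕ) : ℤ → ZWord → ZWord → Prop
  | c, single α, single β => β = c + α
  | c, cons α θ u, cons β θ' v =>
      θ = θ' ∧ ∃ μ : ℤ, c + α = β + μ * θ.lhs p q ∧ Shift p q (μ * θ.rhs p q) u v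
  | _, _, _ => False

/-- The words of a shift have the same value, up to the multiple that is moved out in front. -/
lemma Shift.val_eq {c : ℤ} {u v : ZWord} (h : Shift p q c u v) :
    v.val p q = bsA p q ^ c * u.val p q := by
  induction u generalizing c v with
  | single α =>
    cases v with
    | single β => rw [Shift] at h; subst h; simp [val, zpow_add]
    | cons β θ v => exact h.elim
  | cons α θ u ih =>
    cases v with
    | single β => exact h.elim
    | cons β θ' v =>
      obtain ⟨rfl, μ, hμ, h⟩ := h
      rw [val, val, ih h, ← mul_assoc, mul_assoc (bsA p q ^ β), ← zpow_mul_dir, ← mul_assoc,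
        ← zpow_add, ← hμ, zpow_add]
      simp only [mul_assoc]

lemma Shift.dirs_eq {c : ℤ} {u v : ZWord} (h : Shift p q c u v) : v.dirs = u.dirs := by
  induction u generalizing c v with
  | single α => cases v with
    | single β => rfl
    | cons β θ v => exact h.elim
  | cons α θ u ih =>
    cases v with
    | single β => exact h.elim
    | cons β θ' v =>
      obtain ⟨rfl, μ, hμ, h⟩ := h
      rw [dirs, dirs, ih h]

lemma BrittonReduced.tail {α : ℤ} {θ : Dir} {u : ZWord} (h : (cons α θ u).BrittonReduced p q) :
    u.BrittonReduced p q := by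
  cases u with
  | single => trivial
  | cons => exact h.2.2

lemma BrittonReduced.head_congr {α β : ℤ} {θ : Dir} {u : ZWord}
    (h : (cons α θ u).BrittonReduced p q) : (cons β θ u).BrittonReduced p q := by
  cases u with
  | single => trivial
  | cons => exact h

/-- Being Britton-reduced is invariant under moving multiples across the directions. -/
lemma Shift.brittonReduced {c : ℤ} {u v : ZWord} (h : Shift p q c u v)
    (hu : u.BrittonReduced p q) : v.BrittonReduced p q := by
  induction u generalizing c v with
  | single α => cases v with
    | single β => trivial
    | cons β θ v => exact h.elim
  | cons α θ u ih =>
    cases v with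
    | single β => exact h.elim
    | cons β θ' v =>
      obtain ⟨rfl, μ, hμ, h⟩ := h
      have ihv := ih h hu.tail
      cases u with
      | single => cases v with
        | single => trivial
        | cons => exact h.elim
      | cons α' θ' u =>
        cases v with
        | single => exact h.elim
        | cons β' θ'' v =>
          obtain ⟨rfl, ν, hν, h⟩ := h
          refine ⟨?_, ?_, ihv⟩
          · rintro ⟨rfl, rfl, hd⟩
            apply hu.1
            refine ⟨rfl, rfl, ?_⟩
            simp only [Dir.lhs_T, Dir.rhs_t] at hν
            rw [show α' = β' + ν * p - μ * p by linarith]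
            exact Dvd.dvd.sub (dvd_add hd (dvd_mul_left _ _)) (dvd_mul_left _ _)
          · rintro ⟨rfl, rfl, hd⟩
            apply hu.2.1
            refine ⟨rfl, rfl, ?_⟩
            simp only [Dir.lhs_t, Dir.rhs_T] at hν
            rw [show α' = β' + ν * q - μ * q by linarith]
            exact Dvd.dvd.sub (dvd_add hd (dvd_mul_left _ _)) (dvd_mul_left _ _)

/-- Britton's lemma: Britton-reduced words with the same value differ only by moving multiples
across the directions. -/
lemma shift_of_val_eq (hp : p ≠ 0) (hq : q ≠ 0) {c : ℤ} {u v : ZWord}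
    (hu : u.BrittonReduced p q) (hv : v.BrittonReduced p q)
    (h : v.val p q = bsA p q ^ c * u.val p q) : Shift p q c u v := by
  have key : ∀ (c : ℤ) {u v : ZWord}, u.BrittonReduced p q → v.BrittonReduced p q →
      v.val p q = bsA p q ^ c * u.val p q →
      u.hnnList.map Prod.fst = v.hnnList.map Prod.fst ∧
      ∀ e ∈ u.hnnList.head?.map Prod.fst, (Multiplicative.ofAdd (c + u.head))⁻¹ *
        Multiplicative.ofAdd v.head ∈ HNNExtension.toSubgroup
          (zpowGroupHom (α := Multiplicative ℤ) p).range
          (zpowGroupHom (α := Multiplicative ℤ) q).range (-e) := by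
    intro c u v hu hv h
    have := HNNExtension.ReducedWord.map_fst_eq_and_of_prod_eq (assocEquiv hp hq)
      (w₁ := ⟨Multiplicative.ofAdd (c + u.head), u.hnnList, hnnList_chain hu⟩)
      (w₂ := ⟨Multiplicative.ofAdd v.head, v.hnnList, hnnList_chain hv⟩) (by
        simp only [HNNExtension.NormalWord.ReducedWord.prod]
        rw [← toHNN_val hp hq, h, map_mul, toHNN_val, toHNN_a, ← mul_assoc, ← map_mul]
        rfl)
    exact this
  induction u generalizing c v with
  | single α =>
    have hk := key c hu hv h
    cases v with
    | single β =>
      have h2 := congrArg (toHNN hp hq) h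
      rw [map_mul, val, val, toHNN_a, toHNN_a, toHNN_a, ← map_mul] at h2
      exact Multiplicative.ofAdd.injective (HNNExtension.of_injective _ h2)
    | cons β θ v => simp [hnnList] at hk
  | cons α θ u ih =>
    have hk := key c hu hv h
    cases v with
    | single β => simp [hnnList] at hk
    | cons β θ' v =>
      have hθ : θ = θ' := by
        have := hk.1
        simp only [hnnList, List.map_cons, List.cons.injEq] at this
        cases θ <;> cases θ' <;> first | rfl | simp [Dir.unit] at this
      subst hθ
      have h2 : θ.lhs p q ∣ c + α - β := by
        have h3 : Multiplicative.ofAdd (β - (c + α)) ∈ HNNExtension.toSubgroup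
          (zpowGroupHom (α := Multiplicative ℤ) p).range
          (zpowGroupHom (α := Multiplicative ℤ) q).range
            (-θ.unit) := by
          have := hk.2 _ rfl
          rwa [← ofAdd_neg, ← ofAdd_add, neg_add_eq_sub] at this
        rw [dvd_sub_comm]
        cases θ
        · exact mem_range_zpow.1 h3
        · rw [Dir.unit, neg_neg] at h3
          exact mem_range_zpow.1 h3
      obtain ⟨μ, hμ⟩ := h2
      refine ⟨rfl, μ, by rw [mul_comm]; omega, ih hu.tail hv.tail ?_⟩
      rw [val, val] at h
      rw [← mul_right_inj (bsA p q ^ β * bsT p q ^ θ.sign), h,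
        mul_assoc (bsA p q ^ β), ← mul_assoc (bsT p q ^ θ.sign), ← zpow_mul_dir,
        show α = -c + (β + μ * θ.lhs p q) by rw [mul_comm]; omega, zpow_add, zpow_add]
      simp [mul_assoc]

end ZWord

/-! ### Geodesic length -/

section Words

variable {p q : ℕ}

@[simp] lemma wordVal_nil : wordVal p q [] = 1 := rfl

@[simp] lemma wordVal_cons (x : Letter) (v : List Letter) :
    wordVal p q (x :: v) = x.val p q * wordVal p q v := by simp [wordVal]

@[simp] lemma wordVal_append (v w : List Letter) :
    wordVal p q (v ++ w) = wordVal p q v * wordVal p q w := by simp [wordVal]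

/-- The letters generate the group. -/
lemma exists_word (g : BS p q) : ∃ v : List Letter, wordVal p q v = g := by
  obtain ⟨x, rfl⟩ := QuotientGroup.mk_surjective g
  change ∃ v, wordVal p q v = PresentedGroup.mk (bsRels p q) x
  induction x using FreeGroup.induction_on with
  | C1 => exact ⟨[], by simp⟩
  | of x =>
    cases x
    · exact ⟨[.a], by simp [Letter.val, bsA, PresentedGroup.of]⟩
    · exact ⟨[.t], by simp [Letter.val, bsT, PresentedGroup.of]⟩
  | inv_of x _ =>
    cases x
    · exact ⟨[.A], by simp [Letter.val, bsA, PresentedGroup.of]⟩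
    · exact ⟨[.T], by simp [Letter.val, bsT, PresentedGroup.of]⟩
  | mul x y hx hy =>
    obtain ⟨v, hv⟩ := hx
    obtain ⟨w, hw⟩ := hy
    exact ⟨v ++ w, by simp [hv, hw]⟩

lemma geoLen_le {v : List Letter} {g : BS p q} (h : wordVal p q v = g) :
    geoLen p q g ≤ v.length := Nat.sInf_le ⟨v, h, rfl⟩

lemma exists_geodesic (g : BS p q) :
    ∃ v : List Letter, wordVal p q v = g ∧ v.length = geoLen p q g := by
  have : {n | ∃ v : List Letter, wordVal p q v = g ∧ v.length = n}.Nonempty := by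
    obtain ⟨v, hv⟩ := exists_word g
    exact ⟨_, v, hv, rfl⟩
  exact Nat.sInf_mem this

lemma geoLen_mul_le (g h : BS p q) : geoLen p q (g * h) ≤ geoLen p q g + geoLen p q h := by
  obtain ⟨v, hv, hv'⟩ := exists_geodesic g
  obtain ⟨w, hw, hw'⟩ := exists_geodesic h
  rw [← hv', ← hw', ← List.length_append]
  exact geoLen_le (by simp [hv, hw])

@[simp] lemma geoLen_one : geoLen p q 1 = 0 := Nat.le_zero.1 (geoLen_le (v := []) rfl)

/-- The geodesic length of `a ^ n`. -/
noncomputable def aLen (p q : ℕ) (n : ℤ) : ℕ := geoLen p q (bsA p q ^ n)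

@[simp] lemma aLen_zero : aLen p q 0 = 0 := by simp [aLen]

lemma aLen_add_le (m n : ℤ) : aLen p q (m + n) ≤ aLen p q m + aLen p q n := by
  rw [aLen, zpow_add]; exact geoLen_mul_le _ _

/-- The word `a ^ n`, written with `|n|` letters `a` or `A`. -/
def pureWord (n : ℤ) : List Letter := List.replicate n.natAbs (if n < 0 then .A else .a)

@[simp] lemma pureWord_length (n : ℤ) : (pureWord n).length = n.natAbs := by simp [pureWord]

@[simp] lemma wordVal_pureWord (n : ℤ) : wordVal p q (pureWord n) = bsA p q ^ n := by
  rcases lt_or_ge n 0 with h | h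
  · obtain ⟨k, rfl⟩ : ∃ k : ℕ, n = -k := ⟨n.natAbs, by omega⟩
    rw [pureWord, if_pos h]
    simp [wordVal, Letter.val]
  · obtain ⟨k, rfl⟩ : ∃ k : ℕ, n = k := ⟨n.natAbs, by omega⟩
    rw [pureWord, if_neg h.not_gt]
    simp [wordVal, Letter.val]

lemma aLen_le_natAbs (n : ℤ) : aLen p q n ≤ n.natAbs := by
  simpa [aLen] using geoLen_le (wordVal_pureWord (p := p) (q := q) n)

lemma bsT_conj_zpow (m : ℤ) :
    bsT p q * bsA p q ^ (p * m) * (bsT p q)⁻¹ = bsA p q ^ (q * m) := by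
  rw [bsT_mul_bsA_zpow, mul_inv_cancel_right]

lemma bsT_inv_conj_zpow (m : ℤ) :
    (bsT p q)⁻¹ * bsA p q ^ (q * m) * bsT p q = bsA p q ^ (p * m) := by
  rw [← bsT_conj_zpow, mul_assoc, mul_assoc, mul_assoc, inv_mul_cancel, mul_one, inv_mul_cancel_left]

/-- Conjugation by `t` turns `a ^ (p m)` into `a ^ (q m)`. -/
lemma aLen_lhs_le (m : ℤ) : aLen p q (q * m) ≤ 2 + aLen p q (p * m) := by
  obtain ⟨v, hv, hv'⟩ := exists_geodesic (bsA p q ^ (p * m))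
  have := geoLen_le (p := p) (q := q) (v := Letter.t :: v ++ [.T]) (g := bsA p q ^ (q * m))
    (by simp [hv, Letter.val, ← bsT_conj_zpow, mul_assoc])
  simp only [aLen, ← hv']
  simp at this
  omega

namespace ZWord

lemma norm_single (α : ℤ) : (single α).norm p q = aLen p q α := rfl

lemma norm_cons (α : ℤ) (θ : Dir) (u : ZWord) :
    (cons α θ u).norm p q = aLen p q α + 1 + u.norm p q := rfl

@[simp] lemma single_mul (α : ℤ) (v : ZWord) : single α * v = v.lmul α := rfl

@[simp] lemma cons_mul (α : ℤ) (θ : Dir) (u v : ZWord) :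
    cons α θ u * v = cons α θ (u * v) := rfl

@[simp] lemma lmul_zero (u : ZWord) : u.lmul 0 = u := by cases u <;> simp [lmul]

lemma lmul_lmul (a b : ℤ) (u : ZWord) : (u.lmul b).lmul a = u.lmul (a + b) := by
  cases u <;> simp [lmul, add_assoc]

lemma val_lmul (c : ℤ) (u : ZWord) : (u.lmul c).val p q = bsA p q ^ c * u.val p q := by
  cases u <;> simp [lmul, val, zpow_add, mul_assoc]

lemma norm_lmul_le (c : ℤ) (u : ZWord) : (u.lmul c).norm p q ≤ aLen p q c + u.norm p q := by
  cases u with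
  | single α => exact aLen_add_le _ _
  | cons α θ u =>
    have := aLen_add_le (p := p) (q := q) c α
    rw [lmul, norm_cons, norm_cons]; omega

lemma BrittonReduced.lmul {u : ZWord} (h : u.BrittonReduced p q) (c : ℤ) :
    (u.lmul c).BrittonReduced p q := by
  cases u with
  | single => trivial
  | cons α θ u => exact h.head_congr

lemma dirs_lmul (c : ℤ) (u : ZWord) : (u.lmul c).dirs = u.dirs := by cases u <;> rfl

end ZWord

lemma Letter.val_dir (θ : Dir) : (θ.letter).val p q = bsT p q ^ θ.sign := by
  cases θ <;> simp [Dir.letter, Dir.sign, Letter.val]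

open ZWord

/-! ### The Britton reduction of a word -/

/-- `Decomp v u`: the word `v` is `x₀ θ₁ x₁ ⋯ θₖ xₖ` with `xᵢ = a ^ αᵢ` in the group, where
`u = α₀ θ₁ α₁ ⋯ θₖ αₖ`. -/
inductive Decomp (p q : ℕ) : List Letter → ZWord → Prop
  | single (x : List Letter) (α : ℤ) (h : wordVal p q x = bsA p q ^ α) : Decomp p q x (.single α)
  | cons (x v : List Letter) (α : ℤ) (θ : Dir) (u : ZWord) (h : wordVal p q x = bsA p q ^ α)
      (hv : Decomp p q v u) : Decomp p q (x ++ θ.letter :: v) (.cons α θ u)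

lemma Decomp.val_eq {v : List Letter} {u : ZWord} (h : Decomp p q v u) :
    wordVal p q v = u.val p q := by
  induction h with
  | single x α h => exact h
  | cons x v α θ u h _ ih => simp [h, ih, ZWord.val, Letter.val_dir, mul_assoc]

/-- The Britton reduction of a word is not longer than the word. -/
lemma Decomp.norm_le {v : List Letter} {u : ZWord} (h : Decomp p q v u) :
    u.norm p q ≤ v.length := by
  induction h with
  | single x α h => exact geoLen_le h
  | cons x v α θ u h _ ih =>
    have := geoLen_le h
    rw [norm_cons, aLen]
    simp only [List.length_append, List.length_cons]
    omega

lemma Decomp.append {v x : List Letter} {u : ZWord} (h : Decomp p q v u) {c : ℤ}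
    (hx : wordVal p q x = bsA p q ^ c) : Decomp p q (x ++ v) (u.lmul c) := by
  cases h with
  | single y α h => exact .single _ _ (by simp [hx, h, zpow_add])
  | cons y v α θ u h hv =>
    rw [← List.append_assoc]
    exact .cons _ _ _ _ _ (by simp [hx, h, zpow_add]) hv

lemma Decomp.pushDir {v : List Letter} {u : ZWord} (h : Decomp p q v u) (θ : Dir) :
    Decomp p q (θ.letter :: v) (u.pushDir p q θ) := by
  have h0 : Decomp p q (θ.letter :: v) (.cons 0 θ u) := by
    simpa using Decomp.cons [] v 0 θ u (by simp) h
  match θ, u, h with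
  | .t, .single β, _ => exact h0
  | .T, .single β, _ => exact h0
  | .t, .cons β .t u, _ => exact h0
  | .T, .cons β .T u, _ => exact h0
  | .t, .cons β .T u, h =>
    rw [ZWord.pushDir]
    split_ifs with hd
    · obtain ⟨m, rfl⟩ := hd
      cases h with
      | cons y v _ _ _ hy hv =>
        have := hv.append (x := Letter.t :: y ++ [Letter.T]) (c := (p * m : ℤ) / p * q) (by
          rcases eq_or_ne p 0 with rfl | hp
          · simp_all [Letter.val]
          · rw [Int.mul_ediv_cancel_left _ (by exact_mod_cast hp), mul_comm, ← bsT_conj_zpow]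
            simp [Letter.val, hy, mul_assoc])
        simpa [Dir.letter] using this
    · exact h0
  | .T, .cons β .t u, h =>
    rw [ZWord.pushDir]
    split_ifs with hd
    · obtain ⟨m, rfl⟩ := hd
      cases h with
      | cons y v _ _ _ hy hv =>
        have := hv.append (x := Letter.T :: y ++ [Letter.t]) (c := (q * m : ℤ) / q * p) (by
          rcases eq_or_ne q 0 with rfl | hp
          · simp_all [Letter.val]
          · rw [Int.mul_ediv_cancel_left _ (by exact_mod_cast hp), mul_comm, ← bsT_inv_conj_zpow]
            simp [Letter.val, hy, mul_assoc])
        simpa [Dir.letter] using this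
    · exact h0

/-- Each integer of the Britton reduction is represented by a factor of the word. -/
lemma decomp_britton (v : List Letter) : Decomp p q v (britton p q v) := by
  match v with
  | [] => exact .single _ _ (by simp)
  | .a :: v => exact (decomp_britton v).append (x := [.a]) (by simp [Letter.val])
  | .A :: v => exact (decomp_britton v).append (x := [.A]) (by simp [Letter.val])
  | .t :: v => exact (decomp_britton v).pushDir .t
  | .T :: v => exact (decomp_britton v).pushDir .T

lemma ZWord.BrittonReduced.pushDir {u : ZWord} (h : u.BrittonReduced p q) (θ : Dir) :
    (u.pushDir p q θ).BrittonReduced p q := by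
  match θ, u, h with
  | .t, .single β, _ => trivial
  | .T, .single β, _ => trivial
  | .t, .cons β .t u, h => exact ⟨by simp, by simp, h⟩
  | .T, .cons β .T u, h => exact ⟨by simp, by simp, h⟩
  | .t, .cons β .T u, h =>
    rw [ZWord.pushDir]
    split_ifs with hd
    · exact h.tail.lmul _
    · exact ⟨by simp [hd], by simp, h⟩
  | .T, .cons β .t u, h =>
    rw [ZWord.pushDir]
    split_ifs with hd
    · exact h.tail.lmul _
    · exact ⟨by simp, by simp [hd], h⟩

lemma ZWord.BrittonReduced.pushDir_eq {u : ZWord} {α : ℤ} {θ : Dir}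
    (h : (ZWord.cons α θ u).BrittonReduced p q) : u.pushDir p q θ = .cons 0 θ u := by
  match θ, u, h with
  | .t, .single β, _ => rfl
  | .T, .single β, _ => rfl
  | .t, .cons β .t u, h => rfl
  | .T, .cons β .T u, h => rfl
  | .t, .cons β .T u, h =>
    have : ¬ (p : ℤ) ∣ β := fun hd => h.1 ⟨rfl, rfl, hd⟩
    rw [ZWord.pushDir, if_neg this]
  | .T, .cons β .t u, h =>
    have : ¬ (q : ℤ) ∣ β := fun hd => h.2.1 ⟨rfl, rfl, hd⟩
    rw [ZWord.pushDir, if_neg this]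

lemma brittonReduced_britton (v : List Letter) : (britton p q v).BrittonReduced p q := by
  match v with
  | [] => trivial
  | .a :: v => exact (brittonReduced_britton v).lmul _
  | .A :: v => exact (brittonReduced_britton v).lmul _
  | .t :: v => exact (brittonReduced_britton v).pushDir .t
  | .T :: v => exact (brittonReduced_britton v).pushDir .T

lemma britton_eq_single (hp : p ≠ 0) (hq : q ≠ 0) {v : List Letter} {n : ℤ}
    (h : wordVal p q v = bsA p q ^ n) : britton p q v = .single n := by
  have h1 := shift_of_val_eq hp hq (c := 0) (u := .single n) (v := britton p q v) trivial
    (brittonReduced_britton v) (by rw [← (decomp_britton v).val_eq, h]; simp [ZWord.val])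
  cases hb : britton p q v with
  | single β => rw [hb, Shift] at h1; simp [h1]
  | cons β θ u => rw [hb] at h1; exact h1.elim

/-- The first letter of a word representing a power of `a` is `a` or `A`, or it starts a factor
`t y T` or `T y t` that represents a power of `a`. -/
lemma horocyclic_cases (hp : p ≠ 0) (hq : q ≠ 0) {v : List Letter} {n : ℤ}
    (h : wordVal p q v = bsA p q ^ n) :
    (v = [] ∧ n = 0) ∨ (∃ v', v = .a :: v' ∧ wordVal p q v' = bsA p q ^ (n - 1)) ∨
    (∃ v', v = .A :: v' ∧ wordVal p q v' = bsA p q ^ (n + 1)) ∨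
    (∃ y z m, v = .t :: (y ++ .T :: z) ∧ wordVal p q y = bsA p q ^ (p * m : ℤ) ∧
      wordVal p q z = bsA p q ^ (n - q * m)) ∨
    (∃ y z m, v = .T :: (y ++ .t :: z) ∧ wordVal p q y = bsA p q ^ (q * m : ℤ) ∧
      wordVal p q z = bsA p q ^ (n - p * m)) := by
  match v, h with
  | [], h =>
    have := britton_eq_single hp hq h
    simp only [britton, single.injEq] at this
    exact .inl ⟨rfl, this.symm⟩
  | .a :: v, h =>
    refine .inr (.inl ⟨v, rfl, ?_⟩)
    rw [show n - 1 = -1 + n by ring, zpow_add, ← h]; simp [Letter.val]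
  | .A :: v, h =>
    refine .inr (.inr (.inl ⟨v, rfl, ?_⟩))
    rw [show n + 1 = 1 + n by ring, zpow_add, ← h]; simp [Letter.val]
  | .t :: v, h =>
    have h1 := britton_eq_single hp hq h
    rw [britton] at h1
    have h2 := decomp_britton (p := p) (q := q) v
    refine .inr (.inr (.inr (.inl ?_)))
    match hb : britton p q v, h1, h2 with
    | .single β, h1, _ => simp [ZWord.pushDir] at h1
    | .cons β .t u, h1, _ => simp [ZWord.pushDir] at h1
    | .cons β .T (.cons γ θ u), h1, _ =>
      rw [ZWord.pushDir] at h1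
      split_ifs at h1
      simp [lmul] at h1
    | .cons β .T (.single γ), h1, h2 =>
      rw [ZWord.pushDir] at h1
      split_ifs at h1 with hd
      obtain ⟨m, rfl⟩ := hd
      rw [Int.mul_ediv_cancel_left _ (by exact_mod_cast hp)] at h1
      simp only [lmul, single.injEq] at h1
      cases h2 with
      | cons y z _ _ _ hy hz =>
        cases hz with
        | single _ _ hz =>
          exact ⟨y, z, m, rfl, hy, by rw [hz]; congr 1; linarith⟩
  | .T :: v, h =>
    have h1 := britton_eq_single hp hq h
    rw [britton] at h1
    have h2 := decomp_britton (p := p) (q := q) v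
    refine .inr (.inr (.inr (.inr ?_)))
    match hb : britton p q v, h1, h2 with
    | .single β, h1, _ => simp [ZWord.pushDir] at h1
    | .cons β .T u, h1, _ => simp [ZWord.pushDir] at h1
    | .cons β .t (.cons γ θ u), h1, _ =>
      rw [ZWord.pushDir] at h1
      split_ifs at h1
      simp [lmul] at h1
    | .cons β .t (.single γ), h1, h2 =>
      rw [ZWord.pushDir] at h1
      split_ifs at h1 with hd
      obtain ⟨m, rfl⟩ := hd
      rw [Int.mul_ediv_cancel_left _ (by exact_mod_cast hq)] at h1
      simp only [lmul, single.injEq] at h1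
      cases h2 with
      | cons y z _ _ _ hy hz =>
        cases hz with
        | single _ _ hz =>
          exact ⟨y, z, m, rfl, hy, by rw [hz]; congr 1; linarith⟩

/-! ### Geodesics of powers of `a` -/

/-- The length of the word `t (a ^ (p m)) T a ^ (n - q m)` for `a ^ n`, where the factor
`t (⋯) T` is omitted for `m = 0` and a geodesic is used for `a ^ (p m)`. -/
noncomputable def hopCost (p q : ℕ) (n m : ℤ) : ℕ :=
  (n - q * m).natAbs + if m = 0 then 0 else 2 + aLen p q (p * m)

lemma hopCost_zero (n : ℤ) : hopCost p q n 0 = n.natAbs := by simp [hopCost]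

lemma aLen_le_hopCost (n m : ℤ) : aLen p q n ≤ hopCost p q n m := by
  have h1 := aLen_add_le (p := p) (q := q) (n - q * m) (q * m)
  have h2 := aLen_le_natAbs (p := p) (q := q) (n - q * m)
  have h3 := aLen_lhs_le (p := p) (q := q) m
  rw [sub_add_cancel] at h1
  rw [hopCost]
  split_ifs with h
  · subst h; simp at *; omega
  · omega

lemma hopCost_add (n m n' m' : ℤ) :
    hopCost p q (n + n') (m + m') ≤ hopCost p q n m + hopCost p q n' m' := by
  have h1 := aLen_add_le (p := p) (q := q) (p * m) (p * m')
  rw [← mul_add] at h1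
  have h2 : (n + n' - q * (m + m')).natAbs ≤ (n - q * m).natAbs + (n' - q * m').natAbs := by
    rw [show n + n' - q * (m + m') = (n - q * m) + (n' - q * m') by ring]
    exact Int.natAbs_add_le _ _
  unfold hopCost
  split_ifs <;> simp_all <;> omega

/-- By induction on the length. A prefix `t y T` contributes its own factor `t y T`, and a prefix `T y t` for
`a ^ (p m)` can be absorbed: `y` represents `a ^ (q m)`, which by induction costs at least as much
as `a ^ (p m₂)` and `q |m - m₂|` single letters, for some `m₂`. -/
lemma exists_hopCost_le (hp : 1 ≤ p) (hpq : p ≤ q) (v : List Letter) (n : ℤ)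
    (h : wordVal p q v = bsA p q ^ n) : ∃ m, hopCost p q n m ≤ v.length := by
  induction hl : v.length using Nat.strong_induction_on generalizing v n with
  | _ l ih =>
  subst hl
  have ih' : ∀ (w : List Letter) (n : ℤ), w.length < v.length → wordVal p q w = bsA p q ^ n →
    ∃ m, hopCost p q n m ≤ w.length := fun w n hw hn => ih _ hw w n hn rfl
  rcases horocyclic_cases (by omega) (by omega) h with ⟨rfl, rfl⟩ | ⟨w, rfl, hw⟩ | ⟨w, rfl, hw⟩ |
    ⟨y, z, m, rfl, hy, hz⟩ | ⟨y, z, m, rfl, hy, hz⟩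
  · exact ⟨0, by simp [hopCost]⟩
  · obtain ⟨m, hm⟩ := ih' w _ (by simp) hw
    have := hopCost_add (p := p) (q := q) 1 0 (n - 1) m
    rw [hopCost_zero] at this
    exact ⟨m, by simp at *; omega⟩
  · obtain ⟨m, hm⟩ := ih' w _ (by simp) hw
    have := hopCost_add (p := p) (q := q) (-1) 0 (n + 1) m
    rw [hopCost_zero] at this
    exact ⟨m, by simp at *; omega⟩
  · obtain ⟨m', hm⟩ := ih' z _ (by simp; omega) hz
    have h1 := hopCost_add (p := p) (q := q) (q * m) m (n - q * m) m'
    have h2 : hopCost p q (q * m) m ≤ 2 + y.length := by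
      have := geoLen_le hy
      rw [hopCost, aLen]
      split_ifs <;> simp; omega
    exact ⟨m + m', by simp at *; omega⟩
  · obtain ⟨m₁, h1⟩ := ih' z _ (by simp; omega) hz
    obtain ⟨m₂, h2⟩ := ih' y _ (by simp) hy
    -- `y` is longer than a geodesic for `a ^ (p m₂)`, so that induction applies to the latter
    have h3 : ∃ m₃, hopCost p q (p * m₂) m₃ + (if m₂ = 0 then 0 else 2) ≤
        if m₂ = 0 then 0 else 2 + aLen p q (p * m₂) := by
      split_ifs with h0
      · exact ⟨0, by simp [h0, hopCost]⟩
      · obtain ⟨w, hw, hw'⟩ := exists_geodesic (bsA p q ^ (p * m₂ : ℤ))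
        rw [hopCost, if_neg h0, aLen, ← hw'] at h2
        obtain ⟨m₃, h3⟩ := ih' w (p * m₂) (by simp; omega) hw
        exact ⟨m₃, by rw [aLen, ← hw']; omega⟩
    obtain ⟨m₃, h3⟩ := h3
    have h4 := hopCost_add (p := p) (q := q) (p * m₂) m₃ (p * (m - m₂)) 0
    have h5 := hopCost_add (p := p) (q := q) (p * m) m₃ (n - p * m) m₁
    rw [← mul_add, hopCost_zero, add_zero] at h4
    rw [add_sub_cancel] at h4
    rw [add_sub_cancel] at h5
    rw [hopCost, ← mul_sub, Int.natAbs_mul] at h2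
    rw [Int.natAbs_mul] at h4
    simp only [Int.natAbs_natCast] at h2 h4
    have h6 : p * (m - m₂).natAbs ≤ q * (m - m₂).natAbs := Nat.mul_le_mul_right _ hpq
    refine ⟨m₃ + m₁, ?_⟩
    simp only [List.length_cons, List.length_append]
    split_ifs at h2 h3 <;> omega

/-- Geodesics for `a ^ n` contain at most one maximal factor `t y T`, and `T y t` not at all. -/
lemma exists_hopCost_eq (hp : 1 ≤ p) (hpq : p ≤ q) (n : ℤ) :
    ∃ m, aLen p q n = hopCost p q n m := by
  obtain ⟨v, hv, hv'⟩ := exists_geodesic (bsA p q ^ n)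
  obtain ⟨m, hm⟩ := exists_hopCost_le hp hpq v n hv
  exact ⟨m, le_antisymm (aLen_le_hopCost _ _) (by rw [aLen, ← hv']; exact hm)⟩

/-- A multiple of `q` before `t` does not become longer when it is moved across this letter. -/
lemma aLen_mul_le (hp : 1 ≤ p) (hpq : p ≤ q) (μ : ℤ) : aLen p q (p * μ) ≤ aLen p q (q * μ) := by
  obtain ⟨m, hm⟩ := exists_hopCost_eq hp hpq (q * μ)
  have h1 := aLen_add_le (p := p) (q := q) (p * m) (p * (μ - m))
  have h2 := aLen_le_natAbs (p := p) (q := q) (p * (μ - m))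
  rw [← mul_add, add_sub_cancel] at h1
  rw [hopCost, ← mul_sub, Int.natAbs_mul] at hm
  rw [Int.natAbs_mul] at h2
  simp only [Int.natAbs_natCast] at h2 hm
  have h6 : p * (μ - m).natAbs ≤ q * (μ - m).natAbs := Nat.mul_le_mul_right _ hpq
  split_ifs at hm with h
  · subst h; simp at *; omega
  · omega

/-- A multiple of a divisor `d` of `q` can be split off from `α`, without loss of length, such that
the rest is smaller than `d`. -/
lemma exists_split (hp : 1 ≤ p) (hpq : p ≤ q) {d : ℕ} (hd : d ∣ q) (α : ℤ) :
    ∃ r μ : ℤ, α = r + μ * d ∧ |r| < d ∧ r.natAbs + aLen p q (μ * d) ≤ aLen p q α := by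
  obtain ⟨e, he⟩ := hd
  have hd : 0 < d := Nat.pos_of_ne_zero (by rintro rfl; simp at he; omega)
  obtain ⟨m, hm⟩ := exists_hopCost_eq hp hpq α
  set x := α - q * m with hx
  have h1 : x = x.tmod d + d * x.tdiv d := (Int.tmod_add_mul_tdiv x d).symm
  have h2 : x.natAbs = (x.tmod d).natAbs + d * (x.tdiv d).natAbs := by
    rw [Int.natAbs_tmod, Int.natAbs_tdiv, Int.natAbs_natCast]
    exact (Nat.mod_add_div _ _).symm
  refine ⟨x.tmod d, x.tdiv d + m * e, ?_, ?_, ?_⟩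
  · have : (q : ℤ) = d * e := by exact_mod_cast he
    rw [show α = x + q * m by omega, this]
    linear_combination h1
  · rw [Int.abs_eq_natAbs, Int.natAbs_tmod, Int.natAbs_natCast]
    exact_mod_cast Nat.mod_lt _ hd
  · have h3 := aLen_add_le (p := p) (q := q) (d * x.tdiv d) (q * m)
    have h4 := aLen_le_natAbs (p := p) (q := q) (d * x.tdiv d)
    have h5 := aLen_lhs_le (p := p) (q := q) m
    rw [Int.natAbs_mul, Int.natAbs_natCast] at h4
    rw [show (x.tdiv d + m * e) * (d : ℤ) = d * x.tdiv d + q * m by rw [he]; push_cast; ring,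
      hm, hopCost, ← hx, h2]
    split_ifs with h
    · subst h; simp at *; omega
    · omega

/-! ### Length-lexicographic normal forms of powers of `a` -/

instance : Std.Trichotomous (fun x y : Letter => x.rank < y.rank) :=
  ⟨fun x y h h' => by cases x <;> cases y <;> first | rfl | simp [Letter.rank] at h h'⟩

lemma isLlnf_llnf (g : BS p q) : IsLlnf p q g (llnf p q g) := by
  have wf : WellFounded LenLexLt :=
    List.Shortlex.wf (InvImage.wf (fun x : Letter => x.rank) Nat.lt_wfRel.wf)
  have : ∃ v, IsLlnf p q g v := by
    obtain ⟨v, hv, hm⟩ := wf.has_min {v | wordVal p q v = g} (exists_word g)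
    exact ⟨v, hv, fun v' h => hm v' h⟩
  exact Classical.epsilon_spec this

@[simp] lemma wordVal_llnf (g : BS p q) : wordVal p q (llnf p q g) = g := (isLlnf_llnf g).1

lemma llnf_length (g : BS p q) : (llnf p q g).length = geoLen p q g := by
  refine le_antisymm ?_ (geoLen_le (wordVal_llnf g))
  obtain ⟨v, hv, hv'⟩ := exists_geodesic g
  rw [← hv']
  by_contra h
  exact (isLlnf_llnf g).2 v hv (List.Shortlex.of_length_lt (not_le.1 h))

lemma eq_llnf {g : BS p q} {v : List Letter} (hv : wordVal p q v = g)
    (h : ¬ LenLexLt (llnf p q g) v) : v = llnf p q g := by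
  exact Std.Trichotomous.trichotomous (r := List.Shortlex _) _ _ ((isLlnf_llnf g).2 v hv) h

@[simp] lemma llnf_one : llnf p q 1 = [] :=
  List.length_eq_zero_iff.1 (by rw [llnf_length]; simp)

end Words

section NormalForms

variable {p q : ℕ}

open ZWord

/-- Words of minimal length among the words with the same value. -/
def IsGeodesic (p q : ℕ) (v : List Letter) : Prop :=
  ∀ w : List Letter, wordVal p q w = wordVal p q v → v.length ≤ w.length

lemma isGeodesic_iff {v : List Letter} :
    IsGeodesic p q v ↔ v.length = geoLen p q (wordVal p q v) := by
  constructor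
  · intro h
    obtain ⟨w, hw, hw'⟩ := exists_geodesic (wordVal p q v)
    exact le_antisymm (hw' ▸ h w hw) (geoLen_le rfl)
  · intro h w hw
    exact h ▸ geoLen_le hw

lemma IsGeodesic.infix {x y z : List Letter} (h : IsGeodesic p q (x ++ y ++ z)) :
    IsGeodesic p q y := by
  intro w hw
  have := h (x ++ w ++ z) (by simp [hw])
  simp at this
  omega

lemma IsGeodesic.suffix {x y : List Letter} (h : IsGeodesic p q (x ++ y)) : IsGeodesic p q y :=
  IsGeodesic.infix (x := x) (z := []) (by simpa using h)

lemma IsGeodesic.tail {x : Letter} {y : List Letter} (h : IsGeodesic p q (x :: y)) :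
    IsGeodesic p q y := IsGeodesic.suffix (x := [x]) h

lemma IsGeodesic.length_eq {v : List Letter} (h : IsGeodesic p q v) {n : ℤ}
    (hv : wordVal p q v = bsA p q ^ n) : v.length = aLen p q n := by
  rw [isGeodesic_iff.1 h, hv, aLen]

lemma bsA_zpow_injective (hp : p ≠ 0) (hq : q ≠ 0) {m n : ℤ} (h : bsA p q ^ m = bsA p q ^ n) :
    m = n := by
  have := shift_of_val_eq hp hq (c := 0) (u := .single n) (v := .single m) trivial trivial
    (by simpa [ZWord.val] using h)
  rw [Shift] at this; omega

/-- A geodesic for a power of `a` does not start with a factor `T y t` for a power of `a`. -/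
lemma not_isGeodesic_T_t (hp : 1 ≤ p) (hpq : p ≤ q) {y z : List Letter} {m : ℤ}
    (hy : wordVal p q y = bsA p q ^ (q * m : ℤ)) :
    ¬ IsGeodesic p q (Letter.T :: (y ++ Letter.t :: z)) := by
  intro h
  obtain ⟨w, hw, hw'⟩ := exists_geodesic (bsA p q ^ (p * m : ℤ))
  have h1 := h (w ++ z) (by
    rw [wordVal_append, hw, ← bsT_inv_conj_zpow]; simp [Letter.val, hy, mul_assoc])
  have h2 := geoLen_le hy
  have h3 := aLen_mul_le hp hpq m
  unfold aLen at h3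
  simp at h1
  omega

lemma not_isGeodesic_t_T {y z : List Letter} (hy : wordVal p q y = 1) :
    ¬ IsGeodesic p q (Letter.t :: (y ++ Letter.T :: z)) := by
  intro h
  have h1 := h z (by simp [Letter.val, hy])
  simp at h1
  omega

lemma cons_a_pureWord {n : ℤ} (h : 0 ≤ n) : Letter.a :: pureWord n = pureWord (n + 1) := by
  obtain ⟨k, rfl⟩ := Int.eq_ofNat_of_zero_le h
  rw [pureWord, pureWord, if_neg (by omega), if_neg (by omega), ← List.replicate_succ]
  rfl

lemma cons_A_pureWord {n : ℤ} (h : n ≤ 0) : Letter.A :: pureWord n = pureWord (n - 1) := by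
  rcases eq_or_ne n 0 with rfl | h0
  · rfl
  rw [pureWord, pureWord, if_pos (by omega), if_pos (by omega), ← List.replicate_succ]
  congr 1; omega

lemma pureWord_of_pos {n : ℤ} (h : 0 < n) : pureWord n = Letter.a :: pureWord (n - 1) := by
  rw [cons_a_pureWord (by omega)]; simp

lemma pureWord_of_neg {n : ℤ} (h : n < 0) : pureWord n = Letter.A :: pureWord (n + 1) := by
  rw [cons_A_pureWord (by omega)]; simp

lemma not_isGeodesic_a_A {v : List Letter} : ¬ IsGeodesic p q (Letter.a :: Letter.A :: v) := by
  intro h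
  have := h v (by simp [Letter.val])
  simp at this

lemma not_isGeodesic_A_a {v : List Letter} : ¬ IsGeodesic p q (Letter.A :: Letter.a :: v) := by
  intro h
  have := h v (by simp [Letter.val])
  simp at this

/-- A geodesic for a power of `a` is a power of one letter, or it is one up to the first factor
`t y T` that represents a power of `a`. -/
lemma IsGeodesic.pure_or_hop (hp : 1 ≤ p) (hpq : p ≤ q) {v : List Letter} {n : ℤ}
    (hv : IsGeodesic p q v) (h : wordVal p q v = bsA p q ^ n) :
    v = pureWord n ∨ ∃ c y z m, v = pureWord c ++ Letter.t :: (y ++ Letter.T :: z) ∧ m ≠ 0 ∧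
      wordVal p q y = bsA p q ^ (p * m : ℤ) ∧ wordVal p q z = bsA p q ^ (n - c - q * m) := by
  induction hl : v.length using Nat.strong_induction_on generalizing v n with
  | _ l ih =>
  subst hl
  rcases horocyclic_cases (by omega) (by omega) h with ⟨rfl, rfl⟩ | ⟨w, rfl, hw⟩ | ⟨w, rfl, hw⟩ |
    ⟨y, z, m, rfl, hy, hz⟩ | ⟨y, z, m, rfl, hy, hz⟩
  · exact .inl rfl
  · rcases ih _ (by simp) hv.tail hw rfl with rfl | ⟨c, y, z, m, rfl, hm, hy, hz⟩
    · left
      rcases lt_or_ge (n - 1) 0 with h0 | h0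
      · rw [pureWord_of_neg h0] at hv
        exact (not_isGeodesic_a_A hv).elim
      · rw [cons_a_pureWord h0, sub_add_cancel]
    · right
      rcases lt_or_ge c 0 with h0 | h0
      · rw [pureWord_of_neg h0] at hv
        exact (not_isGeodesic_a_A hv).elim
      · exact ⟨c + 1, y, z, m, by rw [← cons_a_pureWord h0]; rfl, hm, hy, by
          rw [hz]; congr 1; ring⟩
  · rcases ih _ (by simp) hv.tail hw rfl with rfl | ⟨c, y, z, m, rfl, hm, hy, hz⟩
    · left
      rcases lt_or_ge 0 (n + 1) with h0 | h0
      · rw [pureWord_of_pos h0] at hv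
        exact (not_isGeodesic_A_a hv).elim
      · rw [cons_A_pureWord h0, add_sub_cancel_right]
    · right
      rcases lt_or_ge 0 c with h0 | h0
      · rw [pureWord_of_pos h0] at hv
        exact (not_isGeodesic_A_a hv).elim
      · exact ⟨c - 1, y, z, m, by rw [← cons_A_pureWord h0]; rfl, hm, hy, by
          rw [hz]; congr 1; ring⟩
  · refine .inr ⟨0, y, z, m, rfl, ?_, hy, by rw [hz, sub_zero]⟩
    rintro rfl
    exact not_isGeodesic_t_T (by simpa using hy) hv
  · exact (not_isGeodesic_T_t hp hpq hy hv).elim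

/-- A lexicographic comparison of words of equal length is decided within these words. -/
lemma lex_append_of_lex {α : Type*} {r : α → α → Prop} {s s' u u' : List α}
    (hl : s.length = s'.length) (h : List.Lex r s s') : List.Lex r (s ++ u) (s' ++ u') := by
  induction h with
  | nil => simp at hl
  | cons h ih => exact .cons (ih (by simpa using hl))
  | rel h => exact .rel h

lemma lex_or_lex_of_append {α : Type*} {r : α → α → Prop} {s s' u u' : List α}
    (hl : s.length = s'.length) (h : List.Lex r (s ++ u) (s' ++ u')) :
    List.Lex r s s' ∨ (s = s' ∧ List.Lex r u u') := by
  induction s generalizing s' with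
  | nil =>
    cases s' with
    | nil => exact .inr ⟨rfl, h⟩
    | cons => simp at hl
  | cons x s ih =>
    cases s' with
    | nil => simp at hl
    | cons x' s' =>
      cases h with
      | cons h =>
        rcases ih (by simpa using hl) h with h' | ⟨h', h''⟩
        · exact .inl (.cons h')
        · exact .inr ⟨by rw [h'], h''⟩
      | rel h => exact .inl (.rel h)

/-- The length-lexicographic normal form of `a ^ n`. -/
noncomputable def aNf (p q : ℕ) (n : ℤ) : List Letter := llnf p q (bsA p q ^ n)

@[simp] lemma wordVal_aNf (n : ℤ) : wordVal p q (aNf p q n) = bsA p q ^ n := wordVal_llnf _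

@[simp] lemma aNf_length (n : ℤ) : (aNf p q n).length = aLen p q n := llnf_length _

lemma isGeodesic_aNf (n : ℤ) : IsGeodesic p q (aNf p q n) := by
  rw [isGeodesic_iff, aNf_length, wordVal_aNf, aLen]

lemma aNf_le {v : List Letter} {n : ℤ} (hv : wordVal p q v = bsA p q ^ n)
    (hl : v.length = aLen p q n) : ¬ LexLt v (aNf p q n) := fun h =>
  (isLlnf_llnf _).2 v hv (.of_lex (by rw [hl, ← aNf_length]; rfl) h)

lemma eq_aNf {v : List Letter} {n : ℤ} (hv : wordVal p q v = bsA p q ^ n)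
    (hl : v.length = aLen p q n) (h : ¬ LexLt (aNf p q n) v) : v = aNf p q n :=
  eq_llnf hv fun h' => h ((List.shortlex_iff_lex (by rw [hl, ← aNf_length, aNf])).1 h')

/-- The word `t llnf(p m) T llnf(n - q m)` for `a ^ n`. -/
noncomputable def hopWord (p q : ℕ) (n m : ℤ) : List Letter :=
  Letter.t :: (aNf p q (p * m) ++ Letter.T :: aNf p q (n - q * m))

lemma wordVal_hopWord (n m : ℤ) : wordVal p q (hopWord p q n m) = bsA p q ^ n := by
  have := bsT_conj_zpow (p := p) (q := q) m
  simp only [hopWord, wordVal_cons, wordVal_append, wordVal_aNf, Letter.val, ← mul_assoc, this]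
  rw [← zpow_add]
  congr 1; ring

/-- Outside a bounded interval, the normal form of `a ^ n` is one of two words `t y T z`. -/
lemma aNf_eq_hopWord (hp : 1 ≤ p) (hpq : p < q) {n : ℤ} (hn : 3 * (q : ℤ) ≤ |n|) :
    aNf p q n = hopWord p q n (n / q) ∨ aNf p q n = hopWord p q n (n / q + 1) := by
  have hg := isGeodesic_aNf (p := p) (q := q) n
  have hv := wordVal_aNf (p := p) (q := q) n
  have hq : (0 : ℤ) < q := by omega
  rcases hg.pure_or_hop hp hpq.le hv with h | ⟨c, y, z, m, h, hm, hy, hz⟩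
  · exfalso
    -- replacing `a ^ (q m)` by `t a ^ (p m) T` saves `(q - p) |m| - 2` letters
    have h1 := aLen_le_hopCost (p := p) (q := q) n (n.tdiv q)
    have h2 := aLen_le_natAbs (p := p) (q := q) (p * n.tdiv q)
    have h3 : (aNf p q n).length = n.natAbs := by rw [h, pureWord_length]
    rw [aNf_length] at h3
    have h4 : n = n.tmod q + q * n.tdiv q := (Int.tmod_add_mul_tdiv n q).symm
    have h5 : n.natAbs = n.natAbs % q + q * (n.natAbs / q) := (Nat.mod_add_div _ _).symm
    have h6 : 3 ≤ n.natAbs / q := by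
      rw [Nat.le_div_iff_mul_le (by omega)]
      rw [Int.abs_eq_natAbs] at hn
      exact_mod_cast hn
    have h7 : (p + 1) * (n.natAbs / q) ≤ q * (n.natAbs / q) := Nat.mul_le_mul_right _ hpq
    rw [hopCost, show n - q * n.tdiv q = n.tmod q by linarith, h3, Int.natAbs_tmod,
      Int.natAbs_natCast] at h1
    rw [Int.natAbs_mul, Int.natAbs_tdiv, Int.natAbs_natCast] at h2
    rw [add_mul] at h7
    simp only [Int.natAbs_natCast] at h2
    change aLen p q (p * n.tdiv q) ≤ p * (n.natAbs / q) at h2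
    split_ifs at h1 <;> omega
  -- the factor `t y T` can be moved to the front, and `t` is the least letter
  have hc : c = 0 := by
    by_contra hc
    have hl : LexLt (Letter.t :: (y ++ Letter.T :: (pureWord c ++ z))) (aNf p q n) := by
      rw [h]
      rcases lt_or_gt_of_ne hc with h0 | h0
      · rw [pureWord_of_neg h0]; exact .rel (by simp [Letter.rank])
      · rw [pureWord_of_pos h0]; exact .rel (by simp [Letter.rank])
    refine aNf_le ?_ ?_ hl
    · have := bsT_conj_zpow (p := p) (q := q) m
      simp only [wordVal_cons, wordVal_append, hy, hz, Letter.val, wordVal_pureWord,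
        ← mul_assoc, this]
      rw [← zpow_add, ← zpow_add]
      congr 1; ring
    · rw [← aNf_length, h]; simp; omega
  subst hc
  have h' : aNf p q n = Letter.t :: (y ++ Letter.T :: z) := h
  rw [sub_zero] at hz
  have hgy : IsGeodesic p q y :=
    IsGeodesic.infix (x := [Letter.t]) (z := Letter.T :: z) (by rw [h'] at hg; simpa using hg)
  have hgz : IsGeodesic p q z :=
    IsGeodesic.suffix (x := Letter.t :: (y ++ [Letter.T])) (by rw [h'] at hg; simpa using hg)
  have hly := hgy.length_eq hy
  have hlz := hgz.length_eq hz
  have hln : aLen p q n = y.length + z.length + 2 := by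
    rw [← aNf_length, h']; simp; omega
  have hval : ∀ y' z', wordVal p q y' = bsA p q ^ (p * m : ℤ) →
      wordVal p q z' = bsA p q ^ (n - q * m) →
      wordVal p q (Letter.t :: (y' ++ Letter.T :: z')) = bsA p q ^ n := by
    intro y' z' hy' hz'
    have := bsT_conj_zpow (p := p) (q := q) m
    simp only [wordVal_cons, wordVal_append, hy', hz', Letter.val, ← mul_assoc, this]
    rw [← zpow_add]
    congr 1; ring
  have hz1 : z = aNf p q (n - q * m) := by
    refine eq_aNf hz hlz fun hlt => aNf_le (hval y _ hy (wordVal_aNf _)) ?_ ?_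
    · simp; omega
    · rw [h']; exact .cons (List.Lex.append_left _ (.cons hlt) _)
  have hy1 : y = aNf p q (p * m) := by
    refine eq_aNf hy hly fun hlt => aNf_le (hval _ z (wordVal_aNf _) hz) ?_ ?_
    · simp; omega
    · rw [h']; exact .cons (lex_append_of_lex (by simp [hly]) hlt)
  -- two factors `t y T` can be merged into one, which saves two letters
  have hz2 : z = pureWord (n - q * m) := by
    rcases hgz.pure_or_hop hp hpq.le hz with h0 | ⟨c, y', z', m', rfl, hm', hy', hz'⟩
    · exact h0
    · exfalso
      have h1 := aLen_le_hopCost (p := p) (q := q) n (m + m')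
      have h2 := hg (Letter.t :: (y ++ y' ++ Letter.T :: (pureWord c ++ z'))) (by
        have := bsT_conj_zpow (p := p) (q := q) (m + m')
        rw [mul_add, zpow_add] at this
        rw [hv]
        simp only [wordVal_cons, wordVal_append, hy, hy', hz', wordVal_pureWord, Letter.val,
          ← mul_assoc] at this ⊢
        rw [this, ← zpow_add, ← zpow_add]
        congr 1; ring)
      rw [h'] at h2
      simp at h2
      omega
  -- otherwise `q` letters can be exchanged for at most `p` letters inside the factor `t y T`
  have hr : (n - q * m).natAbs < q := by
    have hlr : z.length = (n - q * m).natAbs := by rw [hz2]; simp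
    by_contra hr
    obtain ⟨e, he, her⟩ : ∃ e : ℤ, e.natAbs = 1 ∧
        (n - q * (m + e)).natAbs + q = (n - q * m).natAbs := by
      rcases le_or_gt 0 (n - q * m) with h0 | h0
      · exact ⟨1, rfl, by rw [mul_add]; omega⟩
      · exact ⟨-1, rfl, by rw [mul_add]; omega⟩
    have h1 := aLen_le_hopCost (p := p) (q := q) n (m + e)
    have h2 := aLen_add_le (p := p) (q := q) (p * m) (p * e)
    have h3 := aLen_le_natAbs (p := p) (q := q) (p * e)
    rw [Int.natAbs_mul, he] at h3
    rw [← mul_add] at h2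
    simp only [Int.natAbs_natCast] at h3
    rw [hopCost] at h1
    split_ifs at h1 <;> omega
  have hm2 : m = n / q ∨ m = n / q + 1 := by
    have h1 := Int.emod_add_mul_ediv n q
    have h2 := Int.emod_nonneg n hq.ne'
    have h3 := Int.emod_lt_of_pos n hq
    have h4 : n - q * m = n % q + q * (n / q - m) := by linear_combination -h1
    have h5 : -(q : ℤ) < n - q * m ∧ n - q * m < q := by omega
    have h6 : n / q - m < 1 := by
      by_contra h
      nlinarith
    have h7 : -2 < n / q - m := by
      by_contra h
      nlinarith
    omega
  have : aNf p q n = hopWord p q n m := by rw [h', hopWord, ← hz1, ← hy1]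
  rcases hm2 with rfl | rfl
  · exact .inl this
  · exact .inr this

/-! ### Minimal Britton-reduced words -/

@[simp] lemma ZWord.wordVal_expand (u : ZWord) : wordVal p q (u.expand p q) = u.val p q := by
  induction u with
  | single α => simp [expand, ZWord.val]
  | cons α θ u ih => simp [expand, ZWord.val, ih, Letter.val_dir, mul_assoc]

lemma ZWord.expand_length (u : ZWord) : (u.expand p q).length = u.norm p q := by
  induction u with
  | single α => simp [expand, ZWord.norm, llnf_length]
  | cons α θ u ih => simp [expand, ZWord.norm, llnf_length, ih]; omega

lemma ZWord.geoLen_val_le_norm (u : ZWord) : geoLen p q (u.val p q) ≤ u.norm p q := by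
  rw [← expand_length]; exact geoLen_le (wordVal_expand u)

lemma IsGeodesic.norm_britton {v : List Letter} (h : IsGeodesic p q v) :
    (britton p q v).norm p q = v.length := by
  refine le_antisymm (decomp_britton v).norm_le ?_
  rw [isGeodesic_iff.1 h, (decomp_britton v).val_eq]
  exact geoLen_val_le_norm _

/-- In a geodesic, a horocyclic prefix is reduced independently of the rest. -/
lemma britton_append (hp : 1 ≤ p) (hpq : p ≤ q) {x v : List Letter} {α : ℤ}
    (hx : wordVal p q x = bsA p q ^ α) (hg : IsGeodesic p q (x ++ v)) :
    britton p q (x ++ v) = (britton p q v).lmul α := by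
  induction hl : x.length using Nat.strong_induction_on generalizing x v α with
  | _ l ih =>
  subst hl
  rcases horocyclic_cases (by omega) (by omega) hx with ⟨rfl, rfl⟩ | ⟨w, rfl, hw⟩ |
    ⟨w, rfl, hw⟩ | ⟨y, z, m, rfl, hy, hz⟩ | ⟨y, z, m, rfl, hy, hz⟩
  · simp
  · rw [List.cons_append, britton, ih _ (by simp) hw hg.tail rfl, lmul_lmul, add_sub_cancel]
  · rw [List.cons_append, britton, ih _ (by simp) hw hg.tail rfl, lmul_lmul]
    congr 1; ring
  · simp only [List.cons_append, List.append_assoc] at hg ⊢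
    have hg1 : IsGeodesic p q (Letter.T :: (z ++ v)) := hg.tail.suffix
    have h1 := ih _ (by simp; omega) hz hg1.tail rfl
    -- a Britton reduction of `T` with a later `t` would save letters in the geodesic `T z v`
    have h2 : britton p q (Letter.T :: (z ++ v)) = .cons 0 .T (britton p q (z ++ v)) := by
      rw [britton]
      have hn := hg1.tail.norm_britton
      have hd := decomp_britton (p := p) (q := q) (Letter.T :: (z ++ v))
      have hn2 := hg1.norm_britton
      rw [britton] at hn2
      match hb : britton p q (z ++ v) with
      | .single β => rfl
      | .cons β .T u => rfl
      | .cons β .t u =>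
        rw [ZWord.pushDir]
        split_ifs with hdvd
        · exfalso
          obtain ⟨μ, rfl⟩ := hdvd
          rw [hb, ZWord.pushDir, if_pos (dvd_mul_right _ _),
            Int.mul_ediv_cancel_left _ (by omega)] at hn2
          rw [hb, norm_cons] at hn
          have h3 := norm_lmul_le (p := p) (q := q) (μ * p) u
          have h4 := aLen_mul_le hp hpq μ
          rw [mul_comm μ] at h3 hn2
          simp at hn2 hn
          omega
        · rfl
    have h3 := ih y.length (by simp) hy (v := Letter.T :: (z ++ v)) (by exact hg.tail) rfl
    rw [britton, h3, h2, lmul, ZWord.pushDir, if_pos (by simp), add_zero, h1, lmul_lmul]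
    · rw [Int.mul_ediv_cancel_left _ (by omega)]
      congr 1; ring
  · exfalso
    simp only [List.cons_append, List.append_assoc] at hg
    exact not_isGeodesic_T_t hp hpq hy hg

lemma ZWord.IsMinimalFor.isGeodesic_expand {g : BS p q} {u : ZWord} (h : u.IsMinimalFor p q g) :
    IsGeodesic p q (u.expand p q) := by
  rw [isGeodesic_iff, expand_length, wordVal_expand, h.2.1, h.2.2]

/-- The Britton reduction recovers a reduced word from its geodesic expansion, so that minimal
Britton-reduced words and geodesics correspond to each other. -/
lemma ZWord.britton_expand (hp : 1 ≤ p) (hpq : p ≤ q) {u : ZWord} (h : u.BrittonReduced p q)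
    (hg : IsGeodesic p q (u.expand p q)) : britton p q (u.expand p q) = u := by
  induction u with
  | single α =>
    rw [expand]
    exact britton_eq_single (by omega) (by omega) (wordVal_llnf _)
  | cons α θ u ih =>
    rw [expand] at hg ⊢
    rw [britton_append hp hpq (wordVal_llnf _) hg]
    have : britton p q (θ.letter :: u.expand p q) = .cons 0 θ u := by
      have h1 := ih h.tail hg.suffix.tail
      have h2 := h.pushDir_eq
      cases θ
      · rw [Dir.letter, britton, h1, h2]
      · rw [Dir.letter, britton, h1, h2]
    rw [this, lmul, add_zero]

lemma IsGeodesic.isMinimalFor_britton {v : List Letter} (h : IsGeodesic p q v) :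
    (britton p q v).IsMinimalFor p q (wordVal p q v) :=
  ⟨brittonReduced_britton v, (decomp_britton v).val_eq.symm, by
    rw [h.norm_britton, isGeodesic_iff.1 h]⟩

/-! ### Peak normal forms -/

/-- The position of an integer in the order `0, 1, -1, 2, -2, …`. -/
def zrank (α : ℤ) : ℕ := if α < 0 then 2 * α.natAbs + 1 else 2 * α.natAbs

lemma zrank_lt_iff {α β : ℤ} : zrank α < zrank β ↔ |α| < |β| ∨ (|α| = |β| ∧ β < α) := by
  unfold zrank
  rw [Int.abs_eq_natAbs, Int.abs_eq_natAbs]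
  split_ifs <;> omega

lemma zrank_injective : Function.Injective zrank := by
  intro α β h
  unfold zrank at h
  split_ifs at h <;> omega

/-- The position of a symbol in the order on `Δ`. -/
def DSym.rank : DSym → ℕ
  | .dir .t => 0
  | .dir .T => 1
  | .int α => 2 + zrank α

lemma DSym.lt_iff {x y : DSym} : x.Lt y ↔ x.rank < y.rank := by
  match x, y with
  | .dir .t, .dir .t => simp [DSym.Lt, DSym.rank]
  | .dir .t, .dir .T => simp [DSym.Lt, DSym.rank]
  | .dir .T, .dir .t => simp [DSym.Lt, DSym.rank]
  | .dir .T, .dir .T => simp [DSym.Lt, DSym.rank]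
  | .dir .t, .int β => simp [DSym.Lt, DSym.rank]
  | .dir .T, .int β => simp [DSym.Lt, DSym.rank]; try omega
  | .int α, .dir .t => simp [DSym.Lt, DSym.rank]
  | .int α, .dir .T => simp [DSym.Lt, DSym.rank]
  | .int α, .int β => simp only [DSym.Lt, DSym.rank]; rw [← zrank_lt_iff]; omega

lemma DSym.rank_injective : Function.Injective DSym.rank := by
  intro x y h
  match x, y with
  | .dir .t, .dir .t => rfl
  | .dir .t, .dir .T => simp [DSym.rank] at h
  | .dir .T, .dir .t => simp [DSym.rank] at h
  | .dir .T, .dir .T => rfl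
  | .dir .t, .int β => simp [DSym.rank] at h; omega
  | .dir .T, .int β => simp [DSym.rank] at h; try omega
  | .int α, .dir .t => simp [DSym.rank] at h; try omega
  | .int α, .dir .T => simp [DSym.rank] at h; omega
  | .int α, .int β => exact congrArg _ (zrank_injective (by simpa [DSym.rank] using h))

lemma DSym.wf : WellFounded DSym.Lt :=
  Subrelation.wf (fun {_ _} h => DSym.lt_iff.1 h) (InvImage.wf DSym.rank Nat.lt_wfRel.wf)

instance : Std.Trichotomous DSym.Lt := ⟨fun x y h h' => by
  rw [DSym.lt_iff] at h h'; exact DSym.rank_injective (by omega)⟩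

instance : Std.Asymm DSym.Lt := ⟨fun x y h h' => by rw [DSym.lt_iff] at h h'; omega⟩

lemma deltaLt_irrefl (x : List DSym) : ¬ DeltaLt x x := fun h =>
  Std.Asymm.asymm (r := List.Shortlex DSym.Lt) _ _ h h

lemma deltaLt_trichotomous {x y : List DSym} (h : ¬ DeltaLt x y) (h' : ¬ DeltaLt y x) : x = y :=
  Std.Trichotomous.trichotomous (r := List.Shortlex DSym.Lt) _ _ h h'

namespace ZWord

lemma peakLt_wf : WellFounded PeakLt :=
  Subrelation.wf (r := InvImage (Prod.Lex DeltaLt DeltaLt)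
    (fun u : ZWord => (u.leftPart, u.rightPartBar)))
    (fun {_ _} h => (Prod.lex_def).2 h)
    (InvImage.wf _ (WellFounded.prod_lex (List.Shortlex.wf DSym.wf) (List.Shortlex.wf DSym.wf)))

/-- The word over `Δ` that `u` consists of. -/
def symbols : ZWord → List DSym
  | single α => [.int α]
  | cons α θ u => .int α :: .dir θ :: u.symbols

/-- The group element represented by a word over `Δ`. -/
def symVal (p q : ℕ) (x : List DSym) : BS p q :=
  (x.map (fun s => match s with
    | .dir θ => bsT p q ^ θ.sign
    | .int α => bsA p q ^ α)).prod

lemma symVal_symbols (u : ZWord) : symVal p q u.symbols = u.val p q := by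
  induction u with
  | single α => simp [symVal, symbols, val]
  | cons α θ u ih =>
    rw [val, ← ih]
    simp [symVal, symbols, mul_assoc]

/-- A word can be recovered from its sequence of symbols, as integers and letters alternate. -/
lemma symbols_injective : Function.Injective symbols := by
  intro u v h
  induction u generalizing v with
  | single α =>
    cases v with
    | single β => simpa [symbols] using h
    | cons β θ v => cases v <;> simp [symbols] at h
  | cons α θ u ih =>
    cases v with
    | single β => cases u <;> simp [symbols] at h
    | cons β θ' v =>
      simp only [symbols, List.cons.injEq, DSym.int.injEq, DSym.dir.injEq] at h
      rw [h.1, h.2.1, ih h.2.2]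

lemma coeffs_eq_cons (u : ZWord) : u.coeffs = u.head :: u.coeffs.tail := by cases u <;> rfl

/-- The symbols before, at and after any position; at the peak these are the left part, an integer,
and the right part. -/
lemma symbols_split (u : ZWord) (i : ℕ) (hi : i ≤ u.dirs.length) :
    ∃ c, u.symbols =
      ((u.coeffs.zip u.dirs).take i).flatMap (fun x => [DSym.int x.1, DSym.dir x.2]) ++
      DSym.int c ::
      ((u.dirs.zip u.coeffs.tail).drop i).flatMap (fun x => [DSym.dir x.1, DSym.int x.2]) := by
  induction u generalizing i with
  | single α => exact ⟨α, by simp [symbols, coeffs, dirs]⟩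
  | cons α θ u ih =>
    cases i with
    | zero =>
      obtain ⟨c, hc⟩ := ih 0 (Nat.zero_le _)
      refine ⟨α, ?_⟩
      have hc' : c = u.head := by cases u <;> simp_all [symbols, head]
      subst hc'
      rw [symbols, hc]
      simp only [dirs, coeffs, List.tail_cons]
      rw [coeffs_eq_cons u]
      simp
    | succ i =>
      obtain ⟨c, hc⟩ := ih i (by simpa [dirs] using hi)
      refine ⟨c, ?_⟩
      rw [symbols, hc]
      simp only [dirs, coeffs, List.tail_cons]
      rw [coeffs_eq_cons u]
      simp

lemma peak_le (u : ZWord) : u.peak ≤ u.dirs.length := Nat.findGreatest_le _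

/-- The integer at the peak is determined by the two parts and the value of the word. -/
lemma eq_of_parts_eq (hp : p ≠ 0) (hq : q ≠ 0) {u v : ZWord} (h : u.val p q = v.val p q)
    (h1 : u.leftPart = v.leftPart) (h2 : u.rightPartBar = v.rightPartBar) : u = v := by
  have h3 : u.rightPart = v.rightPart := by
    have hi : Function.Injective DSym.bar := by
      intro x y h
      rcases x with (_ | _) | x <;> rcases y with (_ | _) | y <;>
        simp_all [DSym.bar, Dir.bar]
    exact List.map_injective_iff.2 hi (List.reverse_injective h2)
  obtain ⟨c, hc⟩ := symbols_split u u.peak u.peak_le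
  obtain ⟨d, hd⟩ := symbols_split v v.peak v.peak_le
  change _ = u.leftPart ++ _ :: u.rightPart at hc
  change _ = v.leftPart ++ _ :: v.rightPart at hd
  apply symbols_injective
  rw [hc, hd, h1, h3]
  rw [← symVal_symbols, ← symVal_symbols, hc, hd, h1, h3] at h
  simp only [symVal, List.map_append, List.prod_append, List.map_cons, List.prod_cons,
    mul_right_inj, mul_left_inj] at h
  rw [bsA_zpow_injective hp hq h]

lemma exists_isBrittonPnf (g : BS p q) : ∃ u : ZWord, u.IsBrittonPnf p q g := by
  obtain ⟨v, hv, hv'⟩ := exists_geodesic g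
  have h1 : IsGeodesic p q v := by rw [isGeodesic_iff, hv', hv]
  obtain ⟨u, hu, hm⟩ := peakLt_wf.has_min {u : ZWord | u.IsMinimalFor p q g}
    ⟨_, hv ▸ h1.isMinimalFor_britton⟩
  exact ⟨u, hu, fun u' h => hm u' h⟩

lemma IsBrittonPnf.unique (hp : p ≠ 0) (hq : q ≠ 0) {g : BS p q} {u v : ZWord}
    (hu : u.IsBrittonPnf p q g) (hv : v.IsBrittonPnf p q g) : u = v := by
  have h1 := hu.2 v hv.1
  have h2 := hv.2 u hu.1
  simp only [PeakLt, not_or, not_and] at h1 h2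
  have h3 := deltaLt_trichotomous h2.1 h1.1
  exact eq_of_parts_eq hp hq (hu.1.2.1.trans hv.1.2.1.symm) h3
    (deltaLt_trichotomous (h2.2 h3) (h1.2 h3.symm))

lemma IsBrittonPnf.expand_eq (hp : p ≠ 0) (hq : q ≠ 0) {g : BS p q} {u : ZWord}
    (hu : u.IsBrittonPnf p q g) : u.expand p q = pnf p q g := by
  have : Nonempty ZWord := ⟨ZWord.single 0⟩
  rw [pnf, (Classical.epsilon_spec (exists_isBrittonPnf g)).unique hp hq hu]

/-- Among the geodesics with a given Britton reduction, the word in which all integers are in normal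
form is the least. -/
lemma Decomp_not_lexLt {v : List Letter} {u : ZWord} (h : Decomp p q v u)
    (hl : v.length = u.norm p q) : ¬ LexLt v (u.expand p q) := by
  induction h with
  | single x α h => exact aNf_le h hl
  | cons x v α θ u h hv ih =>
    have h1 := hv.norm_le
    have h2 := geoLen_le h
    rw [norm_cons, aLen] at hl
    simp only [List.length_append, List.length_cons] at hl
    rw [expand]
    intro hlt
    rcases lex_or_lex_of_append (by rw [llnf_length]; omega) hlt with h3 | ⟨_, h3⟩
    · exact aNf_le h (by rw [aLen]; omega) h3
    · exact ih (by omega) (List.lex_cons_iff.1 h3)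

end ZWord

lemma wordVal_pnf (hp : p ≠ 0) (hq : q ≠ 0) (g : BS p q) : wordVal p q (pnf p q g) = g := by
  obtain ⟨u, hu⟩ := exists_isBrittonPnf g
  rw [← hu.expand_eq hp hq, wordVal_expand, hu.1.2.1]

/-- Peak normal forms are minimal among all words with the same value. -/
lemma not_wordLt_pnf (hp : 1 ≤ p) (hpq : p ≤ q) {g : BS p q} {v : List Letter}
    (hv : wordVal p q v = g) : ¬ WordLt p q v (pnf p q g) := by
  obtain ⟨u, hu⟩ := exists_isBrittonPnf g
  rw [← hu.expand_eq (by omega) (by omega)]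
  have hg := hu.1.isGeodesic_expand
  have hb := britton_expand hp hpq hu.1.1 hg
  have hle := hg v (by rw [hv, wordVal_expand, hu.1.2.1])
  rintro (hlt | ⟨hl, hlt⟩)
  · omega
  rw [hb] at hlt
  have hgv : IsGeodesic p q v := fun w hw => by
    rw [hl]; exact hg w (by rw [hw, hv, wordVal_expand, hu.1.2.1])
  have hm : (britton p q v).IsMinimalFor p q g := hv ▸ hgv.isMinimalFor_britton
  rcases hlt with hlt | ⟨h1, h2, hlt⟩
  · exact hu.2 _ hm hlt
  · have := eq_of_parts_eq (by omega) (by omega) (hm.2.1.trans hu.1.2.1.symm) h1 h2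
    have hd := decomp_britton (p := p) (q := q) v
    rw [this] at hd
    exact Decomp_not_lexLt hd (by rw [hl, expand_length]) hlt

end NormalForms

/-! ### Prefixes, heights and peaks -/

namespace ZWord

variable {p q : ℕ}

/-- The list `(α₀, θ₁), …, (α_{k-1}, θₖ)`. -/
def pairs (u : ZWord) : List (ℤ × Dir) := u.coeffs.zip u.dirs

@[simp] lemma pairs_single (α : ℤ) : (single α).pairs = [] := rfl

@[simp] lemma pairs_cons (α : ℤ) (θ : Dir) (u : ZWord) :
    (cons α θ u).pairs = (α, θ) :: u.pairs := rfl

@[simp] lemma dirs_single (α : ℤ) : (single α).dirs = [] := rfl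

@[simp] lemma dirs_cons (α : ℤ) (θ : Dir) (u : ZWord) : (cons α θ u).dirs = θ :: u.dirs := rfl

lemma pairs_map_snd (u : ZWord) : u.pairs.map Prod.snd = u.dirs := by
  induction u with
  | single α => rfl
  | cons α θ u ih => simp [ih]

@[simp] lemma pairs_length (u : ZWord) : u.pairs.length = u.dirs.length := by
  rw [← pairs_map_snd, List.length_map]

/-- The word `α₁ θ₁ ⋯ αₖ θₖ u` for `l = [(α₁, θ₁), …, (αₖ, θₖ)]`. -/
def attach : List (ℤ × Dir) → ZWord → ZWord
  | [], u => u
  | x :: l, u => cons x.1 x.2 (attach l u)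

@[simp] lemma attach_nil (u : ZWord) : attach [] u = u := rfl

@[simp] lemma attach_cons (x : ℤ × Dir) (l : List (ℤ × Dir)) (u : ZWord) :
    attach (x :: l) u = cons x.1 x.2 (attach l u) := rfl

lemma attach_append (l l' : List (ℤ × Dir)) (u : ZWord) :
    attach (l ++ l') u = attach l (attach l' u) := by
  induction l with
  | nil => rfl
  | cons x l ih => simp [ih]

@[simp] lemma attach_pairs_last (u : ZWord) : attach u.pairs (single u.last) = u := by
  induction u with
  | single α => rfl
  | cons α θ u ih => simp [last, ih]

@[simp] lemma pairs_attach (l : List (ℤ × Dir)) (u : ZWord) :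
    (attach l u).pairs = l ++ u.pairs := by
  induction l with
  | nil => rfl
  | cons x l ih => simp [ih]

@[simp] lemma dirs_attach (l : List (ℤ × Dir)) (u : ZWord) :
    (attach l u).dirs = l.map Prod.snd ++ u.dirs := by
  induction l with
  | nil => rfl
  | cons x l ih => simp [ih]

@[simp] lemma last_attach (l : List (ℤ × Dir)) (u : ZWord) : (attach l u).last = u.last := by
  induction l with
  | nil => rfl
  | cons x l ih => simp [last, ih]

lemma attach_mul (l : List (ℤ × Dir)) (u : ZWord) : attach l (single 0) * u = attach l u := by
  induction l with
  | nil => simp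
  | cons x l ih => simp [ih]

/-- The norm of the prefix `α₁ θ₁ ⋯ αₖ θₖ`. -/
noncomputable def pairsNorm (p q : ℕ) (l : List (ℤ × Dir)) : ℕ :=
  (l.map (fun x => aLen p q x.1 + 1)).sum

lemma norm_attach (l : List (ℤ × Dir)) (u : ZWord) :
    (attach l u).norm p q = pairsNorm p q l + u.norm p q := by
  induction l with
  | nil => simp [pairsNorm]
  | cons x l ih => simp [pairsNorm, norm_cons, ih] at *; omega

lemma val_attach (l : List (ℤ × Dir)) (u : ZWord) :
    (attach l u).val p q = (attach l (single 0)).val p q * u.val p q := by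
  induction l with
  | nil => simp [val]
  | cons x l ih => simp [val, ih, mul_assoc]

lemma expand_attach (l : List (ℤ × Dir)) (u : ZWord) :
    (attach l u).expand p q = (attach l (single 0)).expand p q ++ u.expand p q := by
  induction l with
  | nil => simp [expand]
  | cons x l ih => simp [expand, ih]

lemma Shift.attach_congr {u v : ZWord} (h : Shift p q 0 u v) (l : List (ℤ × Dir)) :
    Shift p q 0 (attach l u) (attach l v) := by
  induction l with
  | nil => exact h
  | cons x l ih => exact ⟨rfl, 0, by simp, by simpa using ih⟩

lemma shift_lmul (c : ℤ) (u : ZWord) : Shift p q c u (u.lmul c) := by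
  have h0 : ∀ u : ZWord, Shift p q 0 u u := by
    intro u
    induction u with
    | single α => simp [Shift]
    | cons α θ u ih => exact ⟨rfl, 0, by simp, by simpa using ih⟩
  cases u with
  | single α => simp [Shift, lmul]
  | cons α θ u => exact ⟨rfl, 0, by simp, by simpa using h0 u⟩

lemma exists_attach (u : ZWord) {i : ℕ} (hi : i < u.pairs.length) :
    ∃ l v, u = attach l (cons u.pairs[i].1 u.pairs[i].2 v) ∧ l.length = i := by
  induction u generalizing i with
  | single α => simp at hi
  | cons α θ u ih =>
    cases i with
    | zero => exact ⟨[], u, rfl, rfl⟩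
    | succ i =>
      obtain ⟨l, v, h, hl⟩ := ih (i := i) (by simpa using hi)
      refine ⟨(α, θ) :: l, v, ?_, by simp [hl]⟩
      simp only [pairs_cons, List.getElem_cons_succ, attach_cons]
      rw [← h]

/-- The sum of the signs of a list of directions. -/
def dirSum (l : List Dir) : ℤ := (l.map Dir.sign).sum

@[simp] lemma dirSum_nil : dirSum [] = 0 := rfl

@[simp] lemma dirSum_cons (θ : Dir) (l : List Dir) : dirSum (θ :: l) = θ.sign + dirSum l := by
  simp [dirSum]

@[simp] lemma dirSum_append (l l' : List Dir) : dirSum (l ++ l') = dirSum l + dirSum l' := by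
  simp [dirSum]

lemma heightAt_zero (u : ZWord) : u.heightAt 0 = 0 := by simp [heightAt]

lemma heightAt_cons (α : ℤ) (θ : Dir) (u : ZWord) (j : ℕ) :
    (cons α θ u).heightAt (j + 1) = θ.sign + u.heightAt j := by simp [heightAt]

lemma heightAt_attach (l : List (ℤ × Dir)) (u : ZWord) (j : ℕ) :
    (attach l u).heightAt (l.length + j) = dirSum (l.map Prod.snd) + u.heightAt j := by
  induction l with
  | nil => simp [dirSum]
  | cons x l ih =>
    rw [attach_cons, List.length_cons, show l.length + 1 + j = l.length + j + 1 by omega,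
      heightAt_cons, ih]
    simp [dirSum, add_assoc]

lemma heightAt_attach_of_le (l : List (ℤ × Dir)) (u : ZWord) {j : ℕ} (hj : j ≤ l.length) :
    (attach l u).heightAt j = dirSum ((l.take j).map Prod.snd) := by
  rw [heightAt, dirs_attach, List.take_append_of_le_length (by simpa using hj), dirSum,
    ← List.map_take]

lemma peak_spec (u : ZWord) :
    (∀ j, j ≤ u.dirs.length → u.heightAt j ≤ u.heightAt u.peak) ∧
    ∀ j, u.peak < j → j ≤ u.dirs.length → u.heightAt j < u.heightAt u.peak := by
  obtain ⟨i, hi, hmax⟩ := Finset.exists_max_image (Finset.range (u.dirs.length + 1)) u.heightAt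
    ⟨0, by simp⟩
  have h1 : ∀ j, j ≤ u.dirs.length → u.heightAt j ≤ u.heightAt u.peak := by
    exact Nat.findGreatest_spec (P := fun i => ∀ j, j ≤ u.dirs.length → u.heightAt j ≤ u.heightAt i)
      (m := i) (by simpa [Nat.lt_succ_iff] using hi)
      (fun j hj => hmax j (by simpa [Nat.lt_succ_iff] using hj))
  refine ⟨h1, fun j hj hj' => ?_⟩
  by_contra h
  exact Nat.findGreatest_is_greatest hj hj' fun k hk => (h1 k hk).trans (not_lt.1 h)

lemma peak_eq {u : ZWord} {i : ℕ} (hi : i ≤ u.dirs.length)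
    (h1 : ∀ j, j ≤ u.dirs.length → u.heightAt j ≤ u.heightAt i)
    (h2 : ∀ j, i < j → j ≤ u.dirs.length → u.heightAt j < u.heightAt i) : u.peak = i := by
  obtain ⟨h3, h4⟩ := u.peak_spec
  rcases lt_trichotomy u.peak i with h | h | h
  · have := h4 i h hi; have := h1 _ u.peak_le; omega
  · exact h
  · have := h2 _ h u.peak_le; have := h3 i hi; omega

lemma peak_congr {u v : ZWord} (h : u.dirs = v.dirs) : u.peak = v.peak := by
  have hh : ∀ i, u.heightAt i = v.heightAt i := fun i => by rw [heightAt, heightAt, h]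
  obtain ⟨h1, h2⟩ := v.peak_spec
  refine peak_eq (h ▸ v.peak_le) (fun j hj => ?_) (fun j hj hj' => ?_)
  · rw [hh, hh]; exact h1 j (h ▸ hj)
  · rw [hh, hh]; exact h2 j hj (h ▸ hj')

/-- The condition on `αᵢ` and `θᵢ` in a standard valley. -/
def Bounded (p q : ℕ) (x : ℤ × Dir) : Prop := |x.1| < (q : ℤ) ∧ (x.2 = Dir.T → |x.1| < (p : ℤ))

end ZWord

open ZWord

/-! ### Valleys as binary trees -/

/-- Valleys `α T U β t W` (and the empty valley), as binary trees. -/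
inductive Valley
  | nil
  | node (α : ℤ) (U : Valley) (β : ℤ) (W : Valley)

namespace Valley

variable {p q : ℕ}

/-- The integers of a valley, each with the letter that follows it; the final integer `0` is
omitted. -/
def pairs : Valley → List (ℤ × Dir)
  | nil => []
  | node α U β W => (α, Dir.T) :: (U.pairs ++ (β, Dir.t) :: W.pairs)

/-- The product of the valley and `u`. -/
def app (V : Valley) (u : ZWord) : ZWord := attach V.pairs u

/-- The valley as a word, with last integer `0`. -/
def toZWord (V : Valley) : ZWord := V.app (single 0)

@[simp] lemma app_nil (u : ZWord) : nil.app u = u := rfl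

@[simp] lemma app_node (α β : ℤ) (U W : Valley) (u : ZWord) :
    (node α U β W).app u = cons α Dir.T (U.app (cons β Dir.t (W.app u))) := by
  simp [app, pairs, attach_append]

lemma toZWord_mul (V : Valley) (u : ZWord) : V.toZWord * u = V.app u := attach_mul _ _

lemma val_app (V : Valley) (u : ZWord) : (V.app u).val p q = V.toZWord.val p q * u.val p q :=
  val_attach _ _

lemma dirSum_pairs (V : Valley) : dirSum (V.pairs.map Prod.snd) = 0 := by
  induction V with
  | nil => rfl
  | node α U β W ihU ihW => simp [pairs, Dir.sign, ihU, ihW]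

lemma dirSum_take_le (V : Valley) (j : ℕ) : dirSum ((V.pairs.take j).map Prod.snd) ≤ 0 := by
  induction V generalizing j with
  | nil => simp [pairs, dirSum]
  | node α U β W ihU ihW =>
    cases j with
    | zero => simp [dirSum]
    | succ j =>
      have h1 := ihU j
      have h2 := dirSum_pairs U
      simp only [pairs, List.take_succ_cons, List.take_append, List.map_cons, List.map_append]
      cases hj : j - U.pairs.length with
      | zero =>
        simp only [List.take_zero, List.append_nil, dirSum_cons, Dir.sign, List.map_nil]
        omega
      | succ i =>
        have h3 := ihW i
        rw [List.take_of_length_le (by omega)]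
        simp only [List.take_succ_cons, List.map_cons, dirSum_cons, dirSum_append, Dir.sign]
        omega

lemma heightAt_app (V : Valley) (u : ZWord) (j : ℕ) :
    (V.app u).heightAt (V.pairs.length + j) = u.heightAt j := by
  rw [app, heightAt_attach, dirSum_pairs, zero_add]

lemma heightAt_app_le (V : Valley) (u : ZWord) {j : ℕ} (hj : j ≤ V.pairs.length) :
    (V.app u).heightAt j ≤ 0 := by
  rw [app, heightAt_attach_of_le _ _ hj]; exact dirSum_take_le _ _

@[simp] lemma pairs_app (V : Valley) (u : ZWord) : (V.app u).pairs = V.pairs ++ u.pairs := by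
  simp [app]

@[simp] lemma dirs_app (V : Valley) (u : ZWord) :
    (V.app u).dirs = V.pairs.map Prod.snd ++ u.dirs := by simp [app]

lemma peak_app (V : Valley) (u : ZWord) : (V.app u).peak = V.pairs.length + u.peak := by
  obtain ⟨h1, h2⟩ := u.peak_spec
  have h0 := h1 0 (Nat.zero_le _)
  have hl := u.peak_le
  rw [heightAt_zero] at h0
  apply peak_eq
  · simpa using hl
  · intro j hj
    rw [heightAt_app]
    rcases le_total j V.pairs.length with h | h
    · exact (V.heightAt_app_le u h).trans h0
    · obtain ⟨i, rfl⟩ := Nat.exists_eq_add_of_le h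
      rw [heightAt_app]
      exact h1 i (by simpa using hj)
  · intro j hj hj'
    obtain ⟨i, rfl⟩ := Nat.exists_eq_add_of_le (show V.pairs.length ≤ j by omega)
    rw [heightAt_app, heightAt_app]
    exact h2 i (by omega) (by simpa using hj')

/-- A valley lies before the peak, which is the last position of maximal height. -/
lemma leftPart_app (V : Valley) (u : ZWord) :
    (V.app u).leftPart = V.pairs.flatMap (fun x => [DSym.int x.1, DSym.dir x.2]) ++ u.leftPart := by
  change List.flatMap _ (List.take _ (V.app u).pairs) = _ ++ List.flatMap _ (List.take _ u.pairs)
  rw [peak_app, pairs_app, List.take_length_add_append, List.flatMap_append]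

/-- A word in which some position has positive height can be split at the first such position. -/
lemma exists_app_of_height (u : ZWord) (j : ℕ) (hj : 1 ≤ u.heightAt j) :
    ∃ (X : Valley) (β : ℤ) (y : ZWord), u = X.app (cons β Dir.t y) := by
  induction hn : u.dirs.length using Nat.strong_induction_on generalizing u j with
  | _ n ih =>
  subst hn
  match u, j with
  | u, 0 => simp [heightAt_zero] at hj
  | single α, j => simp [heightAt] at hj
  | cons α .t u, j => exact ⟨nil, α, u, rfl⟩
  | cons α .T u, j + 1 =>
    rw [heightAt_cons] at hj
    simp only [Dir.sign] at hj
    obtain ⟨X₁, β₁, y, rfl⟩ := ih _ (by simp) u j (by omega) rfl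
    have hle : X₁.pairs.length < j := by
      by_contra h
      have := X₁.heightAt_app_le (cons β₁ Dir.t y) (not_lt.1 h)
      omega
    obtain ⟨i, rfl⟩ := Nat.exists_eq_add_of_lt hle
    rw [add_assoc, heightAt_app, heightAt_cons] at hj
    simp only [Dir.sign] at hj
    obtain ⟨X₂, β₂, z, rfl⟩ := ih _ (by simp; omega) y i (by omega) rfl
    exact ⟨node α X₁ β₁ X₂, β₂, z, by simp⟩

/-- Words of height at most `0` that return to height `0` are valleys: they are split at the first
return. -/
lemma exists_eq_toZWord (u : ZWord) (h1 : ∀ j, j ≤ u.dirs.length → u.heightAt j ≤ 0)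
    (h2 : u.heightAt u.dirs.length = 0) (h3 : u.last = 0) : ∃ V : Valley, u = V.toZWord := by
  induction hn : u.dirs.length using Nat.strong_induction_on generalizing u with
  | _ n ih =>
  subst hn
  match u with
  | single α => rw [last] at h3; subst h3; exact ⟨nil, rfl⟩
  | cons α .t u =>
    have := h1 1 (by simp)
    rw [heightAt_cons, heightAt_zero] at this
    simp [Dir.sign] at this
  | cons α .T u =>
    rw [dirs_cons, List.length_cons, heightAt_cons] at h2
    simp only [Dir.sign] at h2
    obtain ⟨X, β, y, rfl⟩ := exists_app_of_height u u.dirs.length (by omega)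
    have hy : ∀ j, (cons α .T (X.app (cons β .t y))).heightAt (X.pairs.length + 1 + j + 1) =
        y.heightAt j := by
      intro j
      rw [heightAt_cons, add_assoc, heightAt_app, add_comm 1 j, heightAt_cons]
      simp [Dir.sign]
    obtain ⟨W, hW⟩ := ih y.dirs.length (by simp; omega) y
      (fun j hj => by rw [← hy]; exact h1 _ (by simp; omega))
      (by
        rw [← hy, heightAt_cons]
        simp only [Dir.sign]
        rw [← h2]
        congr 2
        simp; omega)
      (by simpa [last, app] using h3) rfl
    exact ⟨node α X β W, by rw [hW]; simp [toZWord]⟩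

lemma _root_.ZWord.IsStandardValley.exists_valley {u : ZWord} (h : u.IsStandardValley p q) :
    ∃ V : Valley, u = V.toZWord := by
  refine exists_eq_toZWord u (fun j hj => ?_) h.valley.2 h.last_eq
  have := u.peak_spec.1 j hj
  rwa [← height, h.valley.1] at this

/-- Multiples of `p` can be moved across a valley. -/
lemma shift_app_app {g : ℤ} (hg : (q : ℤ) = p * g) (V : Valley) {e : ℤ} {x y : ZWord}
    (h : Shift p q (p * e) x y) : Shift p q (p * e) (V.app x) (V.app y) := by
  induction V generalizing e x y with
  | nil => exact h
  | node α U β W ihU ihW =>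
    rw [app_node, app_node]
    refine ⟨rfl, e, by simp only [Dir.lhs]; ring, ?_⟩
    rw [Dir.rhs_T, hg, show e * (p * g) = p * (e * g) by ring]
    refine ihU ⟨rfl, e, by simp only [Dir.lhs]; rw [hg]; ring, ?_⟩
    rw [Dir.rhs_t, mul_comm]
    exact ihW h

/-! ### Bounded representations of valleys -/

/-- `Rep V r V'`: the valley `V'` satisfies the bounds of a standard valley, and it equals
`V a ^ (-p r)` in the group. -/
inductive Rep (p q : ℕ) : Valley → ℤ → Valley → Prop
  | nil : Rep p q nil 0 nil
  | node {α β : ℤ} {U W U' W' : Valley} {σ r : ℤ} (ε α' μ β' : ℤ)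
      (hU : Rep p q U σ U') (hW : Rep p q W r W')
      (hα : α = ε * p + α') (hα' : |α'| < (p : ℤ))
      (hβ : p * σ + ε * q + β = μ * q + β') (hβ' : |β'| < (q : ℤ)) :
      Rep p q (node α U β W) (μ + r) (node α' U' β' W')

lemma Rep.map_snd {V V' : Valley} {r : ℤ} (h : Rep p q V r V') :
    V'.pairs.map Prod.snd = V.pairs.map Prod.snd := by
  induction h with
  | nil => rfl
  | node _ _ _ _ _ _ _ _ _ _ ihU ihW => simp [pairs, ihU, ihW]

lemma Rep.pairs_length {V V' : Valley} {r : ℤ} (h : Rep p q V r V') :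
    V'.pairs.length = V.pairs.length := by
  simpa using congrArg List.length h.map_snd

lemma Rep.bounded (hpq : p ≤ q) {V V' : Valley} {r : ℤ} (h : Rep p q V r V') :
    ∀ x ∈ V'.pairs, Bounded p q x := by
  induction h with
  | nil => simp [pairs]
  | node ε α' μ β' _ _ _ hα' _ hβ' ihU ihW =>
    intro x hx
    simp only [pairs, List.mem_cons, List.mem_append] at hx
    rcases hx with rfl | hx | rfl | hx
    · exact ⟨by dsimp only; omega, fun _ => hα'⟩
    · exact ihU x hx
    · exact ⟨hβ', by simp⟩
    · exact ihW x hx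

/-- A bounded representation arises from the valley by moving multiples towards its end. -/
lemma Rep.shift {g : ℤ} (hg : (q : ℤ) = p * g) {V V' : Valley} {r : ℤ} (h : Rep p q V r V')
    {e : ℤ} {x y : ZWord} (hxy : Shift p q (p * (e + r)) x y) :
    Shift p q (p * e) (V.app x) (V'.app y) := by
  induction h generalizing e x y with
  | nil => simpa using hxy
  | @node α β U W U' W' σ r ε α' μ β' _ _ hα hα' hβ hβ' ihU ihW =>
    rw [app_node, app_node]
    refine ⟨rfl, e + ε, by simp only [Dir.lhs]; rw [hα]; ring, ?_⟩
    rw [Dir.rhs_T, hg, show (e + ε) * (p * g) = p * ((e + ε) * g) by ring]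
    refine ihU ⟨rfl, μ + e, ?_, ?_⟩
    · rw [Dir.lhs_t]
      rw [hg] at hβ ⊢
      linear_combination hβ
    · rw [Dir.rhs_t, mul_comm]
      apply ihW
      rwa [show μ + e + r = e + (μ + r) by ring]

lemma Rep.val_eq {g : ℤ} (hg : (q : ℤ) = p * g) {V V' : Valley} {r : ℤ} (h : Rep p q V r V') :
    V'.toZWord.val p q = V.toZWord.val p q * bsA p q ^ (-(p * r)) := by
  have h1 := (h.shift hg (e := 0) (x := single (-(p * r))) (y := single 0)
    (by simp [Shift])).val_eq
  rw [mul_zero, zpow_zero, one_mul, val_app V] at h1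
  exact h1

/-- Every word with bounded coefficients that arises from `V x` by moving multiples starts with a
bounded representation of `V`. -/
lemma exists_rep_of_shift {g : ℤ} (hg : (q : ℤ) = p * g) (V : Valley) {e : ℤ} {x u : ZWord}
    (h : Shift p q (p * e) (V.app x) u)
    (hb : ∀ y ∈ u.pairs.take V.pairs.length, Bounded p q y) :
    ∃ V' y r, u = V'.app y ∧ Rep p q V r V' ∧ Shift p q (p * (e + r)) x y := by
  induction V generalizing e x u with
  | nil => exact ⟨nil, u, 0, rfl, .nil, by simpa using h⟩
  | node α U β W ihU ihW =>
    rw [app_node] at h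
    cases u with
    | single => exact h.elim
    | cons α' θ u =>
    obtain ⟨rfl, ε, hε, h⟩ := h
    simp only [pairs, pairs_cons, List.length_cons, List.length_append, List.take_succ_cons,
      List.mem_cons, forall_eq_or_imp] at hb
    obtain ⟨hbα, hb⟩ := hb
    rw [Dir.rhs_T, hg, show ε * (p * g) = p * (ε * g) by ring] at h
    obtain ⟨U', y, σ, rfl, hU, h⟩ := ihU h
      (fun y hy => hb y (List.take_subset_take_left _ (by omega) hy))
    cases y with
    | single => exact h.elim
    | cons β' θ y =>
    obtain ⟨rfl, μ, hμ, h⟩ := h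
    rw [pairs_app, pairs_cons, ← hU.pairs_length, List.take_length_add_append,
      List.take_succ_cons] at hb
    rw [Dir.rhs_t, mul_comm] at h
    obtain ⟨W', z, r, rfl, hW, h⟩ := ihW h
      (fun y hy => hb y (List.mem_append_right _ (List.mem_cons_of_mem _ hy)))
    have hbβ := hb (β', .t) (List.mem_append_right _ List.mem_cons_self)
    refine ⟨node α' U' β' W', z, μ - e + r, by simp,
      .node (ε - e) α' (μ - e) β' hU hW ?_ (hbα.2 rfl) ?_ hbβ.1, ?_⟩
    · simp only [Dir.lhs] at hε; linear_combination hε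
    · simp only [Dir.lhs] at hμ; rw [hg] at hμ ⊢; linear_combination hμ
    · rwa [show e + (μ - e + r) = μ + r by ring]

/-- The inner valley is determined by a word, because it ends at the first positive height. -/
lemma app_cons_injective {U U' : Valley} {β β' : ℤ} {x x' : ZWord}
    (h : U.app (cons β Dir.t x) = U'.app (cons β' Dir.t x')) : U = U' ∧ β = β' ∧ x = x' := by
  induction U generalizing U' β β' x x' with
  | nil => cases U' with
    | nil => simpa using h
    | node => simp at h
  | node α A b W ihA ihW => cases U' with
    | nil => simp at h
    | node α' A' b' W' =>
      rw [app_node, app_node, cons.injEq] at h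
      obtain ⟨h1, h2, h3⟩ := ihA h.2.2
      obtain ⟨h4, h5, h6⟩ := ihW h3
      exact ⟨by rw [h.1, h1, h2, h4], h5, h6⟩

lemma toZWord_injective : Function.Injective toZWord := by
  intro V V' h
  induction V generalizing V' with
  | nil => cases V' with
    | nil => rfl
    | node => simp [toZWord] at h
  | node α A b W ihA ihW => cases V' with
    | nil => simp [toZWord] at h
    | node α' A' b' W' =>
      rw [toZWord, toZWord, app_node, app_node, cons.injEq] at h
      obtain ⟨h1, h2, h3⟩ := app_cons_injective h.2.2
      rw [h.1, h1, h2, ihW h3]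

/-- Concatenation of valleys. -/
def append : Valley → Valley → Valley
  | nil, X => X
  | node α U β W, X => node α U β (W.append X)

lemma append_app (V X : Valley) (u : ZWord) : (V.append X).app u = V.app (X.app u) := by
  induction V with
  | nil => rfl
  | node α U β W _ ihW => simp [append, ihW]

lemma Rep.append {V V' X X' : Valley} {r s : ℤ} (h : Rep p q V r V') (h' : Rep p q X s X') :
    Rep p q (V.append X) (r + s) (V'.append X') := by
  induction h with
  | nil => simpa [Valley.append] using h'
  | node ε α' μ β' hU hW hα hα' hβ hβ' _ ihW =>
    rw [add_assoc]
    exact .node ε α' μ β' hU ihW hα hα' hβ hβ'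

/-- The range consists of the exponents `p r` for which a bounded representation exists. -/
lemma inRange_iff {V : Valley} {ρ : ℤ} :
    InRange p q V.toZWord ρ ↔ ∃ r V', ρ = p * r ∧ Rep p q V r V' := by
  constructor
  · intro h
    have : ∀ u, InRange p q u ρ → ∃ (V : Valley) (r : ℤ) (V' : Valley),
        u = V.toZWord ∧ ρ = p * r ∧ Rep p q V r V' := by
      intro u hu
      clear h
      induction hu with
      | zero => exact ⟨nil, 0, nil, rfl, by simp, .nil⟩
      | mul U W σ τ hU hW hσ hτ ih1 ih2 =>
        obtain ⟨V₁, r₁, V₁', rfl, rfl, h1⟩ := ih1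
        obtain ⟨V₂, r₂, V₂', rfl, rfl, h2⟩ := ih2
        refine ⟨V₁.append V₂, r₁ + r₂, _, ?_, by ring, h1.append h2⟩
        rw [toZWord_mul, toZWord, toZWord, append_app]
      | nest U α β σ ε α' μ β' hσ hα hα' hβ hβ' ih =>
        obtain ⟨U, r, U', rfl, rfl, h⟩ := ih
        refine ⟨Valley.node α U β .nil, μ + 0, _, ?_, by ring,
          .node ε α' μ β' h .nil hα hα' hβ hβ'⟩
        rw [toZWord_mul]
        simp [toZWord]
    obtain ⟨V₁, r, V', h1, h2, h3⟩ := this _ h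
    rw [toZWord_injective h1]
    exact ⟨r, V', h2, h3⟩
  · rintro ⟨r, V', rfl, h⟩
    induction h with
    | nil => rw [mul_zero]; exact .zero
    | @node α β U W U' W' σ r ε α' μ β' hU hW hα hα' hβ hβ' ihU ihW =>
      have h1 := InRange.nest U.toZWord α β (p * σ) ε α' μ β' ihU hα hα' hβ hβ'
      rw [toZWord_mul] at h1
      cases W with
      | nil =>
        cases hW
        rw [add_zero, mul_comm]
        simpa [toZWord] using h1
      | node γ A δ B =>
        have h2 := InRange.mul _ _ _ _ (by simp) (by simp [toZWord]) h1 ihW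
        rw [mul_add, mul_comm (p : ℤ) μ]
        convert h2 using 1
        rw [cons_mul]
        simp only [toZWord, app_node, cons.injEq, true_and]
        simp only [app]
        rw [show cons β .t (single 0) = attach [(β, Dir.t)] (single 0) from rfl, ← attach_append,
          attach_mul]
        simp [attach_append]

end Valley

section PeakNormalForms

variable {p q : ℕ}

/-! ### Bounds on the integers before the peak -/

namespace ZWord

lemma leftPart_eq (u : ZWord) :
    u.leftPart = (u.pairs.take u.peak).flatMap (fun x => [DSym.int x.1, DSym.dir x.2]) := rfl

lemma flatMap_length (l : List (ℤ × Dir)) :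
    (l.flatMap (fun x => [DSym.int x.1, DSym.dir x.2])).length = 2 * l.length := by
  induction l with
  | nil => rfl
  | cons x l ih => simp [List.flatMap_cons, ih]; omega

/-- Left parts of words with the same letters are compared at the first integer that differs. -/
lemma deltaLt_leftPart {u v : ZWord} {l R S : List (ℤ × Dir)} {α β : ℤ} {θ : Dir}
    (hu : u.pairs = l ++ (α, θ) :: R) (hv : v.pairs = l ++ (β, θ) :: S) (hd : v.dirs = u.dirs)
    (hl : l.length < u.peak) (h : (DSym.int β).Lt (DSym.int α)) :
    DeltaLt v.leftPart u.leftPart := by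
  have hp : v.peak = u.peak := peak_congr hd
  obtain ⟨i, hi⟩ := Nat.exists_eq_add_of_lt hl
  apply List.Shortlex.of_lex
  · rw [leftPart_eq, leftPart_eq, flatMap_length, flatMap_length]
    simp [hd, hp]
  · rw [leftPart_eq, leftPart_eq, hp, hu, hv, hi, add_assoc, List.take_length_add_append,
      List.take_length_add_append, List.flatMap_append, List.flatMap_append]
    apply List.Lex.append_left
    simp only [List.take_succ_cons, List.flatMap_cons]
    exact .rel h

/-- Moving multiples inside a minimal word gives a minimal word, if the norm does not increase. -/
lemma IsMinimalFor.of_shift {g : BS p q} {u v : ZWord} (hu : u.IsMinimalFor p q g)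
    (h : Shift p q 0 u v) (hn : v.norm p q ≤ u.norm p q) : v.IsMinimalFor p q g := by
  have hv : v.val p q = g := by rw [h.val_eq]; simpa using hu.2.1
  exact ⟨h.brittonReduced hu.1, hv,
    le_antisymm (hn.trans hu.2.2.le) (hv ▸ geoLen_val_le_norm v)⟩

/-- Before the peak, multiples can be moved towards the peak without loss of length, so the
integers in a Britton peak normal form satisfy the bounds of a standard valley there. -/
lemma IsBrittonPnf.bounded (hp : 1 ≤ p) (hpq : p < q) (hdvd : p ∣ q) {g : BS p q} {u : ZWord}
    (hu : u.IsBrittonPnf p q g) : ∀ x ∈ u.pairs.take u.peak, Bounded p q x := by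
  intro x hx
  obtain ⟨i, hi, rfl⟩ := List.mem_iff_getElem.1 hx
  rw [List.length_take, lt_min_iff] at hi
  rw [List.getElem_take]
  obtain ⟨l, v, huv, hl⟩ := u.exists_attach hi.2
  generalize u.pairs[i].1 = α at huv
  have hlt : ∀ {r : ℤ} {d : ℕ}, |r| < d → (d : ℤ) ≤ |α| → (DSym.int r).Lt (DSym.int α) :=
    fun h h' => .inl (by omega)
  match hθ : u.pairs[i].2 with
  | .t =>
    rw [hθ] at huv
    have hα : u.pairs[i].1 = α := by
      have h1 : u.pairs = l ++ (α, .t) :: v.pairs := by rw [huv]; simp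
      simp [h1, ← hl]
    have hb : |α| < (q : ℤ) := by
      by_contra hb
      obtain ⟨r, μ, hr, hrd, hn⟩ := exists_split hp hpq.le (dvd_refl q) α
      have hs : Shift p q 0 u (attach l (cons r .t (v.lmul (μ * p)))) := by
        rw [huv]
        exact Shift.attach_congr (u := cons α .t v) (v := cons r .t (v.lmul (μ * p)))
          ⟨rfl, μ, by simp [hr], shift_lmul _ _⟩ l
      refine hu.2 _ (hu.1.of_shift hs ?_) (.inl (deltaLt_leftPart (l := l) (by rw [huv, pairs_attach]; rfl)
        (by rw [pairs_attach]; rfl) hs.dirs_eq (by omega) (hlt hrd (not_lt.1 hb))))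
      have h1 := norm_lmul_le (p := p) (q := q) (μ * p) v
      have h2 := aLen_mul_le hp hpq.le μ
      have h3 := aLen_le_natAbs (p := p) (q := q) r
      rw [mul_comm, mul_comm (q : ℤ)] at h2
      rw [huv, norm_attach, norm_attach, norm_cons, norm_cons]
      omega
    exact ⟨by rw [hα]; exact hb, by rw [hθ]; simp⟩
  | .T =>
    rw [hθ] at huv
    have hα : u.pairs[i].1 = α := by
      have h1 : u.pairs = l ++ (α, .T) :: v.pairs := by rw [huv]; simp
      simp [h1, ← hl]
    have hb : |α| < (p : ℤ) := by
      by_contra hb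
      obtain ⟨e, he⟩ := hdvd
      -- the word returns to the height before `T`, since the peak comes later
      obtain ⟨j, hj⟩ := Nat.exists_eq_add_of_lt hi.1
      have h1 := u.peak_spec.1 i (by simpa using hi.2.le)
      rw [hj, huv, ← hl, add_assoc, heightAt_attach, heightAt_cons] at h1
      have h0 := heightAt_attach l (cons α .T v) 0
      rw [add_zero, heightAt_zero] at h0
      rw [h0] at h1
      simp only [Dir.sign] at h1
      obtain ⟨X, β, y, rfl⟩ := Valley.exists_app_of_height v j (by omega)
      obtain ⟨r, μ, hr, hrd, hn⟩ := exists_split hp hpq.le (d := p) ⟨e, he⟩ α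
      have he' : (q : ℤ) = p * e := by exact_mod_cast he
      have hs : Shift p q 0 u (attach l (cons r .T (X.app (cons β .t (y.lmul (μ * p)))))) := by
        rw [huv]
        refine Shift.attach_congr (u := cons α .T _) (v := cons r .T _)
          ⟨rfl, μ, by simp [hr], ?_⟩ l
        rw [Dir.rhs_T, he', show μ * (p * (e : ℤ)) = p * (μ * e) by ring]
        exact X.shift_app_app he' ⟨rfl, μ, by simp only [Dir.lhs_t]; rw [he']; ring,
          shift_lmul _ _⟩
      refine hu.2 _ (hu.1.of_shift hs ?_) (.inl (deltaLt_leftPart (l := l) (by rw [huv, pairs_attach]; rfl)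
        (by rw [pairs_attach]; rfl) hs.dirs_eq (by omega) (hlt hrd (not_lt.1 hb))))
      have h1 := norm_lmul_le (p := p) (q := q) (μ * p) y
      have h3 := aLen_le_natAbs (p := p) (q := q) r
      rw [huv, norm_attach, norm_attach, norm_cons, norm_cons, Valley.app, Valley.app,
        norm_attach, norm_attach, norm_cons, norm_cons]
      omega
    exact ⟨by rw [hα]; omega, fun _ => by rw [hα]; exact hb⟩

lemma BrittonReduced.attach_single {l : List (ℤ × Dir)} {α β : ℤ}
    (h : (ZWord.attach l (single α)).BrittonReduced p q) :
    (ZWord.attach l (single β)).BrittonReduced p q := by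
  induction l with
  | nil => trivial
  | cons x l ih =>
    cases l with
    | nil => trivial
    | cons y l => exact ⟨h.1, h.2.1, ih h.2.2⟩

lemma BrittonReduced.attach {l : List (ℤ × Dir)} {w : ZWord}
    (h : (ZWord.attach l (single 0)).BrittonReduced p q) (hl : ∀ x ∈ l.getLast?, x.2 = .t)
    (hw : (cons 0 .t w).BrittonReduced p q) : (ZWord.attach l w).BrittonReduced p q := by
  induction l with
  | nil => exact hw.tail
  | cons x l ih =>
    cases l with
    | nil =>
      have : x.2 = .t := hl x rfl
      rw [attach_cons, this]
      exact hw.head_congr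
    | cons y l => exact ⟨h.1, h.2.1, ih h.2.2 (fun z hz => hl z (by simpa using hz))⟩

end ZWord

namespace Valley

lemma getLast?_pairs (V : Valley) : ∀ x ∈ V.pairs.getLast?, x.2 = .t := by
  induction V with
  | nil => simp [pairs]
  | node α U β W _ ihW =>
    intro x hx
    rw [pairs, ← List.cons_append, List.getLast?_append, List.getLast?_cons] at hx
    cases hW : W.pairs.getLast? with
    | none => rw [hW] at hx; simp at hx; rw [← hx]
    | some y =>
      rw [hW] at hx
      simp at hx
      subst hx
      exact ihW y hW

lemma peak_attach {V : Valley} {l : List (ℤ × Dir)} (h : l.map Prod.snd = V.pairs.map Prod.snd)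
    (u : ZWord) : (attach l u).peak = l.length + u.peak := by
  rw [peak_congr (v := V.app u) (by simp [h]), peak_app]
  simpa using congrArg List.length h.symm

lemma leftPart_attach {V : Valley} {l : List (ℤ × Dir)}
    (h : l.map Prod.snd = V.pairs.map Prod.snd) (u : ZWord) :
    (attach l u).leftPart = l.flatMap (fun x => [DSym.int x.1, DSym.dir x.2]) ++ u.leftPart := by
  rw [leftPart_eq, leftPart_eq, peak_attach h, pairs_attach, List.take_length_add_append,
    List.flatMap_append]

lemma rightPart_attach {V : Valley} {l : List (ℤ × Dir)}
    (h : l.map Prod.snd = V.pairs.map Prod.snd) (u : ZWord) :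
    (attach l u).rightPart = u.rightPart := by
  have key : ∀ (l : List (ℤ × Dir)) (i : ℕ),
      ((attach l u).dirs.zip (attach l u).coeffs.tail).drop (l.length + i) =
      (u.dirs.zip u.coeffs.tail).drop i := by
    intro l i
    induction l with
    | nil => simp
    | cons x l ih =>
      rw [attach_cons, dirs_cons, coeffs, List.tail_cons, coeffs_eq_cons, List.zip_cons_cons,
        List.length_cons, show l.length + 1 + i = (l.length + i) + 1 by omega,
        List.drop_succ_cons, ih]
  rw [rightPart, rightPart, peak_attach h, key]

/-- The peak normal form of `V w` splits at the end of the valley. -/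
lemma exists_pnf_split (hp : 1 ≤ p) (hpq : p < q) (hdvd : p ∣ q) (V : Valley)
    (hV : V.toZWord.BrittonReduced p q) {w : ZWord} (hw : (cons 0 .t w).BrittonReduced p q) :
    ∃ r V', Rep p q V r V' ∧
      pnf p q ((V.toZWord * w).val p q) =
        pnf p q (V.toZWord.val p q * bsA p q ^ (-(p * r))) ++
          pnf p q ((w.lmul (p * r)).val p q) := by
  obtain ⟨e, he⟩ := hdvd
  have hg : (q : ℤ) = p * e := by exact_mod_cast he
  have hp0 : p ≠ 0 := by omega
  have hq0 : q ≠ 0 := by omega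
  have hVw : (V.app w).BrittonReduced p q := BrittonReduced.attach hV V.getLast?_pairs hw
  obtain ⟨u, hu⟩ := exists_isBrittonPnf ((V.app w).val p q)
  have hs : Shift p q 0 (V.app w) u :=
    shift_of_val_eq hp0 hq0 hVw hu.1.1 (by simpa using hu.1.2.1)
  have hpeak : u.peak = V.pairs.length + w.peak := by
    rw [← peak_app, peak_congr hs.dirs_eq]
  obtain ⟨V', w', r, rfl, hr, hs'⟩ := exists_rep_of_shift hg V (e := 0) (by simpa using hs) (fun y hy =>
    hu.bounded hp hpq ⟨e, he⟩ y (List.take_subset_take_left _ (by omega) hy))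
  rw [zero_add] at hs'
  have hn : ∀ (X : Valley) (y : ZWord), (X.app y).norm p q = X.toZWord.norm p q + y.norm p q := by
    intro X y
    rw [toZWord, app, app, norm_attach, norm_attach]
    simp [norm_single]
  have hVr := hr.val_eq hg
  have hw' := hs'.val_eq
  -- both parts have minimal length, as otherwise the whole word had not
  have hgeo := hu.1.2.2
  have hsum := geoLen_mul_le (V'.toZWord.val p q) (w'.val p q)
  have hval : V'.toZWord.val p q * w'.val p q = (V.app w).val p q := by
    rw [← val_app, hu.1.2.1]
  rw [hval] at hsum
  rw [hn] at hgeo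
  have hle1 := geoLen_val_le_norm (p := p) (q := q) V'.toZWord
  have hle2 := geoLen_val_le_norm (p := p) (q := q) w'
  have hsV : Shift p q 0 V.toZWord (V'.app (single (p * r))) := by
    have := hr.shift hg (e := 0) (x := single 0) (y := single (p * r)) (by simp [Shift])
    rwa [mul_zero] at this
  have hredV : V'.toZWord.BrittonReduced p q :=
    (hsV.brittonReduced hV).attach_single
  have hminV : V'.toZWord.IsMinimalFor p q (V'.toZWord.val p q) := ⟨hredV, rfl, by omega⟩
  have hminw : w'.IsMinimalFor p q (w'.val p q) :=
    ⟨hs'.brittonReduced hw.tail, rfl, by omega⟩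
  have hpV : V'.toZWord.IsBrittonPnf p q (V'.toZWord.val p q) := by
    refine ⟨hminV, fun X hX hlt => ?_⟩
    have hsX := shift_of_val_eq hp0 hq0 (c := 0) hredV hX.1 (by simp [hX.2.1])
    have hXd := hsX.dirs_eq
    have hsX' : Shift p q 0 (V'.app w') (attach X.pairs (w'.lmul X.last)) := by
      have h1 : ∀ (l : List (ℤ × Dir)) (c : ℤ) (Y : ZWord), Shift p q c (attach l (single 0)) Y →
          Shift p q c (attach l w') (attach Y.pairs (w'.lmul Y.last)) := by
        intro l
        induction l with
        | nil =>
          intro c Y hY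
          cases Y with
          | single β =>
            rw [attach_nil, Shift, add_zero] at hY
            subst hY
            exact shift_lmul _ _
          | cons => exact hY.elim
        | cons x l ih =>
          intro c Y hY
          cases Y with
          | single β => exact hY.elim
          | cons β θ Y =>
            obtain ⟨h1, μ, h2, h3⟩ := hY
            exact ⟨h1, μ, h2, ih _ _ h3⟩
      exact h1 _ _ _ hsX
    have hnX : (attach X.pairs (w'.lmul X.last)).norm p q ≤ (V'.app w').norm p q := by
      have h1 := norm_lmul_le (p := p) (q := q) X.last w'
      have h2 := hX.2.2
      have h3 := norm_attach (p := p) (q := q) X.pairs (single X.last)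
      rw [attach_pairs_last, norm_single] at h3
      rw [norm_attach, hn]
      omega
    refine hu.2 _ (hu.1.of_shift hsX' hnX) (.inl ?_)
    have hd : X.pairs.map Prod.snd = V'.pairs.map Prod.snd := by
      rw [pairs_map_snd, hXd, toZWord, dirs_app]; simp
    have hl1 := leftPart_attach hd (w'.lmul X.last)
    have hl2 := leftPart_app V' w'
    have hl3 := leftPart_attach hd (single X.last)
    have hl4 := leftPart_app V' (single 0)
    have hr3 := rightPart_attach hd (single X.last)
    have hr4 := rightPart_attach (V := V') rfl (single 0)
    rw [attach_pairs_last] at hl3 hr3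
    have hlen : X.pairs.length = V'.pairs.length := by simpa using congrArg List.length hd
    have hll : (w'.lmul X.last).leftPart.length = w'.leftPart.length := by
      rw [leftPart_eq, leftPart_eq, flatMap_length, flatMap_length,
        peak_congr (dirs_lmul X.last w')]
      simp [dirs_lmul]
    rcases hlt with hlt | ⟨-, hlt⟩
    · rw [hl3, toZWord, hl4] at hlt
      simp only [leftPart, coeffs, dirs, List.zip_nil_right, List.take_nil, List.flatMap_nil,
        List.append_nil] at hlt
      rw [hl1, hl2]
      refine List.Shortlex.of_lex ?_ (lex_append_of_lex ?_
        ((List.shortlex_iff_lex ?_).1 hlt))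
      · rw [List.length_append, List.length_append, flatMap_length, flatMap_length, hll, hlen]
      · rw [flatMap_length, flatMap_length, hlen]
      · rw [flatMap_length, flatMap_length, hlen]
    · rw [rightPartBar, rightPartBar, hr3] at hlt
      change DeltaLt _ (List.map _ (rightPart (attach V'.pairs (single 0)))).reverse at hlt
      rw [hr4] at hlt
      exact (deltaLt_irrefl _ hlt).elim
  have hpw : w'.IsBrittonPnf p q (w'.val p q) := by
    refine ⟨hminw, fun y hy hlt => ?_⟩
    have hsy := shift_of_val_eq hp0 hq0 (c := 0) hminw.1 hy.1 (by simp [hy.2.1])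
    refine hu.2 (V'.app y) (hu.1.of_shift (hsy.attach_congr _) ?_) ?_
    · rw [hn, hn, hy.2.2, hminw.2.2]
    · rw [PeakLt, leftPart_app, leftPart_app, rightPartBar, rightPartBar,
        app, app, rightPart_attach rfl, rightPart_attach rfl]
      rcases hlt with hlt | ⟨h1, h2⟩
      · exact .inl (List.Shortlex.append_left hlt _)
      · exact .inr ⟨by rw [h1], h2⟩
  refine ⟨r, V', hr, ?_⟩
  rw [toZWord_mul, ← hu.expand_eq hp0 hq0, app, expand_attach, ← hVr,
    val_lmul, ← hw', ← hpV.expand_eq hp0 hq0, ← hpw.expand_eq hp0 hq0]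
  rfl

end Valley

end PeakNormalForms

section Keys

variable {p q : ℕ}

/-! ### Peak normal forms of valleys through integer keys -/

/-- The number whose digits in base `B` are the positions of the integers in the order
`0, 1, -1, 2, -2, …`. -/
def digitCode (B : ℤ) : List (ℤ × Dir) → ℤ
  | [] => 0
  | x :: l => zrank x.1 * B ^ l.length + digitCode B l

lemma digitCode_append (B : ℤ) (l l' : List (ℤ × Dir)) :
    digitCode B (l ++ l') = digitCode B l * B ^ l'.length + digitCode B l' := by
  induction l with
  | nil => simp [digitCode]
  | cons x l ih => simp [digitCode, ih, pow_add]; ring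

lemma digitCode_nonneg (l : List (ℤ × Dir)) : 0 ≤ digitCode (2 * q) l := by
  induction l with
  | nil => simp [digitCode]
  | cons x l ih => rw [digitCode]; positivity

lemma zrank_lt {α : ℤ} (h : |α| < (q : ℤ)) : (zrank α : ℤ) < 2 * q := by
  rw [Int.abs_eq_natAbs] at h
  unfold zrank
  split_ifs <;> omega

lemma digitCode_lt {l : List (ℤ × Dir)} (h : ∀ x ∈ l, Bounded p q x) :
    digitCode (2 * q) l < (2 * q) ^ l.length := by
  induction l with
  | nil => simp [digitCode]
  | cons x l ih =>
    have h1 := ih fun y hy => h y (List.mem_cons_of_mem _ hy)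
    have h2 := zrank_lt (h x List.mem_cons_self).1
    have h3 : (0 : ℤ) ≤ (2 * q) ^ l.length := by positivity
    rw [digitCode, List.length_cons, pow_succ]
    nlinarith

/-- The order of the codes is the order on words over `Δ`. -/
lemma digitCode_lt_of_deltaLt {l l' : List (ℤ × Dir)} (hb : ∀ x ∈ l, Bounded p q x)
    (hd : l.map Prod.snd = l'.map Prod.snd)
    (h : DeltaLt (l.flatMap (fun x => [DSym.int x.1, DSym.dir x.2]))
      (l'.flatMap (fun x => [DSym.int x.1, DSym.dir x.2]))) :
    digitCode (2 * q) l < digitCode (2 * q) l' := by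
  induction l generalizing l' with
  | nil =>
    cases l' with
    | nil => exact (deltaLt_irrefl _ h).elim
    | cons => simp at hd
  | cons x l ih =>
    cases l' with
    | nil => simp at hd
    | cons x' l' =>
      have hlen : l.length = l'.length := by simpa using congrArg List.length hd
      simp only [List.map_cons, List.cons.injEq] at hd
      have hb' : ∀ y ∈ l, Bounded p q y := fun y hy => hb y (List.mem_cons_of_mem _ hy)
      have hl : ((x :: l).flatMap (fun x => [DSym.int x.1, DSym.dir x.2])).length =
          ((x' :: l').flatMap (fun x => [DSym.int x.1, DSym.dir x.2])).length := by
        rw [flatMap_length, flatMap_length]; simp [hlen]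
      have h1 := (List.shortlex_iff_lex hl).1 h
      simp only [List.flatMap_cons, List.cons_append, List.nil_append] at h1
      rw [digitCode, digitCode, hlen]
      obtain ⟨a, θ⟩ := x
      obtain ⟨b, θ'⟩ := x'
      obtain rfl : θ = θ' := hd.1
      cases h1 with
      | rel h1 =>
        rw [DSym.lt_iff] at h1
        simp only [DSym.rank, Nat.add_lt_add_iff_left] at h1
        have h2 := digitCode_lt hb'
        have h3 := digitCode_nonneg (q := q) l'
        have h4 : (zrank a : ℤ) + 1 ≤ zrank b := by exact_mod_cast h1
        rw [hlen] at h2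
        have h5 : (0 : ℤ) ≤ (2 * q) ^ l'.length := by positivity
        dsimp only
        nlinarith
      | cons h1 =>
        have h3 := ih hb' hd.2 (List.Shortlex.of_lex (by
          rw [flatMap_length, flatMap_length, hlen]) (List.lex_cons_iff.1 h1))
        dsimp only
        omega

/-- A bounded representation `V'` of `V` with exponent `p r'`, followed by `a ^ (p (r' - r))`, is
the Britton peak normal form of `V a ^ (-p r)` if it minimizes first the norm and then the code. -/
lemma Valley.isBrittonPnf_of_minimal (hp : 1 ≤ p) (hpq : p < q) (hdvd : p ∣ q) {V V' : Valley}
    (hV : V.toZWord.BrittonReduced p q) {r r' : ℤ} (hr' : Rep p q V r' V')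
    (hmin : ∀ r'' V'', Rep p q V r'' V'' →
      (2 * q : ℤ) ^ V.pairs.length * (pairsNorm p q V'.pairs + aLen p q (p * (r' - r))) +
        digitCode (2 * q) V'.pairs ≤
      (2 * q : ℤ) ^ V.pairs.length * (pairsNorm p q V''.pairs + aLen p q (p * (r'' - r))) +
        digitCode (2 * q) V''.pairs) :
    (V'.app (single (p * (r' - r)))).IsBrittonPnf p q
      (V.toZWord.val p q * bsA p q ^ (-(p * r))) := by
  obtain ⟨e, he⟩ := hdvd
  have hg : (q : ℤ) = p * e := by exact_mod_cast he
  have hp0 : p ≠ 0 := by omega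
  have hq0 : q ≠ 0 := by omega
  have hred : (V.app (single (-(p * r)))).BrittonReduced p q := BrittonReduced.attach_single hV
  have hval : (V.app (single (-(p * r)))).val p q = V.toZWord.val p q * bsA p q ^ (-(p * r)) := by
    rw [val_app, ZWord.val]
  rw [← hval]
  obtain ⟨u, hu⟩ := exists_isBrittonPnf ((V.app (single (-(p * r)))).val p q)
  have hs : Shift p q 0 (V.app (single (-(p * r)))) u :=
    shift_of_val_eq hp0 hq0 hred hu.1.1 (by simpa using hu.1.2.1)
  obtain ⟨V₀, y, r₀, rfl, hr₀, hs'⟩ := exists_rep_of_shift hg V (e := 0) (by simpa using hs)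
    (fun y hy => hu.bounded hp hpq ⟨e, he⟩ y (List.take_subset_take_left _ (by
      rw [peak_congr hs.dirs_eq, peak_app]; omega) hy))
  have hsV' : Shift p q 0 (V.app (single (-(p * r)))) (V'.app (single (p * (r' - r)))) := by
    have := hr'.shift hg (e := 0) (x := single (-(p * r))) (y := single (p * (r' - r)))
      (by rw [Shift]; ring)
    rwa [mul_zero] at this
  cases y with
  | cons => exact hs'.elim
  | single y =>
  obtain rfl : y = p * (r₀ - r) := by rw [Shift] at hs'; rw [hs']; ring
  have h1 := hmin _ _ hr₀
  have hb' := hr'.bounded hpq.le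
  have hb₀ := hr₀.bounded hpq.le
  have hc' := digitCode_lt hb'
  have hc₀ := digitCode_lt hb₀
  have hn' := digitCode_nonneg (q := q) V'.pairs
  have hn₀ := digitCode_nonneg (q := q) V₀.pairs
  rw [hr'.pairs_length] at hc'
  rw [hr₀.pairs_length] at hc₀
  have hgeo := hu.1.2.2
  have hval' : (V'.app (single (p * (r' - r)))).val p q =
      (V.app (single (-(p * r)))).val p q := by simpa using hsV'.val_eq
  have hle := geoLen_val_le_norm (p := p) (q := q) (V'.app (single (p * (r' - r))))
  rw [hval', ← hgeo] at hle
  simp only [Valley.app, norm_attach, norm_single] at hle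
  have hle' : pairsNorm p q V'.pairs + aLen p q (p * (r' - r)) ≤
      pairsNorm p q V₀.pairs + aLen p q (p * (r₀ - r)) := by
    by_contra hlt
    have : ((pairsNorm p q V₀.pairs + aLen p q (p * (r₀ - r)) : ℕ) : ℤ) + 1 ≤
      ((pairsNorm p q V'.pairs + aLen p q (p * (r' - r)) : ℕ) : ℤ) := by
      exact_mod_cast not_le.1 hlt
    push_cast at this
    nlinarith
  have heq : pairsNorm p q V'.pairs + aLen p q (p * (r' - r)) =
      pairsNorm p q V₀.pairs + aLen p q (p * (r₀ - r)) := le_antisymm hle' hle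
  have hcode : digitCode (2 * q) V'.pairs ≤ digitCode (2 * q) V₀.pairs := by
    have : ((pairsNorm p q V'.pairs : ℕ) : ℤ) + (aLen p q (p * (r' - r)) : ℕ) =
      (pairsNorm p q V₀.pairs : ℕ) + (aLen p q (p * (r₀ - r)) : ℕ) := by exact_mod_cast heq
    rw [this] at h1
    linarith
  have hm : (V'.app (single (p * (r' - r)))).IsMinimalFor p q
      ((V.app (single (-(p * r)))).val p q) := by
    refine ⟨hsV'.brittonReduced hred, hval', ?_⟩
    rw [← hgeo]
    simp only [Valley.app, norm_attach, norm_single]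
    exact heq
  have hl : ∀ (X : Valley) (c : ℤ), (X.app (single c)).leftPart =
      X.pairs.flatMap (fun x => [DSym.int x.1, DSym.dir x.2]) := by
    intro X c
    rw [leftPart_app]
    simp [leftPart, coeffs, dirs]
  have heqr : (V'.app (single (p * (r' - r)))).rightPartBar =
      (V₀.app (single (p * (r₀ - r)))).rightPartBar := by
    simp only [rightPartBar, Valley.app]
    rw [rightPart_attach rfl, rightPart_attach rfl]
    simp [rightPart, dirs, coeffs]
  have heql : (V'.app (single (p * (r' - r)))).leftPart =
      (V₀.app (single (p * (r₀ - r)))).leftPart := by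
    apply deltaLt_trichotomous
    · exact fun h => hu.2 _ hm (.inl h)
    · intro h
      rw [hl, hl] at h
      have := digitCode_lt_of_deltaLt hb₀ (by rw [hr₀.map_snd, hr'.map_snd]) h
      omega
  rw [eq_of_parts_eq hp0 hq0 (hm.2.1.trans hu.1.2.1.symm) heql heqr]
  exact hu

/-! ### Sinks -/

/-- The number of sinks of a valley, except that the empty valley has none. -/
def Valley.size : Valley → ℕ
  | .nil => 0
  | .node _ U _ W => max U.size 1 + W.size

/-- The number of positions `i` with `θᵢ ≠ t` and `θᵢ₊₁ ≠ T`, where `θ₀ = e`. -/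
def sinkCount : Option Dir → List Dir → ℕ
  | e, [] => if e ≠ some Dir.t then 1 else 0
  | e, θ :: l => (if e ≠ some Dir.t ∧ θ ≠ Dir.T then 1 else 0) + sinkCount (some θ) l

lemma sinks_eq (u : ZWord) : u.sinks = sinkCount none u.dirs := by
  have key : ∀ (l : List Dir) (e : Option Dir),
      ((Finset.range (l.length + 1)).filter (fun i =>
        (e :: l.map some)[i]? ≠ some (some Dir.t) ∧ l[i]? ≠ some Dir.T)).card = sinkCount e l := by
    intro l
    induction l with
    | nil =>
      intro e
      rw [sinkCount]
      split_ifs with h <;> simp_all [Finset.filter_singleton]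
    | cons θ l ih =>
      intro e
      rw [sinkCount, ← ih, List.length_cons, Finset.range_add_one', Finset.filter_insert,
        Finset.filter_map]
      split_ifs with h1 h2 h2
      · rw [Finset.card_insert_of_notMem (by simp), Finset.card_map, add_comm 1]
        rfl
      · simp_all
      · simp_all
      · rw [Finset.card_map, zero_add]
        rfl
  rw [← key, sinks]
  congr 1
  apply Finset.filter_congr
  intro i hi
  have : u.dirAt i ≠ some Dir.t ↔ (none :: u.dirs.map some)[i]? ≠ some (some Dir.t) := by
    cases i with
    | zero => simp [dirAt]
    | succ i => simp [dirAt]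
  rw [this]
  rfl

/-- Sinks of a valley in its context: before `t`, and not after `t`, even the empty valley
contributes a sink, while after `t` it need not contribute one. -/
lemma Valley.le_sinkCount (V : Valley) :
    (∀ (e : Option Dir) (l : List Dir), e ≠ some Dir.t →
      max V.size 1 + sinkCount (some Dir.t) l ≤
        sinkCount e (V.pairs.map Prod.snd ++ Dir.t :: l)) ∧
    ∀ l, V.size + sinkCount (some Dir.t) l ≤
      sinkCount (some Dir.t) (V.pairs.map Prod.snd ++ l) := by
  induction V with
  | nil =>
    refine ⟨fun e l he => ?_, fun l => ?_⟩
    · simp [Valley.pairs, Valley.size, sinkCount, he]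
    · simp [Valley.pairs, Valley.size]
  | node α U β W ihU ihW =>
    have key : ∀ (e : Option Dir) (l : List Dir),
        (Valley.node α U β W).size + sinkCount (some Dir.t) l ≤
          sinkCount e ((Valley.node α U β W).pairs.map Prod.snd ++ l) := by
      intro e l
      have h1 := ihU.1 (some Dir.T) (W.pairs.map Prod.snd ++ l) (by simp)
      have h2 := ihW.2 l
      simp only [Valley.pairs, Valley.size, List.map_cons, List.map_append, List.cons_append,
        List.append_assoc, sinkCount]
      simp only [ne_eq, not_true_eq_false, and_false, if_false]
      omega
    refine ⟨fun e l he => ?_, fun l => key _ l⟩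
    have h1 := key e (Dir.t :: l)
    have h2 : 1 ≤ (Valley.node α U β W).size := by simp only [Valley.size]; omega
    rw [sinkCount] at h1
    simp only [ne_eq, not_true_eq_false, false_and, if_false, zero_add] at h1
    omega

lemma Valley.size_le_sinks (V : Valley) : max V.size 1 ≤ V.toZWord.sinks := by
  rw [sinks_eq, Valley.toZWord, Valley.dirs_app]
  cases V with
  | nil => simp [Valley.size, Valley.pairs, sinkCount]
  | node α U β W =>
    have h1 := U.le_sinkCount.1 (some Dir.T) (W.pairs.map Prod.snd) (by simp)
    have h2 := W.le_sinkCount.2 []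
    rw [List.append_nil] at h2
    simp [Valley.size, Valley.pairs, sinkCount]
    omega

end Keys

/-! ### Programs with expressions -/

/-- Integer expressions over registers and array entries. -/
inductive Ex
  | lit (c : ℤ)
  | var (x : ℕ)
  | op (o : ArithOp) (e f : Ex)
  | get (b : ℕ) (e : Ex)

namespace Ex

instance : Add Ex := ⟨op .plus⟩
instance : Sub Ex := ⟨op .minus⟩
instance : Mul Ex := ⟨op .times⟩
instance : Div Ex := ⟨op .quo⟩
instance : Mod Ex := ⟨op .rem⟩

/-- The value of an expression in a given memory. -/
def eval : Ex → Mem → ℤ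
  | lit c, _ => c
  | var x, m => m.reg x
  | op o e f, m => o.eval (e.eval m) (f.eval m)
  | get b e, m => m.arr b (e.eval m)

section

variable (e f : Ex) (m : Mem) (c : ℤ) (x b : ℕ)

@[simp] lemma eval_lit : (lit c).eval m = c := rfl
@[simp] lemma eval_var : (var x).eval m = m.reg x := rfl
@[simp] lemma eval_get : (get b e).eval m = m.arr b (e.eval m) := rfl
@[simp] lemma eval_add : (e + f).eval m = e.eval m + f.eval m := rfl
@[simp] lemma eval_sub : (e - f).eval m = e.eval m - f.eval m := rfl
@[simp] lemma eval_mul : (e * f).eval m = e.eval m * f.eval m := rfl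
@[simp] lemma eval_div : (e / f).eval m = e.eval m / f.eval m := rfl
@[simp] lemma eval_mod : (e % f).eval m = e.eval m % f.eval m := rfl

end

/-- The number of leaves and array accesses. -/
def size : Ex → ℕ
  | lit _ => 1
  | var _ => 1
  | op _ e f => e.size + f.size
  | get _ e => e.size + 1

/-- The number of steps that the evaluation takes. -/
def cost : Ex → ℕ
  | lit _ => 1
  | var _ => 2
  | op _ e f => e.cost + f.cost + 1
  | get _ e => e.cost + 1

section

variable (e f : Ex) (c : ℤ) (x b : ℕ)

@[simp] lemma size_lit : (lit c).size = 1 := rfl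
@[simp] lemma size_var : (var x).size = 1 := rfl
@[simp] lemma size_get : (get b e).size = e.size + 1 := rfl
@[simp] lemma size_add : (e + f).size = e.size + f.size := rfl
@[simp] lemma size_sub : (e - f).size = e.size + f.size := rfl
@[simp] lemma size_mul : (e * f).size = e.size + f.size := rfl
@[simp] lemma size_div : (e / f).size = e.size + f.size := rfl
@[simp] lemma size_mod : (e % f).size = e.size + f.size := rfl

end

section

variable (e f : Ex) (c : ℤ) (x b : ℕ)

@[simp] lemma cost_lit : (lit c).cost = 1 := rfl
@[simp] lemma cost_var : (var x).cost = 2 := rfl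
@[simp] lemma cost_get : (get b e).cost = e.cost + 1 := rfl
@[simp] lemma cost_add : (e + f).cost = e.cost + f.cost + 1 := rfl
@[simp] lemma cost_sub : (e - f).cost = e.cost + f.cost + 1 := rfl
@[simp] lemma cost_mul : (e * f).cost = e.cost + f.cost + 1 := rfl
@[simp] lemma cost_div : (e / f).cost = e.cost + f.cost + 1 := rfl
@[simp] lemma cost_mod : (e % f).cost = e.cost + f.cost + 1 := rfl

end

/-- Registers from `40` on are reserved for the evaluation of expressions; an expression is
admissible for the bound `X` if it does not use them, and if its constants are at most `X`. -/
def Admissible (X : ℤ) : Ex → Prop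
  | lit c => |c| ≤ X
  | var x => x < 40
  | op _ e f => e.Admissible X ∧ f.Admissible X
  | get _ e => e.Admissible X

section

variable (X : ℤ) (e f : Ex) (c : ℤ) (x b : ℕ)

@[simp] lemma admissible_lit : (lit c).Admissible X ↔ |c| ≤ X := Iff.rfl
@[simp] lemma admissible_var : (var x).Admissible X ↔ x < 40 := Iff.rfl
@[simp] lemma admissible_get : (get b e).Admissible X ↔ e.Admissible X := Iff.rfl
@[simp] lemma admissible_add : (e + f).Admissible X ↔ e.Admissible X ∧ f.Admissible X := Iff.rfl
@[simp] lemma admissible_sub : (e - f).Admissible X ↔ e.Admissible X ∧ f.Admissible X := Iff.rfl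
@[simp] lemma admissible_mul : (e * f).Admissible X ↔ e.Admissible X ∧ f.Admissible X := Iff.rfl
@[simp] lemma admissible_div : (e / f).Admissible X ↔ e.Admissible X ∧ f.Admissible X := Iff.rfl
@[simp] lemma admissible_mod : (e % f).Admissible X ↔ e.Admissible X ∧ f.Admissible X := Iff.rfl

end

/-- The program that puts the value of an expression into register `x`. -/
def compile : Ex → ℕ → Prog
  | lit c, x => .const x c
  | var y, x => .seq (.const x 0) (.arith .plus x x y)
  | op o e f, x => .seq (e.compile x) (.seq (f.compile (x + 1)) (.arith o x x (x + 1)))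
  | get b e, x => .seq (e.compile x) (.load x b x)

end Ex

namespace Mem

variable (m : Mem) (x y b b' : ℕ) (c i : ℤ)

@[simp] lemma setReg_reg : (m.setReg x c).reg y = if y = x then c else m.reg y := by
  simp [setReg, Function.update_apply]
@[simp] lemma setReg_arr : (m.setReg x c).arr = m.arr := rfl
@[simp] lemma setReg_out : (m.setReg x c).out = m.out := rfl
@[simp] lemma setArr_reg : (m.setArr b i c).reg = m.reg := rfl
@[simp] lemma setArr_out : (m.setArr b i c).out = m.out := rfl
lemma setArr_arr : (m.setArr b i c).arr b' =
    if b' = b then Function.update (m.arr b) i c else m.arr b' := by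
  by_cases h : b' = b
  · subst h; simp [setArr]
  · simp [setArr, h]

/-- Equality up to the registers that are reserved for the evaluation of expressions. -/
def Eqv (m m' : Mem) : Prop := (∀ x < 40, m.reg x = m'.reg x) ∧ m.arr = m'.arr ∧ m.out = m'.out

/-- All integers are at most `X` in absolute value. -/
def Bdd (X : ℤ) (m : Mem) : Prop := (∀ x < 40, |m.reg x| ≤ X) ∧ ∀ b i, |m.arr b i| ≤ X

variable {m} {X : ℤ}

lemma Bdd.setReg (h : m.Bdd X) (hc : |c| ≤ X) : (m.setReg x c).Bdd X := by
  refine ⟨fun y hy => ?_, h.2⟩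
  rw [setReg_reg]
  split_ifs
  · exact hc
  · exact h.1 y hy

lemma Bdd.setArr (h : m.Bdd X) (hc : |c| ≤ X) : (m.setArr b i c).Bdd X := by
  refine ⟨h.1, fun b' j => ?_⟩
  rw [setArr_arr]
  split_ifs
  · rw [Function.update_apply]
    split_ifs
    · exact hc
    · exact h.2 b j
  · exact h.2 b' j

end Mem

/-- Every operation at most multiplies the bounds on its arguments. -/
lemma ArithOp.abs_eval_le (o : ArithOp) {X x y : ℤ} {i j : ℕ} (hX : 2 ≤ X) (hi : 1 ≤ i)
    (hj : 1 ≤ j) (hx : |x| ≤ X ^ i) (hy : |y| ≤ X ^ j) : |o.eval x y| ≤ X ^ (i + j) := by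
  have h1 : X ≤ X ^ i := by
    calc X = X ^ 1 := (pow_one X).symm
      _ ≤ X ^ i := pow_le_pow_right₀ (by omega) hi
  have h2 : X ≤ X ^ j := by
    calc X = X ^ 1 := (pow_one X).symm
      _ ≤ X ^ j := pow_le_pow_right₀ (by omega) hj
  have h3 : X ^ i + X ^ j ≤ X ^ i * X ^ j := by nlinarith
  have h4 : X ^ i ≤ X ^ i * X ^ j := by nlinarith
  have h5 : X ^ j ≤ X ^ i * X ^ j := by nlinarith
  rw [pow_add]
  cases o with
  | plus => exact (abs_add_le x y).trans (by linarith)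
  | minus => exact (abs_sub x y).trans (by linarith)
  | times => rw [eval, abs_mul]; exact mul_le_mul hx hy (abs_nonneg y) (by linarith)
  | quo =>
    refine le_trans ?_ (hx.trans h4)
    rw [eval, Int.abs_eq_natAbs, Int.abs_eq_natAbs]
    exact_mod_cast Int.natAbs_ediv_le_natAbs x y
  | rem =>
    rw [eval]
    rcases eq_or_ne y 0 with rfl | h0
    · rw [Int.emod_zero]; linarith
    · rw [abs_of_nonneg (Int.emod_nonneg x h0)]
      have := Int.emod_lt_abs x h0
      linarith

lemma Ex.size_pos (e : Ex) : 1 ≤ e.size := by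
  cases e with
  | op o e f => have := e.size_pos; rw [size]; omega
  | _ => simp [size]

/-- The value is bounded by a power of the bound on the memory, with the size as exponent. -/
lemma Ex.abs_eval_le {X : ℤ} (hX : 2 ≤ X) {m : Mem} (hm : m.Bdd X) (e : Ex)
    (he : e.Admissible X) : |e.eval m| ≤ X ^ e.size := by
  induction e with
  | lit c => simpa [size] using he
  | var x => simpa [size] using hm.1 x he
  | op o e f ihe ihf => exact o.abs_eval_le hX e.size_pos f.size_pos (ihe he.1) (ihf he.2)
  | get b e ih =>
    calc _ ≤ X ^ 1 := by simpa using hm.2 b _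
      _ ≤ _ := pow_le_pow_right₀ (by omega) (by rw [size]; omega)

/-- The evaluation of a compiled expression affects only registers from `x` on. The bound `200` on
the size is larger than needed for all expressions below; it makes `X ^ 200` a bound on all
intermediate results. -/
lemma Ex.run_compile {X : ℤ} (hX : 2 ≤ X) {m : Mem} (hm : m.Bdd X) (e : Ex)
    (he : e.Admissible X) (hs : e.size ≤ 200) {x : ℕ} (hx : 40 ≤ x) {m₀ : Mem} (h₀ : m₀.Eqv m) :
    ∃ m₁, Run (X ^ 200) (e.compile x) m₀ e.cost m₁ ∧ (∀ y < x, m₁.reg y = m₀.reg y) ∧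
      m₁.arr = m₀.arr ∧ m₁.out = m₀.out ∧ m₁.reg x = e.eval m := by
  have hle : ∀ {c : ℤ} {i : ℕ}, i ≤ 200 → |c| ≤ X ^ i → |c| ≤ X ^ 200 := fun hi hc =>
    hc.trans (pow_le_pow_right₀ (by omega) hi)
  induction e generalizing x m₀ with
  | lit c =>
    exact ⟨_, .const _ _ _ (hle (i := 1) (by omega) (by simpa using he)),
      fun y hy => by simp [hy.ne], rfl, rfl, by simp⟩
  | var y =>
    have hy : y < 40 := he
    refine ⟨_, .seq _ _ _ _ _ 1 1 (.const _ _ 0 (by simp; positivity))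
      (.arith _ .plus x x y ?_), fun z hz => by simp [hz.ne], rfl, rfl, ?_⟩
    · simp only [ArithOp.eval, Mem.setReg_reg, if_true]
      rw [if_neg (by omega), zero_add, h₀.1 y hy]
      exact hle (i := 1) (by omega) (by simpa using hm.1 y hy)
    · simp only [ArithOp.eval, Mem.setReg_reg, if_true]
      rw [if_neg (by omega), zero_add, h₀.1 y hy]
      rfl
  | op o e f ihe ihf =>
    rw [size] at hs
    obtain ⟨m₁, r1, a1, b1, c1, d1⟩ := ihe he.1 (by omega) hx h₀
    have h₁ : m₁.Eqv m := ⟨fun y hy => (a1 y (by omega)).trans (h₀.1 y hy), b1.trans h₀.2.1,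
      c1.trans h₀.2.2⟩
    obtain ⟨m₂, r2, a2, b2, c2, d2⟩ := ihf he.2 (by omega) (x := x + 1) (by omega) h₁
    have hv : o.eval (m₂.reg x) (m₂.reg (x + 1)) = (op o e f).eval m := by
      rw [a2 x (by omega), d1, d2]; rfl
    refine ⟨m₂.setReg x ((op o e f).eval m), ?_, fun y hy => ?_, b2.trans b1, c2.trans c1,
      by simp⟩
    · rw [← hv]
      have := Run.arith (W := X ^ 200) m₂ o x x (x + 1) (by
        rw [hv]; exact hle hs (abs_eval_le hX hm (op o e f) he))
      have := Run.seq _ _ _ _ _ _ _ r1 (.seq _ _ _ _ _ _ _ r2 this)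
      rwa [← add_assoc] at this
    · rw [Mem.setReg_reg, if_neg hy.ne, a2 y (by omega), a1 y hy]
  | get b e ih =>
    rw [size] at hs
    obtain ⟨m₁, r1, a1, b1, c1, d1⟩ := ih he (by omega) hx h₀
    refine ⟨_, .seq _ _ _ _ _ _ _ r1 (.load _ _ _ _), fun y hy => ?_, b1, c1, ?_⟩
    · rw [Mem.setReg_reg, if_neg hy.ne, a1 y hy]
    · rw [Mem.setReg_reg, if_pos rfl, d1, b1, h₀.2.1, eval]

/-! ### Statements and their execution -/

namespace Prog

/-- Assign the value of an expression to a register. The result is computed in register `40`. -/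
def assign (x : ℕ) (e : Ex) : Prog :=
  .seq (e.compile 40) (.seq (.const x 0) (.arith .plus x x 40))

/-- Store a value in an array, at the address given by an expression. -/
def put (b : ℕ) (i e : Ex) : Prog :=
  .seq (i.compile 40) (.seq (e.compile 41) (.store b 40 41))

/-- Output the value of an expression. -/
def write (e : Ex) : Prog := .seq (e.compile 40) (.emit 40)

/-- Execute `P` if `e < f`, and `Q` otherwise. -/
def ite (e f : Ex) (P Q : Prog) : Prog :=
  .seq (e.compile 40) (.seq (f.compile 41) (.ifLt 40 41 P Q))

/-- Repeat `P` while `e < f`. Both sides are evaluated again after each execution of the body. -/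
def loop (e f : Ex) (P : Prog) : Prog :=
  .seq (e.compile 40) (.seq (f.compile 41)
    (.whileLt 40 41 (.seq P (.seq (e.compile 40) (f.compile 41)))))

end Prog

/-- Started in a state equivalent to `m`, the program halts in a state equivalent to `m'` after at
most `n` steps, and `X` bounds the integers in `m'`; intermediate results may be as large as
`X ^ 200`. -/
def Exec (X : ℤ) (P : Prog) (m : Mem) (n : ℕ) (m' : Mem) : Prop :=
  m'.Bdd X ∧ ∀ m₀ : Mem, m₀.Eqv m → ∃ n₀ ≤ n, ∃ m₁ : Mem, m₁.Eqv m' ∧ Run (X ^ 200) P m₀ n₀ m₁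

section Exec

variable {X : ℤ} {m m₁ m₂ : Mem} {P Q : Prog} {n n₁ n₂ : ℕ} {e f : Ex}

lemma Exec.bdd (h : Exec X P m n m₁) : m₁.Bdd X := h.1

lemma Exec.mono (h : Exec X P m n m₁) (hn : n ≤ n₁) : Exec X P m n₁ m₁ :=
  ⟨h.1, fun m₀ h₀ => by
    obtain ⟨n₀, hn₀, r⟩ := h.2 m₀ h₀
    exact ⟨n₀, hn₀.trans hn, r⟩⟩

lemma Exec.seq (h : Exec X P m n m₁) (h' : Exec X Q m₁ n₁ m₂) :
    Exec X (.seq P Q) m (n + n₁) m₂ := by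
  refine ⟨h'.1, fun m₀ h₀ => ?_⟩
  obtain ⟨k, hk, a, ha, ra⟩ := h.2 m₀ h₀
  obtain ⟨l, hl, b, hb, rb⟩ := h'.2 a ha
  exact ⟨k + l, by omega, b, hb, .seq _ _ _ _ _ _ _ ra rb⟩

lemma exec_skip (hm : m.Bdd X) : Exec X .skip m 1 m :=
  ⟨hm, fun m₀ h₀ => ⟨1, le_rfl, m₀, h₀, .skip _⟩⟩

lemma exec_assign (hX : 2 ≤ X) (hm : m.Bdd X) {x : ℕ} (hx : x < 40) {v : ℤ} (he : e.Admissible X)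
    (hs : e.size ≤ 200) (hv : e.eval m = v) (hvX : |v| ≤ X) :
    Exec X (.assign x e) m (e.cost + 2) (m.setReg x v) := by
  refine ⟨hm.setReg x v hvX, fun m₀ h₀ => ?_⟩
  obtain ⟨m₁, r1, a1, b1, c1, d1⟩ := e.run_compile hX hm he hs le_rfl h₀
  have hX1 : X ≤ X ^ 200 := by
    calc X = X ^ 1 := (pow_one X).symm
      _ ≤ X ^ 200 := pow_le_pow_right₀ (by omega) (by omega)
  refine ⟨e.cost + (1 + 1), le_rfl, _, ?_, .seq _ _ _ _ _ _ _ r1 (.seq _ _ _ _ _ _ _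
    (.const _ _ 0 (by simp; positivity)) (.arith _ .plus x x 40 ?_))⟩
  · refine ⟨fun y hy => ?_, b1.trans h₀.2.1, c1.trans h₀.2.2⟩
    simp only [ArithOp.eval, Mem.setReg_reg, if_pos]
    split_ifs with h1 h2
    · omega
    · rw [zero_add, d1, hv]
    · rw [a1 y hy, h₀.1 y hy]
  · simp only [ArithOp.eval, Mem.setReg_reg, if_pos]
    rw [if_neg (by omega), zero_add, d1, hv]
    exact hvX.trans hX1

lemma run_compile_two (hX : 2 ≤ X) (hm : m.Bdd X) (he : e.Admissible X) (hs : e.size ≤ 200)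
    (hf : f.Admissible X) (hs' : f.size ≤ 200) {m₀ : Mem} (h₀ : m₀.Eqv m) :
    ∃ m₁ m₂, Run (X ^ 200) (e.compile 40) m₀ e.cost m₁ ∧
      Run (X ^ 200) (f.compile 41) m₁ f.cost m₂ ∧ m₂.Eqv m ∧ m₂.reg 40 = e.eval m ∧
      m₂.reg 41 = f.eval m := by
  obtain ⟨m₁, r1, a1, b1, c1, d1⟩ := e.run_compile hX hm he hs le_rfl h₀
  have h₁ : m₁.Eqv m := ⟨fun y hy => (a1 y (by omega)).trans (h₀.1 y hy), b1.trans h₀.2.1,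
    c1.trans h₀.2.2⟩
  obtain ⟨m₂, r2, a2, b2, c2, d2⟩ := f.run_compile hX hm hf hs' (x := 41) (by omega) h₁
  exact ⟨m₁, m₂, r1, r2, ⟨fun y hy => (a2 y (by omega)).trans (h₁.1 y hy), b2.trans h₁.2.1,
    c2.trans h₁.2.2⟩, (a2 40 (by omega)).trans d1, d2⟩

lemma exec_put (hX : 2 ≤ X) (hm : m.Bdd X) {b : ℕ} {j v : ℤ} (he : e.Admissible X)
    (hs : e.size ≤ 200) (hf : f.Admissible X) (hs' : f.size ≤ 200) (hj : e.eval m = j)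
    (hv : f.eval m = v) (hvX : |v| ≤ X) :
    Exec X (.put b e f) m (e.cost + f.cost + 1) (m.setArr b j v) := by
  refine ⟨hm.setArr b v j hvX, fun m₀ h₀ => ?_⟩
  obtain ⟨m₁, m₂, r1, r2, h₂, h40, h41⟩ := run_compile_two hX hm he hs hf hs' h₀
  refine ⟨e.cost + (f.cost + 1), by omega, _, ?_, .seq _ _ _ _ _ _ _ r1 (.seq _ _ _ _ _ _ _ r2
    (.store _ _ _ _))⟩
  rw [h40, h41, hj, hv]
  exact ⟨h₂.1, by simp only [Mem.setArr, h₂.2.1], h₂.2.2⟩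

lemma exec_write (hX : 2 ≤ X) (hm : m.Bdd X) {v : ℤ} (he : e.Admissible X) (hs : e.size ≤ 200)
    (hv : e.eval m = v) :
    Exec X (.write e) m (e.cost + 1) { m with out := m.out ++ [v] } := by
  refine ⟨hm, fun m₀ h₀ => ?_⟩
  obtain ⟨m₁, r1, a1, b1, c1, d1⟩ := e.run_compile hX hm he hs le_rfl h₀
  refine ⟨e.cost + 1, le_rfl, _, ?_, .seq _ _ _ _ _ _ _ r1 (.emit _ _)⟩
  exact ⟨fun y hy => (a1 y hy).trans (h₀.1 y hy), b1.trans h₀.2.1, by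
    simp only [c1, d1, hv, h₀.2.2]⟩

lemma exec_ite (hX : 2 ≤ X) (hm : m.Bdd X) (he : e.Admissible X) (hs : e.size ≤ 200)
    (hf : f.Admissible X) (hs' : f.size ≤ 200)
    (h1 : e.eval m < f.eval m → Exec X P m n m₁) (h2 : ¬ e.eval m < f.eval m → Exec X Q m n m₁) :
    Exec X (.ite e f P Q) m (e.cost + f.cost + n + 1) m₁ := by
  have key : ∀ m₀ : Mem, m₀.Eqv m → ∃ n₀ ≤ e.cost + f.cost + n + 1, ∃ m' : Mem,
      m'.Eqv m₁ ∧ Run (X ^ 200) (.ite e f P Q) m₀ n₀ m' := by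
    intro m₀ h₀
    obtain ⟨a, b, r1, r2, hb, h40, h41⟩ := run_compile_two hX hm he hs hf hs' h₀
    by_cases hc : e.eval m < f.eval m
    · obtain ⟨k, hk, c, hc', rc⟩ := (h1 hc).2 b hb
      exact ⟨e.cost + (f.cost + (k + 1)), by omega, c, hc', .seq _ _ _ _ _ _ _ r1
        (.seq _ _ _ _ _ _ _ r2 (.ifTrue _ _ _ _ _ _ _ (by rw [h40, h41]; exact hc) rc))⟩
    · obtain ⟨k, hk, c, hc', rc⟩ := (h2 hc).2 b hb
      exact ⟨e.cost + (f.cost + (k + 1)), by omega, c, hc', .seq _ _ _ _ _ _ _ r1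
        (.seq _ _ _ _ _ _ _ r2 (.ifFalse _ _ _ _ _ _ _ (by rw [h40, h41]; exact hc) rc))⟩
  by_cases hc : e.eval m < f.eval m
  · exact ⟨(h1 hc).1, key⟩
  · exact ⟨(h2 hc).1, key⟩

/-- The loop reaches `m'` from `m` by some iterations, with `n` steps. -/
def LoopTo (X : ℤ) (e f : Ex) (P : Prog) (m : Mem) (n : ℕ) (m' : Mem) : Prop :=
  ∀ n₂ m₂, Exec X (.loop e f P) m' n₂ m₂ → Exec X (.loop e f P) m (n + n₂) m₂

lemma LoopTo.refl : LoopTo X e f P m 0 m := fun n₂ m₂ h => h.mono (by omega)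

lemma LoopTo.trans (h : LoopTo X e f P m n m₁) (h' : LoopTo X e f P m₁ n₁ m₂) :
    LoopTo X e f P m (n + n₁) m₂ := fun k m₃ hk => (h _ _ (h' _ _ hk)).mono (by omega)

lemma LoopTo.mono (h : LoopTo X e f P m n m₁) (hn : n ≤ n₁) : LoopTo X e f P m n₁ m₁ :=
  fun k m₃ hk => (h _ _ hk).mono (by omega)

/-- One execution of the body of a loop, with the evaluation of the condition. -/
lemma loopTo_step (hX : 2 ≤ X) (hm : m.Bdd X) (he : e.Admissible X) (hs : e.size ≤ 200)
    (hf : f.Admissible X) (hs' : f.size ≤ 200) (hc : e.eval m < f.eval m)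
    (h : Exec X P m n m₁) : LoopTo X e f P m (e.cost + f.cost + n + 1) m₁ := by
  intro n₂ m₂ h2
  refine ⟨h2.1, fun m₀ h₀ => ?_⟩
  obtain ⟨a, b, r1, r2, hb, h40, h41⟩ := run_compile_two hX hm he hs hf hs' h₀
  obtain ⟨k, hk, c, hc', rc⟩ := h.2 b hb
  obtain ⟨l, hl, d, hd, rd⟩ := h2.2 c hc'
  cases rd with
  | seq _ c₁ _ _ _ l₁ l₂ rd1 rd =>
  cases rd with
  | seq _ c₂ _ _ _ l₃ l₄ rd2 rd3 =>
  refine ⟨e.cost + (f.cost + (k + (l₁ + l₃) + l₄ + 1)), by omega, d, hd,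
    .seq _ _ _ _ _ _ _ r1 (.seq _ _ _ _ _ _ _ r2 (.whileStep _ _ _ _ _ _ _ _
      (by rw [h40, h41]; exact hc) (.seq _ _ _ _ _ _ _ rc (.seq _ _ _ _ _ _ _ rd1 rd2)) rd3))⟩

lemma exec_loop_done (hX : 2 ≤ X) (hm : m.Bdd X) (he : e.Admissible X) (hs : e.size ≤ 200)
    (hf : f.Admissible X) (hs' : f.size ≤ 200) (hc : ¬ e.eval m < f.eval m) :
    Exec X (.loop e f P) m (e.cost + f.cost + 1) m := by
  refine ⟨hm, fun m₀ h₀ => ?_⟩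
  obtain ⟨a, b, r1, r2, hb, h40, h41⟩ := run_compile_two hX hm he hs hf hs' h₀
  exact ⟨e.cost + (f.cost + 1), by omega, b, hb, .seq _ _ _ _ _ _ _ r1 (.seq _ _ _ _ _ _ _ r2
    (.whileDone _ _ _ _ (by rw [h40, h41]; exact hc)))⟩

/-- A loop with a known number `N` of iterations, by an invariant. -/
lemma exec_loop (hX : 2 ≤ X) (he : e.Admissible X) (hs : e.size ≤ 200) (hf : f.Admissible X)
    (hs' : f.size ≤ 200) (N : ℕ) (I : ℕ → Mem → Prop)
    (hstep : ∀ j < N, ∀ m, I j m → m.Bdd X → e.eval m < f.eval m ∧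
      ∃ m', Exec X P m n m' ∧ I (j + 1) m')
    (hend : ∀ m, I N m → m.Bdd X → ¬ e.eval m < f.eval m) (h0 : I 0 m) (hm : m.Bdd X) :
    ∃ m', Exec X (.loop e f P) m ((e.cost + f.cost + 1 + n) * (N + 1)) m' ∧ I N m' := by
  have key : ∀ j ≤ N, ∃ m', LoopTo X e f P m ((e.cost + f.cost + 1 + n) * j) m' ∧ I j m' ∧
      m'.Bdd X := by
    intro j hj
    induction j with
    | zero => exact ⟨m, LoopTo.refl, h0, hm⟩
    | succ j ih =>
      obtain ⟨a, ha, hI, hb⟩ := ih (by omega)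
      obtain ⟨hlt, b, hb', hI'⟩ := hstep j (by omega) a hI hb
      refine ⟨b, ?_, hI', hb'.1⟩
      exact (ha.trans (loopTo_step hX hb he hs hf hs' hlt hb')).mono (by rw [mul_add]; omega)
  obtain ⟨a, ha, hI, hb⟩ := key N le_rfl
  exact ⟨a, (ha _ _ (exec_loop_done hX hb he hs hf hs' (hend a hI hb))).mono (by
    rw [mul_add]; omega), hI⟩

lemma Run.mono {W W' : ℤ} (h : W ≤ W') {P : Prog} {m m' : Mem} {n : ℕ} (r : Run W P m n m') :
    Run W' P m n m' := by
  induction r with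
  | skip m => exact .skip m
  | const m x c hc => exact .const m x c (hc.trans h)
  | arith m o x y z hc => exact .arith m o x y z (hc.trans h)
  | load m x b i => exact .load m x b i
  | store m b i x => exact .store m b i x
  | emit m x => exact .emit m x
  | seq m₁ m₂ m₃ P Q n n' _ _ ih ih' => exact .seq m₁ m₂ m₃ P Q n n' ih ih'
  | ifTrue m m' x y P Q n hlt _ ih => exact .ifTrue m m' x y P Q n hlt ih
  | ifFalse m m' x y P Q n hge _ ih => exact .ifFalse m m' x y P Q n hge ih
  | whileDone m x y P hge => exact .whileDone m x y P hge
  | whileStep m₁ m₂ m₃ x y P n n' hlt _ _ ih ih' => exact .whileStep m₁ m₂ m₃ x y P n n' hlt ih ih'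

/-- Only the registers in `R` and the arrays in `A` may differ, and `o` has been written. -/
def Frame (R A : List ℕ) (o : List ℤ) (m m' : Mem) : Prop :=
  (∀ x, x ∉ R → m'.reg x = m.reg x) ∧ (∀ b, b ∉ A → m'.arr b = m.arr b) ∧ m'.out = m.out ++ o

lemma Frame.refl {R A : List ℕ} : Frame R A [] m m :=
  ⟨fun _ _ => rfl, fun _ _ => rfl, by simp⟩

lemma Frame.trans {R A : List ℕ} {o o' : List ℤ} (h : Frame R A o m m₁)
    (h' : Frame R A o' m₁ m₂) : Frame R A (o ++ o') m m₂ :=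
  ⟨fun x hx => (h'.1 x hx).trans (h.1 x hx), fun x hx => (h'.2.1 x hx).trans (h.2.1 x hx), by
    rw [h'.2.2, h.2.2, List.append_assoc]⟩

lemma Frame.mono {R A R' A' : List ℕ} {o : List ℤ} (h : Frame R A o m m₁) (hR : R ⊆ R')
    (hA : A ⊆ A') : Frame R' A' o m m₁ :=
  ⟨fun x hx => h.1 x fun h => hx (hR h), fun x hx => h.2.1 x fun h => hx (hA h), h.2.2⟩

lemma Frame.setReg {R A : List ℕ} {o : List ℤ} {x : ℕ} {v : ℤ} (h : Frame R A o m m₁)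
    (hx : x ∈ R) : Frame R A o m (m₁.setReg x v) :=
  ⟨fun y hy => by
    have : y ≠ x := fun h => hy (h ▸ hx)
    rw [Mem.setReg_reg, if_neg this, h.1 y hy], h.2⟩

lemma Frame.setArr {R A : List ℕ} {o : List ℤ} {b : ℕ} {j v : ℤ} (h : Frame R A o m m₁)
    (hb : b ∈ A) : Frame R A o m (m₁.setArr b j v) :=
  ⟨h.1, fun y hy => by
    have : y ≠ b := fun h => hy (h ▸ hb)
    rw [Mem.setArr_arr, if_neg this, h.2.1 y hy], h.2.2⟩

lemma Frame.write {R A : List ℕ} {o : List ℤ} {v : ℤ} (h : Frame R A o m m₁) :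
    Frame R A (o ++ [v]) m { m₁ with out := m₁.out ++ [v] } :=
  ⟨h.1, h.2.1, by simp [h.2.2]⟩

/-- `for x = 0, 1, … while x < f`. -/
def Prog.forLt (x : ℕ) (f : Ex) (P : Prog) : Prog :=
  .seq (.assign x (.lit 0)) (.loop (.var x) f (.seq P (.assign x (.var x + .lit 1))))

/-- Execution of a counting loop with an invariant `I`, which has to keep the value of the bound
`f`; the body has to restore the counter. -/
lemma exec_forLt (hX : 2 ≤ X) (hm : m.Bdd X) {x : ℕ} (hx : x < 40) (hf : f.Admissible X)
    (hs : f.size ≤ 200) {N : ℕ} (hN : (N : ℤ) ≤ X) (I : ℕ → Mem → Prop)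
    (hI : ∀ j ≤ N, ∀ m, I j m → f.eval m = N)
    (hstep : ∀ j < N, ∀ m, I j m → m.reg x = j → m.Bdd X →
      ∃ m', Exec X P m n m' ∧ m'.reg x = j ∧ I (j + 1) (m'.setReg x (j + 1)))
    (h0 : I 0 (m.setReg x 0)) :
    ∃ m', Exec X (.forLt x f P) m ((f.cost + n + 12) * (N + 1)) m' ∧ I N m' := by
  have hX1 : |(1 : ℤ)| ≤ X := by simp; omega
  have e0 : Exec X (.assign x (.lit 0)) m 3 (m.setReg x 0) :=
    exec_assign hX hm hx (by simp; omega) (by simp [Ex.size]) rfl (by simp; omega)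
  obtain ⟨m', h1, h2, h3⟩ := exec_loop (P := .seq P (.assign x (.var x + .lit 1)))
    (n := n + 6) hX (e := .var x) hx (by simp [Ex.size]) hf hs N
    (fun j m => I j m ∧ m.reg x = j) (fun j hj m hIm hm => by
      obtain ⟨m', r1, r2, r3⟩ := hstep j hj m hIm.1 hIm.2 hm
      refine ⟨?_, _, r1.seq (exec_assign hX r1.1 hx (by simp [hx]; omega) (by simp)
        (by simp [r2]) ?_), r3, by simp⟩
      · rw [hI j hj.le m hIm.1, Ex.eval_var, hIm.2]; exact_mod_cast hj
      · rw [abs_of_nonneg (by positivity)]; omega) (fun m hIm hm => by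
      rw [hI N le_rfl m hIm.1, Ex.eval_var, hIm.2]; omega) (m := m.setReg x 0)
    ⟨h0, by simp⟩ e0.1
  refine ⟨m', (e0.seq h1).mono ?_, h2⟩
  have : (Ex.var x).cost = 2 := rfl
  rw [this]
  nlinarith

/-- Fill the entries of arrays that are listed in `l` with the values of `F`. -/
def Prog.putAll (F : ℕ → ℤ → ℤ) : List (ℕ × ℤ) → Prog
  | [] => .skip
  | y :: l => .seq (.put y.1 (.lit y.2) (.lit (F y.1 y.2))) (putAll F l)

lemma exec_putAll (hX : 2 ≤ X) (F : ℕ → ℤ → ℤ) (l : List (ℕ × ℤ))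
    (hl : ∀ y ∈ l, |y.2| ≤ X ∧ |F y.1 y.2| ≤ X) (hm : m.Bdd X) :
    ∃ m', Exec X (.putAll F l) m (3 * l.length + 1) m' ∧ m'.reg = m.reg ∧ m'.out = m.out ∧
      ∀ b i, m'.arr b i = if (b, i) ∈ l then F b i else m.arr b i := by
  induction l generalizing m with
  | nil => exact ⟨m, exec_skip hm, rfl, rfl, by simp⟩
  | cons y l ih =>
    have hy := hl y List.mem_cons_self
    have e1 : Exec X (.put y.1 (.lit y.2) (.lit (F y.1 y.2))) m 3 (m.setArr y.1 y.2 (F y.1 y.2)) :=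
      exec_put hX hm hy.1 (by simp [Ex.size]) hy.2 (by simp [Ex.size]) rfl rfl hy.2
    obtain ⟨m', r1, r2, r3, r4⟩ := ih (fun z hz => hl z (List.mem_cons_of_mem _ hz)) e1.1
    refine ⟨m', (e1.seq r1).mono (by rw [List.length_cons]; omega), r2, r3, fun b i => ?_⟩
    rw [r4, Mem.setArr_arr]
    by_cases h : (b, i) ∈ l
    · simp [h]
    · rw [if_neg h]
      by_cases hb : b = y.1
      · subst hb
        rw [if_pos rfl, Function.update_apply]
        by_cases hi : i = y.2
        · subst hi; simp
        · rw [if_neg hi, if_neg]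
          rw [List.mem_cons, not_or]
          exact ⟨fun h => hi (congrArg Prod.snd h), h⟩
      · rw [if_neg hb, if_neg]
        rw [List.mem_cons, not_or]
        exact ⟨fun h => hb (congrArg Prod.fst h), h⟩

/-- Fill array `b` with the powers of `c` up to the exponent `f`. -/
def Prog.powers (b x : ℕ) (c : ℤ) (f : Ex) : Prog :=
  .seq (.put b (.lit 0) (.lit 1))
    (.forLt x f (.put b (.var x + .lit 1) (.get b (.var x) * .lit c)))

lemma exec_powers (hX : 2 ≤ X) (hm : m.Bdd X) {b x N : ℕ} (hx : x < 40) {c : ℤ} (hc : 2 ≤ c)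
    (hf : f.Admissible X) (hs : f.size ≤ 200)
    (hN : ∀ m', Frame [x] [b] [] m m' → f.eval m' = N) (hcN : c ^ N * c ≤ X) :
    ∃ m', Exec X (.powers b x c f) m ((f.cost + 30) * (N + 1)) m' ∧ Frame [x] [b] [] m m' ∧
      ∀ i ≤ N, m'.arr b i = c ^ i := by
  have h1 : ∀ i ≤ N, c ^ i ≤ c ^ N := fun i hi => pow_le_pow_right₀ (by omega) hi
  have hpos : ∀ i, 0 < c ^ i := fun i => by positivity
  have hcX : c ≤ X := le_trans (by nlinarith [hpos N]) hcN
  have hNX : (N : ℤ) ≤ X := by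
    have : N < 2 ^ N := Nat.lt_two_pow_self
    have h2 : (2 : ℤ) ^ N ≤ c ^ N := pow_le_pow_left₀ (by omega) hc N
    have h3 : (N : ℤ) < 2 ^ N := by exact_mod_cast this
    nlinarith [hpos N]
  have e1 : Exec X (.put b (.lit 0) (.lit 1)) m 3 (m.setArr b 0 1) :=
    exec_put hX hm (by simp; omega) (by simp) (by simp; omega) (by simp) rfl rfl (by simp; omega)
  obtain ⟨m', r1, r2, r3⟩ := exec_forLt
    (P := .put b (.var x + .lit 1) (.get b (.var x) * .lit c)) (n := 10) hX e1.1 hx hf hs hNX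
    (fun j m' => Frame [x] [b] [] m m' ∧ ∀ i ≤ j, m'.arr b i = c ^ i)
    (fun j _ m' h => hN m' h.1) (fun j hj m' h hj' hb => by
      refine ⟨m'.setArr b (j + 1) (c ^ (j + 1)), ?_, hj', ?_, fun i hi => ?_⟩
      · have := hpos (j + 1)
        have := h1 (j + 1) hj
        exact exec_put hX hb (by simp [hx]; omega) (by simp) (by simp [hx, abs_le]; omega) (by simp)
          (by simp [hj']) (by simp [hj', h.2 j le_rfl, pow_succ]) (by
            rw [abs_of_pos (hpos _)]; nlinarith)
      · exact (h.1.setArr (by simp)).setReg (by simp)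
      · rw [Mem.setReg_arr, Mem.setArr_arr, if_pos rfl, Function.update_apply]
        split_ifs with hij
        · have : i = j + 1 := by exact_mod_cast hij
          rw [this]
        · exact h.2 i (by
            rcases Nat.lt_or_eq_of_le hi with h | h
            · omega
            · exact absurd (by exact_mod_cast h) hij))
    ⟨(Frame.refl.setArr (by simp)).setReg (by simp), fun i hi => by
      have : i = 0 := by omega
      subst this
      simp [Mem.setArr_arr]⟩
  exact ⟨m', (e1.seq r1).mono (by nlinarith), r2, r3⟩

end Exec

/-! ### Positional numerals -/

/-- The number with the given digits in base `B`, most significant digit first. -/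
def numeral (B : ℤ) : List ℤ → ℤ
  | [] => 0
  | d :: l => d * B ^ l.length + numeral B l

lemma numeral_append (B : ℤ) (l l' : List ℤ) :
    numeral B (l ++ l') = numeral B l * B ^ l'.length + numeral B l' := by
  induction l with
  | nil => simp [numeral]
  | cons d l ih => simp [numeral, ih, pow_add]; ring

lemma numeral_bounds {B : ℤ} {l : List ℤ} (h : ∀ d ∈ l, 0 ≤ d ∧ d < B) :
    0 ≤ numeral B l ∧ numeral B l < B ^ l.length := by
  induction l with
  | nil => simp [numeral]
  | cons d l ih =>
    have h1 := ih fun y hy => h y (List.mem_cons_of_mem _ hy)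
    have h2 := h d List.mem_cons_self
    rw [numeral, List.length_cons, pow_succ]
    constructor <;> nlinarith

/-- A digit is found by division, also in the presence of higher digits `c`. -/
lemma numeral_digit {B : ℤ} {l : List ℤ} (h : ∀ d ∈ l, 0 ≤ d ∧ d < B) (c : ℤ) {j : ℕ}
    (hj : j < l.length) :
    (c * B ^ l.length + numeral B l) / B ^ (l.length - 1 - j) % B = l[j] := by
  induction l generalizing c j with
  | nil => simp at hj
  | cons d l ih =>
    have hd := h d List.mem_cons_self
    have hl : ∀ d ∈ l, 0 ≤ d ∧ d < B := fun y hy => h y (List.mem_cons_of_mem _ hy)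
    have hn := numeral_bounds hl
    have hB : 0 < B ^ l.length := by linarith
    have e1 : c * B ^ (d :: l).length + numeral B (d :: l) =
        (c * B + d) * B ^ l.length + numeral B l := by
      rw [numeral, List.length_cons, pow_succ]; ring
    rw [e1]
    cases j with
    | zero =>
      simp only [List.length_cons, Nat.add_sub_cancel, Nat.sub_zero, List.getElem_cons_zero]
      rw [add_comm, Int.add_mul_ediv_right _ _ hB.ne', Int.ediv_eq_zero_of_lt hn.1 hn.2, zero_add,
        add_comm, Int.add_mul_emod_self_right, Int.emod_eq_of_lt hd.1 hd.2]
    | succ j =>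
      have := ih hl (c * B + d) (j := j) (by simpa using hj)
      rw [List.getElem_cons_succ, ← this]
      congr 3
      simp only [List.length_cons]
      omega

section Words

variable {p q : ℕ}

/-- The number in base `4` with leading digit `1` followed by the letters of `v`. -/
def wordKey (v : List Letter) : ℤ := 4 ^ v.length + numeral 4 (v.map fun x => (x.rank : ℤ))

lemma rank_bounds (v : List Letter) : ∀ d ∈ v.map (fun x => (x.rank : ℤ)), 0 ≤ d ∧ d < 4 := by
  intro d hd
  obtain ⟨x, -, rfl⟩ := List.mem_map.1 hd
  cases x <;> simp [Letter.rank]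

lemma wordKey_bounds (v : List Letter) : 4 ^ v.length ≤ wordKey v ∧ wordKey v < 2 * 4 ^ v.length := by
  have := numeral_bounds (rank_bounds v)
  rw [List.length_map] at this
  unfold wordKey
  omega

lemma wordKey_digit (v : List Letter) {j : ℕ} (hj : j < v.length) :
    wordKey v / 4 ^ (v.length - 1 - j) % 4 = (v[j].rank : ℤ) := by
  have := numeral_digit (rank_bounds v) 1 (j := j) (by simpa using hj)
  simpa [wordKey] using this

/-- For words of equal length, the numerals are ordered like the words. -/
lemma numeral_le_of_not_lexLt {u v : List Letter} (hl : u.length = v.length) (h : ¬ LexLt u v) :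
    numeral 4 (v.map fun x => (x.rank : ℤ)) ≤ numeral 4 (u.map fun x => (x.rank : ℤ)) := by
  induction u generalizing v with
  | nil => cases v with
    | nil => rfl
    | cons => simp at hl
  | cons x u ih => cases v with
    | nil => simp at hl
    | cons y v =>
      have hl' : u.length = v.length := by simpa using hl
      have h1 : ¬ x.rank < y.rank := fun hc => h (.rel hc)
      simp only [List.map_cons, numeral, List.length_map, hl']
      by_cases hxy : x = y
      · subst hxy
        have := ih hl' fun hc => h (.cons hc)
        omega
      · have h2 : y.rank < x.rank := by
          revert h1 hxy
          cases x <;> cases y <;> simp [Letter.rank]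
        have h3 := numeral_bounds (rank_bounds v)
        have h4 := numeral_bounds (rank_bounds u)
        rw [List.length_map] at h3
        have h5 : (y.rank : ℤ) + 1 ≤ x.rank := by exact_mod_cast h2
        nlinarith

/-- The order of the keys is the length-lexicographical order, so that the normal form has the least
key. -/
lemma wordKey_aNf_le {v : List Letter} {n : ℤ} (h : wordVal p q v = bsA p q ^ n) :
    wordKey (aNf p q n) ≤ wordKey v := by
  have h1 : aLen p q n ≤ v.length := by rw [aLen, ← h]; exact geoLen_le rfl
  have hb := wordKey_bounds (aNf p q n)
  have hb' := wordKey_bounds v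
  rw [aNf_length] at hb
  rcases h1.eq_or_lt with h2 | h2
  · have := numeral_le_of_not_lexLt (v := aNf p q n) (by rw [aNf_length, h2]) (aNf_le h h2.symm)
    rw [wordKey, wordKey, aNf_length, h2]
    omega
  · have h3 : (4 : ℤ) ^ (aLen p q n + 1) ≤ 4 ^ v.length := pow_le_pow_right₀ (by norm_num) h2
    rw [pow_succ] at h3
    have : (0 : ℤ) < 4 ^ aLen p q n := by positivity
    linarith

lemma wordKey_hopWord (n m : ℤ) : wordKey (hopWord p q n m) =
    (wordKey (aNf p q (p * m)) + 3 * 4 ^ aLen p q (p * m)) * 4 * 4 ^ aLen p q (n - q * m) +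
      wordKey (aNf p q (n - q * m)) := by
  simp only [wordKey, hopWord, List.map_cons, List.map_append, numeral, numeral_append,
    List.length_cons, List.length_append, List.length_map, aNf_length, Letter.rank, pow_succ,
    pow_add]
  push_cast
  ring

lemma hopWord_length (n m : ℤ) : (hopWord p q n m).length =
    aLen p q (p * m) + aLen p q (n - q * m) + 2 := by
  simp only [hopWord, List.length_cons, List.length_append, aNf_length]
  omega

/-- The comparison of two keys decides which of the two candidates is the normal form. -/
lemma aNf_hop (hp : 1 ≤ p) (hpq : p < q) {n : ℤ} (hn : 3 * (q : ℤ) ≤ |n|) :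
    (wordKey (hopWord p q n (n / q + 1)) < wordKey (hopWord p q n (n / q)) →
      wordKey (aNf p q n) = wordKey (hopWord p q n (n / q + 1)) ∧
      aLen p q n = (hopWord p q n (n / q + 1)).length) ∧
    (¬ wordKey (hopWord p q n (n / q + 1)) < wordKey (hopWord p q n (n / q)) →
      wordKey (aNf p q n) = wordKey (hopWord p q n (n / q)) ∧
      aLen p q n = (hopWord p q n (n / q)).length) := by
  have h0 := wordKey_aNf_le (wordVal_hopWord (p := p) (q := q) n (n / q))
  have h1 := wordKey_aNf_le (wordVal_hopWord (p := p) (q := q) n (n / q + 1))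
  have key : ∀ u v : List Letter, wordKey u = wordKey v → u.length = v.length := by
    intro u v h
    have hu := wordKey_bounds u
    have hv := wordKey_bounds v
    by_contra hne
    rcases Nat.lt_or_gt_of_ne hne with h2 | h2
    · have h3 : (4 : ℤ) ^ (u.length + 1) ≤ 4 ^ v.length := pow_le_pow_right₀ (by norm_num) h2
      rw [pow_succ] at h3
      omega
    · have h3 : (4 : ℤ) ^ (v.length + 1) ≤ 4 ^ u.length := pow_le_pow_right₀ (by norm_num) h2
      rw [pow_succ] at h3
      omega
  have key' : ∀ v : List Letter, wordKey (aNf p q n) = wordKey v →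
      wordKey (aNf p q n) = wordKey v ∧ aLen p q n = v.length := fun v h =>
    ⟨h, by rw [← aNf_length]; exact key _ _ h⟩
  rcases aNf_eq_hopWord hp hpq hn with h | h
  · exact ⟨fun hc => by rw [h] at h1; omega, fun _ => key' _ (by rw [h])⟩
  · exact ⟨fun _ => key' _ (by rw [h]), fun hc => key' _ (by rw [h] at h0 ⊢; omega)⟩

end Words

/-! ### Tables of minimal keys -/

/-- The cell value `c` encodes the minimum of the set `S` of keys: it is the minimum shifted by
`-Z`, or `0` if there is no key; all keys are expected to be smaller than `Z`. -/
def MinCell (Z : ℤ) (S : ℤ → Prop) (c : ℤ) : Prop :=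
  c ≤ 0 ∧ (c = 0 ∨ ∃ κ, S κ ∧ c = κ - Z) ∧ ∀ κ, S κ → c ≤ κ - Z

lemma MinCell.congr {Z c : ℤ} {S S' : ℤ → Prop} (h : MinCell Z S c) (hS : ∀ κ, S κ ↔ S' κ) :
    MinCell Z S' c := by
  obtain rfl : S = S' := funext fun κ => propext (hS κ)
  exact h

lemma minCell_empty (Z : ℤ) {S : ℤ → Prop} (h : ∀ κ, ¬ S κ) : MinCell Z S 0 :=
  ⟨le_rfl, .inl rfl, fun κ hκ => (h κ hκ).elim⟩

lemma MinCell.insert_of_lt {Z c κ₀ : ℤ} {S : ℤ → Prop} (h : MinCell Z S c) (hc : κ₀ - Z < c) :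
    MinCell Z (fun κ => S κ ∨ κ = κ₀) (κ₀ - Z) := by
  refine ⟨by linarith [h.1], .inr ⟨κ₀, .inr rfl, rfl⟩, ?_⟩
  rintro κ (hκ | rfl)
  · exact hc.le.trans (h.2.2 κ hκ)
  · exact le_rfl

lemma MinCell.insert_of_le {Z c κ₀ : ℤ} {S : ℤ → Prop} (h : MinCell Z S c) (hc : c ≤ κ₀ - Z) :
    MinCell Z (fun κ => S κ ∨ κ = κ₀) c := by
  refine ⟨h.1, h.2.1.imp_right fun ⟨κ, hκ, e⟩ => ⟨κ, .inl hκ, e⟩, ?_⟩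
  rintro κ (hκ | rfl)
  · exact h.2.2 κ hκ
  · exact hc

lemma MinCell.neg_le {Z c : ℤ} {S : ℤ → Prop} (h : MinCell Z S c) (hZ : 0 ≤ Z)
    (hS : ∀ κ, S κ → 0 ≤ κ) : -Z ≤ c := by
  rcases h.2.1 with rfl | ⟨κ, hκ, rfl⟩
  · omega
  · linarith [hS κ hκ]

section Extension

variable {p q : ℕ}

/-- The key of a list of coefficients: the norm with weight `M`, and the code with weight `w`. -/
noncomputable def listKey (p q : ℕ) (M w : ℤ) (l : List (ℤ × Dir)) : ℤ :=
  M * pairsNorm p q l + w * digitCode (2 * q) l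

@[simp] lemma listKey_nil (M w : ℤ) : listKey p q M w [] = 0 := by
  simp [listKey, pairsNorm, digitCode]

lemma listKey_append (M w : ℤ) (l l' : List (ℤ × Dir)) :
    listKey p q M w (l ++ l') =
      listKey p q M (w * (2 * q) ^ l'.length) l + listKey p q M w l' := by
  simp only [listKey, pairsNorm, digitCode_append, List.map_append, List.sum_append]
  push_cast
  ring

lemma listKey_cons (M w : ℤ) (x : ℤ × Dir) (l : List (ℤ × Dir)) :
    listKey p q M w (x :: l) =
      (M * (aLen p q x.1 + 1) + w * (2 * q) ^ l.length * zrank x.1) + listKey p q M w l := by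
  simp only [listKey, pairsNorm, digitCode, List.map_cons, List.sum_cons]
  push_cast
  ring

/-- Pairs of an exponent and a key for a prefix, followed by a bounded representation of `V`. -/
def Extend (p q : ℕ) (M w : ℤ) (S : ℤ → ℤ → Prop) (V : Valley) (r κ : ℤ) : Prop :=
  ∃ r₁ κ₁ r₂ V', S r₁ κ₁ ∧ Valley.Rep p q V r₂ V' ∧ r = r₁ + r₂ ∧
    κ = κ₁ + listKey p q M w V'.pairs

/-- The case `α T U β t` of `Extend`, in terms of the pairs `S'` of exponents and keys for `U`. -/
def Nest (p q : ℕ) (M w w' α β : ℤ) (S S' : ℤ → ℤ → Prop) (r κ : ℤ) : Prop :=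
  ∃ r₁ κ₁ σ κ₂ ε α' μ β', S r₁ κ₁ ∧ S' σ κ₂ ∧ α = ε * p + α' ∧ |α'| < (p : ℤ) ∧
    p * σ + ε * q + β = μ * q + β' ∧ |β'| < (q : ℤ) ∧ r = r₁ + μ ∧
    κ = κ₁ + κ₂ + (M * (aLen p q α' + 1) + w * zrank α') + (M * (aLen p q β' + 1) + w' * zrank β')

lemma extend_nil (M w : ℤ) (S : ℤ → ℤ → Prop) (r κ : ℤ) : Extend p q M w S .nil r κ ↔ S r κ := by
  constructor
  · rintro ⟨r₁, κ₁, r₂, V', h, hr, rfl, rfl⟩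
    cases hr
    simpa [Valley.pairs] using h
  · exact fun h => ⟨r, κ, 0, .nil, h, .nil, by simp, by simp [Valley.pairs]⟩

/-- The recursion of the scan: nesting the inner valley changes the table, and the rest of the
valley extends the result. -/
lemma extend_node (M w : ℤ) (S : ℤ → ℤ → Prop) (α β : ℤ) (U W : Valley) (r κ : ℤ) :
    Extend p q M w S (.node α U β W) r κ ↔
      Extend p q M w (Nest p q M (w * (2 * q) ^ (U.pairs.length + W.pairs.length + 1))
        (w * (2 * q) ^ W.pairs.length) α β S
        (Extend p q M (w * (2 * q) ^ (W.pairs.length + 1)) (fun r κ => r = 0 ∧ κ = 0) U)) W r κ := by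
  constructor
  · rintro ⟨r₁, κ₁, r₂, V', h, hr, rfl, rfl⟩
    cases hr with
    | node ε α' μ β' hU hW hα hα' hβ hβ' =>
    refine ⟨r₁ + μ, _, _, _, ⟨r₁, κ₁, _, _, ε, α', μ, β', h, ⟨0, 0, _, _, ⟨rfl, rfl⟩, hU,
      (zero_add _).symm, rfl⟩, hα, hα', hβ, hβ', rfl, rfl⟩, hW, by ring, ?_⟩
    simp only [Valley.pairs, listKey_cons, listKey_append, List.length_append, List.length_cons,
      hU.pairs_length, hW.pairs_length]
    rw [← add_assoc U.pairs.length]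
    ring
  · rintro ⟨_, _, r₂, W', ⟨r₁, κ₁, σ, κ₂, ε, α', μ, β', h, ⟨_, _, σ', U', ⟨rfl, rfl⟩, hU, rfl, rfl⟩,
      hα, hα', hβ, hβ', rfl, rfl⟩, hW, rfl, rfl⟩
    rw [zero_add] at hβ
    refine ⟨r₁, κ₁, μ + r₂, _, h, .node ε α' μ β' hU hW hα hα' hβ hβ', by ring, ?_⟩
    simp only [Valley.pairs, listKey_cons, listKey_append, List.length_append, List.length_cons,
      hU.pairs_length, hW.pairs_length]
    rw [← add_assoc U.pairs.length]
    ring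

/-- The possible carries in a bounded representation. -/
lemma carry_cases {α ε α' : ℤ} (hα : |α| < (p : ℤ)) (h : α = ε * p + α')
    (hα' : |α'| < (p : ℤ)) : ε = -1 ∨ ε = 0 ∨ ε = 1 := by
  rw [abs_lt] at hα hα'
  have h1 : ε < 2 := by by_contra hc; nlinarith
  have h2 : -2 < ε := by by_contra hc; nlinarith
  omega

/-- A remainder of absolute value below `q` leaves two possibilities for the quotient. -/
lemma quotient_cases {q : ℕ} {x μ β' : ℤ} (h : x = μ * q + β') (hβ' : |β'| < (q : ℤ)) :
    μ = x / q ∨ μ = x / q + 1 := by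
  rw [abs_lt] at hβ'
  have hq : (0 : ℤ) < q := by omega
  have h1 := Int.mul_ediv_add_emod x q
  have h2 := Int.emod_nonneg x hq.ne'
  have h3 := Int.emod_lt_of_pos x hq
  have h4 : μ < x / q + 2 := by by_contra hc; nlinarith
  have h5 : x / q - 1 < μ := by by_contra hc; nlinarith
  omega

/-- What is known of the exponents and keys of a prefix with `i` letters: the exponents are at most
`6 n`. -/
def KeyBound (q : ℕ) (M : ℤ) (i n : ℕ) (S : ℤ → ℤ → Prop) : Prop :=
  ∀ r κ, S r κ → |r| ≤ 6 * n ∧ 0 ≤ κ ∧ κ ≤ (q + 1) * M * i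

/-- The carry of a nested valley is bounded by `(p / q) 6 n + 3 ≤ 3 n + 3`, which is at most
`6 max n 1`. -/
lemma nest_abs_le (hpq : p < q) (hdvd : p ∣ q) {α β σ ε α' μ β' : ℤ} {n : ℕ}
    (h3 : α = ε * p + α') (h4 : |α'| < (p : ℤ)) (h5 : p * σ + ε * q + β = μ * q + β')
    (h6 : |β'| < (q : ℤ)) (hα : |α| < (p : ℤ)) (hβ : |β| < (q : ℤ)) (hσ : |σ| ≤ 6 * n) :
    |μ| ≤ 6 * max (n : ℤ) 1 := by
  obtain ⟨e, he⟩ := hdvd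
  have he2 : 2 ≤ e := by
    by_contra hc
    have : e = 0 ∨ e = 1 := by omega
    rcases this with rfl | rfl <;> omega
  have he' : (q : ℤ) = p * e := by exact_mod_cast he
  have hpe : (p : ℤ) * 2 ≤ p * e := mul_le_mul_of_nonneg_left (by exact_mod_cast he2) (by omega)
  have hε : |ε| ≤ 1 := by
    rcases carry_cases hα h3 h4 with rfl | rfl | rfl <;> simp
  have e1 : |μ| * q ≤ p * (6 * n) + q + q + q := by
    have e2 : μ * q = p * σ + ε * q + β - β' := by linarith
    have f0 : |μ| * q = |p * σ + ε * q + β - β'| := by rw [← e2, abs_mul, Nat.abs_cast]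
    have f1 := abs_sub (p * σ + ε * q + β) β'
    have f2 := abs_add_le (p * σ + ε * q) β
    have f3 := abs_add_le (p * σ : ℤ) (ε * q)
    rw [abs_mul, abs_mul, Nat.abs_cast, Nat.abs_cast] at f3
    have f4 : (p : ℤ) * |σ| ≤ p * (6 * n) := mul_le_mul_of_nonneg_left hσ (by omega)
    have f5 : |ε| * q ≤ 1 * q := mul_le_mul_of_nonneg_right hε (by omega)
    linarith
  have hn : (0 : ℤ) ≤ n := by positivity
  have hq : (0 : ℤ) < q := by omega
  have g2 : (p : ℤ) * (6 * n) ≤ 3 * n * q := by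
    have := mul_le_mul_of_nonneg_right (by omega : (p : ℤ) * 2 ≤ q) (by omega : (0 : ℤ) ≤ 3 * n)
    linarith
  have g3 : |μ| * q ≤ (3 * n + 3) * q := by linarith
  have g4 := le_of_mul_le_mul_right g3 hq
  omega

/-- Nesting adds up the bounds for the exponents, where an empty inner valley counts as one sink. -/
lemma KeyBound.nest (hpq : p < q) (hdvd : p ∣ q) {M w w' α β : ℤ} {i j n n' : ℕ}
    {S S' : ℤ → ℤ → Prop} (h : KeyBound q M i n S) (h' : KeyBound q M j n' S') (hM : 0 ≤ M)
    (hw : 0 ≤ w) (hw' : 0 ≤ w') (hwM : w * (2 * q) ≤ M) (hwM' : w' * (2 * q) ≤ M)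
    (hα : |α| < (p : ℤ)) (hβ : |β| < (q : ℤ)) :
    KeyBound q M (i + j + 2) (n + max n' 1) (Nest p q M w w' α β S S') := by
  rintro r κ ⟨r₁, κ₁, σ, κ₂, ε, α', μ, β', h1, h2, h3, h4, h5, h6, rfl, rfl⟩
  obtain ⟨a1, a2, a3⟩ := h _ _ h1
  obtain ⟨b1, b2, b3⟩ := h' _ _ h2
  have hl : ∀ (x v : ℤ), |x| < (q : ℤ) → 0 ≤ v → v * (2 * q) ≤ M →
      0 ≤ M * (aLen p q x + 1) + v * zrank x ∧
      M * (aLen p q x + 1) + v * zrank x ≤ (q + 1) * M := by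
    intro x v hx hv hvM
    have c1 := aLen_le_natAbs (p := p) (q := q) x
    have c2 : (aLen p q x : ℤ) ≤ |x| := by rw [Int.abs_eq_natAbs]; exact_mod_cast c1
    have c3 := zrank_lt hx
    have c4 : M * (aLen p q x + 1) ≤ M * q := mul_le_mul_of_nonneg_left (by omega) hM
    have c5 : v * zrank x ≤ v * (2 * q) := mul_le_mul_of_nonneg_left (by omega) hv
    refine ⟨by positivity, by nlinarith⟩
  obtain ⟨c1, c2⟩ := hl α' w (by omega) hw hwM
  obtain ⟨d1, d2⟩ := hl β' w' h6 hw' hwM'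
  refine ⟨?_, by omega, ?_⟩
  · have hμ := nest_abs_le hpq hdvd h3 h4 h5 h6 hα hβ b1
    have := abs_add_le r₁ μ
    push_cast
    omega
  · push_cast
    nlinarith

/-- The candidates that the program compares, formed from the cell values for `S` and `S'`, have
the same minimum as `Nest`. -/
lemma MinCell.nest {M w w' α β Z c r : ℤ} {S S' : ℤ → ℤ → Prop} {f f' : ℤ → ℤ}
    (hM : 0 ≤ M) (hw : 0 ≤ w) (hw' : 0 ≤ w') (hZ : 0 ≤ Z) {i j n n' : ℕ}
    (hα : |α| < (p : ℤ))
    (hS : KeyBound q M i n S) (hS' : KeyBound q M j n' S')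
    (hf : ∀ r, MinCell Z (S r) (f r)) (hf' : ∀ r, MinCell Z (S' r) (f' r))
    (h : MinCell Z (fun κ => ∃ r₁ σ ε δ : ℤ, |r₁| ≤ 6 * n ∧ |σ| ≤ 6 * n' ∧
      (ε = -1 ∨ ε = 0 ∨ ε = 1) ∧ (δ = 0 ∨ δ = 1) ∧ |α - ε * p| < (p : ℤ) ∧
      |p * σ + ε * q + β - ((p * σ + ε * q + β) / q + δ) * q| < (q : ℤ) ∧
      r = r₁ + ((p * σ + ε * q + β) / q + δ) ∧
      κ - Z = f r₁ + f' σ + Z + (M * (aLen p q (α - ε * p) + 1) + w * zrank (α - ε * p)) +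
        (M * (aLen p q (p * σ + ε * q + β - ((p * σ + ε * q + β) / q + δ) * q) + 1) +
          w' * zrank (p * σ + ε * q + β - ((p * σ + ε * q + β) / q + δ) * q))) c) :
    MinCell Z (Nest p q M w w' α β S S' r) c := by
  refine ⟨h.1, ?_, ?_⟩
  · rcases h.2.1 with h0 | ⟨κ, ⟨r₁, σ, ε, δ, h1, h2, h3, h4, h5, h6, h7, h8⟩, h9⟩
    · exact .inl h0
    rcases h.1.eq_or_lt with h0 | h0
    · exact .inl h0
    right
    refine ⟨κ, ?_, h9⟩
    have g1 := (hf r₁).neg_le hZ fun κ hκ => (hS _ κ hκ).2.1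
    have g2 := (hf' σ).neg_le hZ fun κ hκ => (hS' _ κ hκ).2.1
    set x := (p * σ + ε * q + β - ((p * σ + ε * q + β) / q + δ) * q) with hx
    have g3 : 0 ≤ M * (aLen p q (α - ε * p) + 1) + w * zrank (α - ε * p) := by positivity
    have g4 : 0 ≤ M * (aLen p q x + 1) + w' * zrank x := by positivity
    have g5 := (hf r₁).1
    have g6 := (hf' σ).1
    rcases (hf r₁).2.1 with h10 | ⟨κ₁, k1, h10⟩
    · omega
    rcases (hf' σ).2.1 with h11 | ⟨κ₂, k2, h11⟩
    · omega
    exact ⟨r₁, κ₁, σ, κ₂, ε, α - ε * p, (p * σ + ε * q + β) / q + δ, x, k1, k2, by ring, h5,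
      by rw [hx]; ring, h6, h7, by linarith⟩
  · rintro κ ⟨r₁, κ₁, σ, κ₂, ε, α', μ, β', k1, k2, k3, k4, k5, k6, k7, rfl⟩
    obtain rfl : α' = α - ε * p := by linarith
    obtain ⟨δ, hδ, rfl⟩ : ∃ δ, (δ = 0 ∨ δ = 1) ∧ μ = (p * σ + ε * q + β) / q + δ := by
      rcases quotient_cases k5 k6 with h | h
      · exact ⟨0, .inl rfl, by rw [h]; ring⟩
      · exact ⟨1, .inr rfl, h⟩
    obtain rfl : β' = p * σ + ε * q + β - ((p * σ + ε * q + β) / q + δ) * q := by linarith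
    have g1 := (hf r₁).2.2 κ₁ k1
    have g2 := (hf' σ).2.2 κ₂ k2
    have h1 := h.2.2 (_ + Z) ⟨r₁, σ, ε, δ, (hS _ _ k1).1, (hS' _ _ k2).1, carry_cases hα k3 k4,
      hδ, k4, k6, k7, add_sub_cancel_right _ Z⟩
    rw [add_sub_cancel_right] at h1
    linarith

end Extension

/-! ### The scan of the valley

The program uses the following registers and arrays. Register `0` holds the number `k` of letters,
`1` the position, `2` the depth of the stack, and `3` the number of a combination. The arrays `0`
and `1` hold the integers and the letters of the input, and the arrays `6`, `7`, `8` form the stack: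
at each depth, they hold the number of a table, a bound `n` on the sinks it covers, and the position
of the letter `T` that started it. Array `5` holds the cells of all tables, and array `12` the powers
of `2 q`. For the powers `a ^ x`, the arrays `2` and `4` hold the lengths and the keys of their
normal forms. Array `3` holds the powers of `4`, array `10` the position of an integer in the order
`0, 1, -1, 2, -2, …`, and array `11` its inverse.
-/

section Scan

open Ex

/-- The weight `M` of the norm in keys. -/
def exM : Ex := get 12 (var 0)

/-- The shift `Z` of keys in cells. -/
def exZ (q : ℕ) : Ex := lit (14 * q) * exM * (var 0 + lit 1)

/-- The address in array `5` of the cell for the exponent `r` in the table number `e`. -/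
def exAddr (r e : Ex) : Ex := r * (var 0 + lit 1) + e

/-- The exponent for the prefix. -/
def exR : Ex :=
  var 3 / (lit 6 * (lit 12 * get 7 (var 2) + lit 1)) - lit 6 * get 7 (var 2 - lit 1)

/-- The exponent for the inner valley. -/
def exS : Ex := var 3 / lit 6 % (lit 12 * get 7 (var 2) + lit 1) - lit 6 * get 7 (var 2)

/-- The carry `ε` from `α`. -/
def exE : Ex := var 3 / lit 2 % lit 3 - lit 1

/-- The remaining coefficient `α'`. -/
def exAlpha (p : ℕ) : Ex := get 0 (get 8 (var 2)) - exE * lit p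

/-- The integer before the letter `t`, after the exponent of the inner valley and the carry from `α`
have been added to it. -/
def exSum (p q : ℕ) : Ex := lit p * exS + exE * lit q + get 0 (var 1)

/-- The carry `μ` from `β`. -/
def exMu (p q : ℕ) : Ex := exSum p q / lit q + var 3 % lit 2

/-- The remaining coefficient `β'`. -/
def exBeta (p q : ℕ) : Ex := exSum p q - exMu p q * lit q

/-- The shifted key of the combination. Cells hold keys minus `Z`, so that one `Z` has to be
restored when two cells are added up. -/
def exKey (p q : ℕ) : Ex :=
  get 5 (exAddr exR (get 6 (var 2 - lit 1))) + get 5 (exAddr exS (get 6 (var 2))) + exZ q +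
    (exM * (get 2 (exAlpha p) + lit 1) +
      get 12 (var 0 - lit 1 - get 8 (var 2)) * get 10 (exAlpha p)) +
    (exM * (get 2 (exBeta p q) + lit 1) + get 12 (var 0 - lit 1 - var 1) * get 10 (exBeta p q))

/-- The address of the cell for the resulting exponent, in the table for the next position. -/
def exTarget (p q : ℕ) : Ex := exAddr (exR + exMu p q) (var 1 + lit 1)

/-- Consider the combination number `var 3` of table entries and carries. -/
def popBody (p q : ℕ) : Prog :=
  .ite (exAlpha p * exAlpha p) (lit (p * p))
    (.ite (exBeta p q * exBeta p q) (lit (q * q))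
      (.ite (exKey p q) (get 5 (exTarget p q)) (.put 5 (exTarget p q) (exKey p q)) .skip) .skip)
    .skip

/-- The step for a letter `t`: combine the two topmost tables. -/
def pop (p q : ℕ) : Prog :=
  .seq (.forLt 3 (lit 6 * (lit 12 * get 7 (var 2) + lit 1) *
      (lit 12 * get 7 (var 2 - lit 1) + lit 1)) (popBody p q))
    (.seq (.put 7 (var 2 - lit 1) (get 7 (var 2 - lit 1) + get 7 (var 2) +
        lit 1 / (get 7 (var 2) + lit 1)))
      (.seq (.put 6 (var 2 - lit 1) (var 1 + lit 1)) (.assign 2 (var 2 - lit 1))))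

/-- The step for a letter `T`: start a new table. -/
def push (q : ℕ) : Prog :=
  .seq (.put 8 (var 2 + lit 1) (var 1))
    (.seq (.put 6 (var 2 + lit 1) (var 1 + lit 1))
      (.seq (.put 7 (var 2 + lit 1) (lit 0))
        (.seq (.put 5 (var 1 + lit 1) (lit 0 - exZ q)) (.assign 2 (var 2 + lit 1)))))

/-- Process one letter of the valley. -/
def scanStep (p q : ℕ) : Prog :=
  .seq (.ite (get 1 (var 1)) (lit 0) (push q) (pop p q)) (.assign 1 (var 1 + lit 1))

variable {p q : ℕ}

/-- The shifted key of a combination of table entries `c`, `c'` and coefficients `α'`, `β'`. -/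
noncomputable def candKey (p q : ℕ) (Z M w w' c c' α' β' : ℤ) : ℤ :=
  c + c' + Z + (M * (aLen p q α' + 1) + w * zrank α') + (M * (aLen p q β' + 1) + w' * zrank β')

/-- The values that `popBody` computes for the combination number `j`. -/
structure Comb (p q : ℕ) (n n' α β j r s ε μ α' β' : ℤ) : Prop where
  r_eq : r = j / (6 * (12 * n' + 1)) - 6 * n
  s_eq : s = j / 6 % (12 * n' + 1) - 6 * n'
  ε_eq : ε = j / 2 % 3 - 1
  α_eq : α' = α - ε * p
  μ_eq : μ = (p * s + ε * q + β) / q + j % 2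
  β_eq : β' = p * s + ε * q + β - μ * q

lemma lit_bounds {X : ℤ} (hq : 1 ≤ q) (hpq : p < q) (hlit : 14 * (q : ℤ) * q ≤ X) :
    12 ≤ X ∧ 6 ≤ X ∧ 1 ≤ X ∧ 3 ≤ X ∧ 2 ≤ X ∧ (p : ℤ) ≤ X ∧ (q : ℤ) ≤ X ∧ |(p * p : ℤ)| ≤ X ∧
    |(q * q : ℤ)| ≤ X ∧ 14 * (q : ℤ) ≤ X := by
  have hp' : (p : ℤ) < q := by exact_mod_cast hpq
  have hq' : (1 : ℤ) ≤ q := by exact_mod_cast hq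
  have hqq : (q : ℤ) ≤ q * q := by nlinarith
  have hpp : (p : ℤ) * p ≤ q * q := by nlinarith
  have h14 : 14 * (q : ℤ) ≤ 14 * q * q := by nlinarith
  rw [abs_of_nonneg (by positivity : (0 : ℤ) ≤ p * p),
    abs_of_nonneg (by positivity : (0 : ℤ) ≤ q * q)]
  refine ⟨?_, ?_, ?_, ?_, ?_, ?_, ?_, ?_, ?_, ?_⟩ <;> linarith

lemma mul_self_lt_iff {x y : ℤ} (hy : 0 ≤ y) : x * x < y * y ↔ |x| < y := by
  rw [← abs_mul_abs_self x]
  exact (mul_self_lt_mul_self_iff (abs_nonneg x) hy).symm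

/-- `popBody` lowers the target cell to the key of combination `j`, if the remaining coefficients
are in bounds and the key is smaller than the entry of the cell. -/
lemma exec_popBody {X Z M w w' α β : ℤ} {m : Mem} (hX : 2 ≤ X) (hm : m.Bdd X)
    (hq : 1 ≤ q) (hpq : p < q) (hlit : 14 * (q : ℤ) * q ≤ X) {k n n' e e' i d j₀ : ℕ} {j : ℤ}
    (h0 : m.reg 0 = k) (h1 : m.reg 1 = i) (h2 : m.reg 2 = d + 1) (h3 : m.reg 3 = j)
    (a0 : m.arr 0 j₀ = α) (a0' : m.arr 0 i = β)
    (a2 : ∀ x : ℤ, |x| < (q : ℤ) → m.arr 2 x = aLen p q x)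
    (a10 : ∀ x : ℤ, |x| < (q : ℤ) → m.arr 10 x = zrank x)
    (a6 : m.arr 6 d = e) (a6' : m.arr 6 (d + 1) = e') (a7 : m.arr 7 d = n)
    (a7' : m.arr 7 (d + 1) = n') (a8 : m.arr 8 (d + 1) = j₀)
    (aM : m.arr 12 k = M) (aw : m.arr 12 (k - 1 - j₀) = w) (aw' : m.arr 12 (k - 1 - i) = w')
    (hZ : Z = 14 * q * M * (k + 1)) (hZX : Z ≤ X) (hM : 0 ≤ M) (hw : 0 ≤ w) (hw' : 0 ≤ w')
    (hc : ∀ z, -Z ≤ m.arr 5 z ∧ m.arr 5 z ≤ 0) :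
    ∃ r s ε μ α' β', Comb p q n n' α β j r s ε μ α' β' ∧ ∃ m', Exec X (popBody p q) m 1600 m' ∧
      ((|α'| < (p : ℤ) ∧ |β'| < (q : ℤ) ∧
          candKey p q Z M w w' (m.arr 5 (r * (k + 1) + e)) (m.arr 5 (s * (k + 1) + e')) α' β' <
            m.arr 5 ((r + μ) * (k + 1) + (i + 1)) ∧
          m' = m.setArr 5 ((r + μ) * (k + 1) + (i + 1))
            (candKey p q Z M w w' (m.arr 5 (r * (k + 1) + e)) (m.arr 5 (s * (k + 1) + e')) α' β')) ∨
        ((|α'| < (p : ℤ) → |β'| < (q : ℤ) →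
          m.arr 5 ((r + μ) * (k + 1) + (i + 1)) ≤
            candKey p q Z M w w' (m.arr 5 (r * (k + 1) + e)) (m.arr 5 (s * (k + 1) + e')) α' β') ∧
          m' = m)) := by
  obtain ⟨r, hr⟩ : ∃ r : ℤ, r = j / (6 * (12 * n' + 1)) - 6 * n := ⟨_, rfl⟩
  obtain ⟨s, hs⟩ : ∃ s : ℤ, s = j / 6 % (12 * n' + 1) - 6 * n' := ⟨_, rfl⟩
  obtain ⟨ε, hε⟩ : ∃ ε : ℤ, ε = j / 2 % 3 - 1 := ⟨_, rfl⟩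
  obtain ⟨μ, hμ⟩ : ∃ μ : ℤ, μ = (p * s + ε * q + β) / q + j % 2 := ⟨_, rfl⟩
  obtain ⟨α', hα'⟩ : ∃ α' : ℤ, α' = α - ε * p := ⟨_, rfl⟩
  obtain ⟨β', hβ'⟩ : ∃ β' : ℤ, β' = p * s + ε * q + β - μ * q := ⟨_, rfl⟩
  have er : exR.eval m = r := by simp [exR, h3, h2, a7, a7', hr]
  have es : exS.eval m = s := by simp [exS, h3, h2, a7', hs]
  have eε : exE.eval m = ε := by simp [exE, h3, hε]
  have eα : (exAlpha p).eval m = α' := by simp [exAlpha, h2, a8, a0, eε, hα']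
  have esum : (exSum p q).eval m = p * s + ε * q + β := by simp [exSum, h1, a0', eε, es]
  have eμ : (exMu p q).eval m = μ := by simp [exMu, esum, h3, hμ]
  have eβ : (exBeta p q).eval m = β' := by simp [exBeta, esum, eμ, hβ']
  have et : (exTarget p q).eval m = (r + μ) * (k + 1) + (i + 1) := by
    simp [exTarget, exAddr, er, eμ, h0, h1]
  have ek : |α'| < (p : ℤ) → |β'| < (q : ℤ) → (exKey p q).eval m =
      candKey p q Z M w w' (m.arr 5 (r * (k + 1) + e)) (m.arr 5 (s * (k + 1) + e')) α' β' := by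
    intro hα hβ
    simp [exKey, exAddr, exZ, exM, candKey, er, es, eα, eβ, h0, h1, h2, a6, a6', a8, aM, aw, aw',
      a2 _ hβ, a10 _ hβ, a2 α' (by omega), a10 α' (by omega), hZ]
  refine ⟨r, s, ε, μ, α', β', ⟨hr, hs, hε, hα', hμ, hβ'⟩, ?_⟩
  obtain ⟨l1, l2, l3, l4, l5, l6, l7, l8, l9, l10⟩ := lit_bounds hq hpq hlit
  have adR : exR.Admissible X := by simp [exR, l1, l2, l3]
  have adS : exS.Admissible X := by simp [exS, l1, l2, l3]
  have adE : exE.Admissible X := by simp [exE, l3, l4, l5]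
  have adα : (exAlpha p).Admissible X := by simp [exAlpha, adE, l6]
  have adsum : (exSum p q).Admissible X := by simp [exSum, adE, adS, l6, l7]
  have adμ : (exMu p q).Admissible X := by simp [exMu, adsum, l7, l5]
  have adβ : (exBeta p q).Admissible X := by simp [exBeta, adsum, adμ, l7]
  have adt : (exTarget p q).Admissible X := by simp [exTarget, exAddr, adR, adμ, l3]
  have adk : (exKey p q).Admissible X := by
    simp [exKey, exAddr, exZ, exM, adR, adS, adα, adβ, l3, l10, abs_of_nonneg]
  have sq : ∀ (x y : ℤ), 0 ≤ y → (x * x < y * y ↔ |x| < y) := fun x y => mul_self_lt_iff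
  have z1 : (exAlpha p * exAlpha p).size ≤ 200 := Nat.le_of_ble_eq_true rfl
  have z2 : (exBeta p q * exBeta p q).size ≤ 200 := Nat.le_of_ble_eq_true rfl
  have z3 : (exKey p q).size ≤ 200 := Nat.le_of_ble_eq_true rfl
  have z4 : (exTarget p q).size ≤ 200 := Nat.le_of_ble_eq_true rfl
  have z5 : (get 5 (exTarget p q)).size ≤ 200 := Nat.le_of_ble_eq_true rfl
  have y1 : (exAlpha p * exAlpha p).cost ≤ 50 := Nat.le_of_ble_eq_true rfl
  have y2 : (exBeta p q * exBeta p q).cost ≤ 250 := Nat.le_of_ble_eq_true rfl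
  have y3 : (exKey p q).cost ≤ 450 := Nat.le_of_ble_eq_true rfl
  have y4 : (exTarget p q).cost ≤ 150 := Nat.le_of_ble_eq_true rfl
  have cα : ((exAlpha p * exAlpha p).eval m < (lit (p * p)).eval m) = (|α'| < (p : ℤ)) := by
    simp [eα, sq _ (p : ℤ) (by omega)]
  have cβ : ((exBeta p q * exBeta p q).eval m < (lit (q * q)).eval m) = (|β'| < (q : ℤ)) := by
    simp [eβ, sq _ (q : ℤ) (by omega)]
  have key : ∀ m', (|α'| < (p : ℤ) → |β'| < (q : ℤ) →
      (exKey p q).eval m < (get 5 (exTarget p q)).eval m →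
      Exec X (.put 5 (exTarget p q) (exKey p q)) m 601 m') →
      ((|α'| < (p : ℤ) → |β'| < (q : ℤ) →
        ¬ (exKey p q).eval m < (get 5 (exTarget p q)).eval m) → m' = m) →
      Exec X (popBody p q) m 1600 m' := by
    intro m' g1 g2
    refine Exec.mono (exec_ite (n := 1500) hX hm ⟨adα, adα⟩ z1 (by simpa using l8)
      (Nat.le_of_ble_eq_true rfl) (fun h1 => Exec.mono (exec_ite (n := 1205) hX hm ⟨adβ, adβ⟩ z2
      (by simpa using l9) (Nat.le_of_ble_eq_true rfl) (fun h2 => Exec.mono (exec_ite (n := 601) hX hm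
      adk z3 (f := get 5 (exTarget p q)) adt z5 (fun h3 => ?_) (fun h3 => ?_)) ?_) (fun h2 => ?_)) ?_)
      (fun h1 => ?_)) ?_
    · rw [cα] at h1; rw [cβ] at h2; exact g1 h1 h2 h3
    · rw [g2 fun _ _ => h3]; exact (exec_skip hm).mono (by omega)
    · simp only [cost_get]; omega
    · rw [cβ] at h2; rw [g2 fun _ h => absurd h h2]; exact (exec_skip hm).mono (by omega)
    · simp only [cost_lit]; omega
    · rw [cα] at h1; rw [g2 fun h => absurd h h1]; exact (exec_skip hm).mono (by omega)
    · simp only [cost_lit]; omega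
  have eg : (get 5 (exTarget p q)).eval m = m.arr 5 ((r + μ) * (k + 1) + (i + 1)) := by
    rw [eval_get, et]
  by_cases hv : |α'| < (p : ℤ) ∧ |β'| < (q : ℤ) ∧
    candKey p q Z M w w' (m.arr 5 (r * (k + 1) + e)) (m.arr 5 (s * (k + 1) + e')) α' β' <
      m.arr 5 ((r + μ) * (k + 1) + (i + 1))
  · obtain ⟨hα, hβ, h⟩ := hv
    have ek' := ek hα hβ
    refine ⟨_, key _ (fun _ _ _ => ?_) (fun hc => absurd ?_ (hc hα hβ)), .inl ⟨hα, hβ, h, rfl⟩⟩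
    · refine (exec_put hX hm adt z4 adk z3 et ek' ?_).mono (by omega)
      rw [abs_le]
      have g1 := (hc (r * (k + 1) + e)).1
      have g2 := (hc (s * (k + 1) + e')).1
      have g3 := (hc ((r + μ) * (k + 1) + (i + 1))).2
      have g4 : 0 ≤ M * (aLen p q α' + 1) + w * zrank α' := by positivity
      have g5 : 0 ≤ M * (aLen p q β' + 1) + w' * zrank β' := by positivity
      constructor
      · unfold candKey; linarith
      · have := (hc 0).1
        have := (hc 0).2
        linarith
    · rw [ek', eg]; exact h
  · refine ⟨m, key _ (fun hα hβ hk => absurd ⟨hα, hβ, by rwa [ek hα hβ, eg] at hk⟩ hv)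
      (fun _ => rfl), .inr ⟨fun hα hβ => not_lt.1 fun h => hv ⟨hα, hβ, h⟩, rfl⟩⟩

end Scan

section ScanLoop

open Ex

variable {p q : ℕ}

/-! ### Combining two tables -/

/-- The numbers below the loop bound address only entries inside the windows of the tables. -/
lemma comb_window {n n' α β j r s ε μ α' β' : ℤ} (hn' : 0 ≤ n')
    (h : Comb p q n n' α β j r s ε μ α' β') (hj : 0 ≤ j)
    (hj' : j < 6 * (12 * n' + 1) * (12 * n + 1)) :
    |r| ≤ 6 * n ∧ |s| ≤ 6 * n' ∧ (ε = -1 ∨ ε = 0 ∨ ε = 1) ∧ (j % 2 = 0 ∨ j % 2 = 1) := by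
  refine ⟨?_, ?_, ?_, by omega⟩
  · have h1 : 0 ≤ j / (6 * (12 * n' + 1)) := Int.ediv_nonneg hj (by positivity)
    have h2 : j / (6 * (12 * n' + 1)) < 12 * n + 1 := Int.ediv_lt_of_lt_mul (by positivity)
      (by linarith)
    rw [h.r_eq, abs_le]
    omega
  · have h1 := Int.emod_nonneg (j / 6) (by positivity : 12 * n' + 1 ≠ 0)
    have h2 := Int.emod_lt_of_pos (j / 6) (by positivity : 0 < 12 * n' + 1)
    rw [h.s_eq, abs_le]
    omega
  · have := h.ε_eq
    omega

/-- Every combination has a number, namely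
`((r + 6 n) (12 n' + 1) + (s + 6 n')) 6 + 2 (ε + 1) + δ`, where `δ` selects one of the two possible
quotients `μ`. -/
lemma comb_exists {n n' α β r s ε δ : ℤ} (hr : |r| ≤ 6 * n) (hs : |s| ≤ 6 * n')
    (hε : ε = -1 ∨ ε = 0 ∨ ε = 1) (hδ : δ = 0 ∨ δ = 1) :
    ∃ j : ℕ, (j : ℤ) < 6 * (12 * n' + 1) * (12 * n + 1) ∧
      Comb p q n n' α β j r s ε ((p * s + ε * q + β) / q + δ) (α - ε * p)
        (p * s + ε * q + β - ((p * s + ε * q + β) / q + δ) * q) := by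
  rw [abs_le] at hr hs
  set y : ℤ := (s + 6 * n') * 6 + (ε + 1) * 2 + δ with hy
  have hy0 : 0 ≤ y := by omega
  have hy1 : y < 6 * (12 * n' + 1) := by omega
  have hj0 : 0 ≤ (r + 6 * n) * (6 * (12 * n' + 1)) + y := by
    have : 0 ≤ (r + 6 * n) * (6 * (12 * n' + 1)) := mul_nonneg (by omega) (by omega)
    omega
  refine ⟨((r + 6 * n) * (6 * (12 * n' + 1)) + y).toNat, ?_, ?_⟩
  · rw [Int.toNat_of_nonneg hj0]
    have : (r + 6 * n) * (6 * (12 * n' + 1)) ≤ (12 * n) * (6 * (12 * n' + 1)) :=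
      mul_le_mul_of_nonneg_right (by omega) (by omega)
    linarith
  · rw [Int.toNat_of_nonneg hj0]
    have h2 : ((r + 6 * n) * (6 * (12 * n' + 1)) + y) / 2 % 3 = ε + 1 := by
      have : ((r + 6 * n) * (6 * (12 * n' + 1)) + y) =
        6 * ((r + 6 * n) * (12 * n' + 1) + (s + 6 * n')) + ((ε + 1) * 2 + δ) := by
        rw [hy]; ring
      rw [this]
      omega
    have h3 : ((r + 6 * n) * (6 * (12 * n' + 1)) + y) % 2 = δ := by
      have : ((r + 6 * n) * (6 * (12 * n' + 1)) + y) =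
        6 * ((r + 6 * n) * (12 * n' + 1) + (s + 6 * n')) + ((ε + 1) * 2 + δ) := by
        rw [hy]; ring
      rw [this]
      omega
    have h4 : ((r + 6 * n) * (6 * (12 * n' + 1)) + y) / 6 =
        (s + 6 * n') + (12 * n' + 1) * (r + 6 * n) := by
      have : ((r + 6 * n) * (6 * (12 * n' + 1)) + y) =
        6 * ((s + 6 * n') + (12 * n' + 1) * (r + 6 * n)) + ((ε + 1) * 2 + δ) := by
        rw [hy]; ring
      rw [this]
      omega
    refine ⟨?_, ?_, by rw [h2]; ring, rfl, by rw [h3], rfl⟩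
    · rw [add_comm, Int.add_mul_ediv_right _ _ (by omega), Int.ediv_eq_zero_of_lt hy0 hy1]
      ring
    · rw [h4, Int.add_mul_emod_self_left, Int.emod_eq_of_lt (by omega) (by omega)]
      ring

lemma Comb.unique {n n' α β j r s ε μ α' β' r₂ s₂ ε₂ μ₂ α₂ β₂ : ℤ}
    (h : Comb p q n n' α β j r s ε μ α' β') (h' : Comb p q n n' α β j r₂ s₂ ε₂ μ₂ α₂ β₂) :
    r₂ = r ∧ s₂ = s ∧ ε₂ = ε ∧ μ₂ = μ ∧ α₂ = α' ∧ β₂ = β' := by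
  obtain ⟨rfl, rfl, rfl, rfl, rfl, rfl⟩ := h
  obtain ⟨rfl, rfl, rfl, rfl, rfl, rfl⟩ := h'
  exact ⟨rfl, rfl, rfl, rfl, rfl, rfl⟩

/-- `κ` is the key for the exponent `r` of one of the first `J` combinations. -/
def Cand (p q : ℕ) (Z M w w' n n' α β : ℤ) (f f' : ℤ → ℤ) (J : ℕ) (r κ : ℤ) : Prop :=
  ∃ j < J, ∃ r₁ s ε μ α' β', Comb p q n n' α β (j : ℕ) r₁ s ε μ α' β' ∧ |α'| < (p : ℤ) ∧
    |β'| < (q : ℤ) ∧ r = r₁ + μ ∧ κ - Z = candKey p q Z M w w' (f r₁) (f' s) α' β'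

lemma cand_succ {Z M w w' n n' α β : ℤ} {f f' : ℤ → ℤ} {J : ℕ} {r₁ s ε μ α' β' : ℤ}
    (h : Comb p q n n' α β J r₁ s ε μ α' β') (r κ : ℤ) :
    Cand p q Z M w w' n n' α β f f' (J + 1) r κ ↔ Cand p q Z M w w' n n' α β f f' J r κ ∨
      (|α'| < (p : ℤ) ∧ |β'| < (q : ℤ) ∧ r = r₁ + μ ∧
        κ - Z = candKey p q Z M w w' (f r₁) (f' s) α' β') := by
  constructor
  · rintro ⟨j, hj, r₂, s₂, ε₂, μ₂, α₂, β₂, hc, h1, h2, h3, h4⟩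
    rcases Nat.lt_succ_iff_lt_or_eq.1 hj with hj | rfl
    · exact .inl ⟨j, hj, r₂, s₂, ε₂, μ₂, α₂, β₂, hc, h1, h2, h3, h4⟩
    · obtain ⟨rfl, rfl, rfl, rfl, rfl, rfl⟩ := h.unique hc
      exact .inr ⟨h1, h2, h3, h4⟩
  · rintro (⟨j, hj, hc⟩ | ⟨h1, h2, h3, h4⟩)
    · exact ⟨j, by omega, hc⟩
    · exact ⟨J, by omega, r₁, s, ε, μ, α', β', h, h1, h2, h3, h4⟩

/-- Different cells of different tables have different addresses. -/
lemma addr_injective {k t t' : ℕ} {r r' : ℤ} (ht : t ≤ k) (ht' : t' ≤ k)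
    (h : r * (k + 1) + t = r' * (k + 1) + t') : r = r' ∧ t = t' := by
  have h1 : (r * (k + 1) + t) % (k + 1) = t := by
    rw [add_comm, Int.add_mul_emod_self_right, Int.emod_eq_of_lt (by omega) (by omega)]
  have h2 : (r' * (k + 1) + t') % (k + 1) = t' := by
    rw [add_comm, Int.add_mul_emod_self_right, Int.emod_eq_of_lt (by omega) (by omega)]
  have h3 : (t : ℤ) = t' := by rw [← h1, h, h2]
  refine ⟨?_, by exact_mod_cast h3⟩
  rw [h3] at h
  exact mul_right_cancel₀ (by omega : (k + 1 : ℤ) ≠ 0) (add_right_cancel h)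

/-! ### The states of the scan -/

/-- The shift of the keys for an input of length `k`. -/
def keyShift (q k : ℕ) : ℤ := 14 * q * (2 * q) ^ k * (k + 1)

/-- The input of length `k` with the constant tables, and the lower bounds on the word size. -/
structure Env (p q k : ℕ) (X : ℤ) (l : List (ℤ × Dir)) (m : Mem) : Prop where
  two_le : 2 ≤ X
  pos : 1 ≤ p
  lt : p < q
  lit_le : 14 * (q : ℤ) * q ≤ X
  count_le : 1100 * ((k : ℤ) + 1) ^ 2 ≤ X
  shift_le : keyShift q k ≤ X
  length_eq : l.length = k
  reg0 : m.reg 0 = k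
  coeff : ∀ i : ℕ, ∀ x, l[i]? = some x → m.arr 0 i = x.1 ∧ m.arr 1 i = x.2.sign
  len : ∀ x : ℤ, |x| < (q : ℤ) → m.arr 2 x = aLen p q x
  rank : ∀ x : ℤ, |x| < (q : ℤ) → m.arr 10 x = zrank x
  pow : ∀ i ≤ k, m.arr 12 i = (2 * q) ^ i

lemma Env.frame {k : ℕ} {X : ℤ} {l : List (ℤ × Dir)} {m m' : Mem} (h : Env p q k X l m)
    {R A : List ℕ} {o : List ℤ} (hf : Frame R A o m m') (hR : 0 ∉ R)
    (hA : 0 ∉ A ∧ 1 ∉ A ∧ 2 ∉ A ∧ 10 ∉ A ∧ 12 ∉ A) : Env p q k X l m' where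
  two_le := h.two_le
  pos := h.pos
  lt := h.lt
  lit_le := h.lit_le
  count_le := h.count_le
  shift_le := h.shift_le
  length_eq := h.length_eq
  reg0 := by rw [hf.1 0 hR, h.reg0]
  coeff := by rw [hf.2.1 0 hA.1, hf.2.1 1 hA.2.1]; exact h.coeff
  len := by rw [hf.2.1 2 hA.2.2.1]; exact h.len
  rank := by rw [hf.2.1 10 hA.2.2.2.1]; exact h.rank
  pow := by rw [hf.2.1 12 hA.2.2.2.2]; exact h.pow

/-- The state before letter `i`, at depth `d`. -/
structure ScanState (p q k : ℕ) (X : ℤ) (l : List (ℤ × Dir)) (i d : ℕ) (m : Mem) : Prop where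
  env : Env p q k X l m
  bdd : m.Bdd X
  reg1 : m.reg 1 = i
  reg2 : m.reg 2 = d
  depth_le : d ≤ i
  cells : ∀ z, -keyShift q k ≤ m.arr 5 z ∧ m.arr 5 z ≤ 0
  fresh : ∀ (r : ℤ) (t : ℕ), i < t → t ≤ k → m.arr 5 (r * (k + 1) + t) = 0

/-- At depth `d`, table number `e` holds the minimal keys for `S`; the exponents are at most `6 n`,
and at most `b` letters have contributed. -/
structure Level (q k : ℕ) (m : Mem) (d e n b : ℕ) (S : ℤ → ℤ → Prop) : Prop where
  id : m.arr 6 d = e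
  num : m.arr 7 d = n
  num_le : n ≤ b
  tab : ∀ r, MinCell (keyShift q k) (S r) (m.arr 5 (r * (k + 1) + e))
  bound : KeyBound q ((2 * q) ^ k) b n S

/-- Below depth `d` the stack is unchanged, and so are the tables with numbers up to `i`. -/
structure Keep (k i d c : ℕ) (m m' : Mem) : Prop where
  frame : Frame [1, 2, 3] [5, 6, 7, 8] [] m m'
  stack : ∀ x < d, m'.arr 6 x = m.arr 6 x ∧ m'.arr 7 x = m.arr 7 x
  pos : ∀ x < c, m'.arr 8 x = m.arr 8 x
  tab : ∀ (r : ℤ) (t : ℕ), t ≤ i → m'.arr 5 (r * (k + 1) + t) = m.arr 5 (r * (k + 1) + t)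

lemma Keep.refl {k i d c : ℕ} {m : Mem} : Keep k i d c m m :=
  ⟨Frame.refl, fun _ _ => ⟨rfl, rfl⟩, fun _ _ => rfl, fun _ _ _ => rfl⟩

lemma Keep.trans {k i i' d d' c c' : ℕ} {m m' m'' : Mem} (h : Keep k i d c m m')
    (h' : Keep k i' d' c' m' m'') (hi : i ≤ i') {d₀ c₀ : ℕ} (hd : d₀ ≤ d) (hd' : d₀ ≤ d')
    (hc : c₀ ≤ c) (hc' : c₀ ≤ c') : Keep k i d₀ c₀ m m'' where
  frame := h.frame.trans h'.frame
  stack x hx := ⟨((h'.stack x (by omega)).1).trans (h.stack x (by omega)).1,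
    ((h'.stack x (by omega)).2).trans (h.stack x (by omega)).2⟩
  pos x hx := (h'.pos x (by omega)).trans (h.pos x (by omega))
  tab r t ht := (h'.tab r t (by omega)).trans (h.tab r t ht)

lemma Level.keep {k i d c d' e n b : ℕ} {m m' : Mem} {S : ℤ → ℤ → Prop}
    (h : Level q k m d' e n b S) (h' : Keep k i d c m m') (hd : d' < d) (he : e ≤ i) :
    Level q k m' d' e n b S where
  id := by rw [(h'.stack d' hd).1, h.id]
  num := by rw [(h'.stack d' hd).2, h.num]
  num_le := h.num_le
  tab r := by rw [h'.tab r e he]; exact h.tab r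
  bound := h.bound

variable {k : ℕ} {X : ℤ} {l : List (ℤ × Dir)} {i d : ℕ} {m : Mem}

lemma keyShift_nonneg (q k : ℕ) : 0 ≤ keyShift q k := by unfold keyShift; positivity

/-- After all combinations have been considered, the new table holds the minimal keys for the nested
valley. -/
lemma exec_popLoop {e e' n n' b b' j₀ : ℕ} {S S' : ℤ → ℤ → Prop} {α β : ℤ}
    (hs : ScanState p q k X l i (d + 1) m) (hL : Level q k m d e n b S)
    (hL' : Level q k m (d + 1) e' n' b' S') (he : e ≤ i) (he' : e' ≤ i) (hb : b + b' ≤ i)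
    (hi : l[i]? = some (β, Dir.t)) (hj₀ : j₀ < i) (hα : l[j₀]? = some (α, Dir.T))
    (hpos : m.arr 8 ((d + 1 : ℕ) : ℤ) = j₀) (hαp : |α| < (p : ℤ)) :
    ∃ m', Exec X (.forLt 3 (lit 6 * (lit 12 * get 7 (var 2) + lit 1) *
      (lit 12 * get 7 (var 2 - lit 1) + lit 1)) (popBody p q)) m
        (12000 * ((12 * n + 1) * (12 * n' + 1))) m' ∧
      Frame [3] [5] [] m m' ∧
      (∀ z, -keyShift q k ≤ m'.arr 5 z ∧ m'.arr 5 z ≤ 0) ∧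
      (∀ (r : ℤ) (t : ℕ), t ≤ k → t ≠ i + 1 →
        m'.arr 5 (r * (k + 1) + t) = m.arr 5 (r * (k + 1) + t)) ∧
      ∀ r, MinCell (keyShift q k) (Nest p q ((2 * q) ^ k) ((2 * q) ^ (k - 1 - j₀))
        ((2 * q) ^ (k - 1 - i)) α β S S' r) (m'.arr 5 (r * (k + 1) + (i + 1 : ℕ))) := by
  have hE := hs.env
  have hik : i < k := by
    rw [← hE.length_eq]
    by_contra hc
    rw [List.getElem?_eq_none (by omega)] at hi
    cases hi
  have hX := hE.two_le
  have hq : 1 ≤ q := by have := hE.lt; omega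
  set Z := keyShift q k with hZ
  set M : ℤ := (2 * q) ^ k with hM
  set w : ℤ := (2 * q) ^ (k - 1 - j₀) with hw
  set w' : ℤ := (2 * q) ^ (k - 1 - i) with hw'
  set f : ℤ → ℤ := fun r => m.arr 5 (r * (k + 1) + e) with hf
  set f' : ℤ → ℤ := fun r => m.arr 5 (r * (k + 1) + e') with hf'
  have hreg2 : m.reg 2 = (d : ℤ) + 1 := by rw [hs.reg2]; push_cast; ring
  have hnk : (12 * n' + 1) * (12 * n + 1) ≤ 169 * (k + 1) ^ 2 := by
    have h1 := hL.num_le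
    have h2 := hL'.num_le
    calc _ ≤ (13 * (k + 1)) * (13 * (k + 1)) := Nat.mul_le_mul (by omega) (by omega)
      _ = _ := by ring
  have hN : ((6 * (12 * n' + 1) * (12 * n + 1) : ℕ) : ℤ) ≤ X := by
    have h1 := hE.count_le
    have h2 : (((12 * n' + 1) * (12 * n + 1) : ℕ) : ℤ) ≤ ((169 * (k + 1) ^ 2 : ℕ) : ℤ) := by
      exact_mod_cast hnk
    push_cast at h2 ⊢
    nlinarith
  have e7 : m.arr 7 ((d : ℤ) + 1) = n' := by have := hL'.num; push_cast at this; exact this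
  have e6 : m.arr 6 ((d : ℤ) + 1) = e' := by have := hL'.id; push_cast at this; exact this
  have e8 : m.arr 8 ((d : ℤ) + 1) = j₀ := by push_cast at hpos; exact hpos
  obtain ⟨l1, l2, l3, -⟩ := lit_bounds hq hE.lt hE.lit_le
  have hwX : ∀ j : ℕ, j < k → m.arr 12 ((k : ℤ) - 1 - j) = (2 * q) ^ (k - 1 - j) := by
    intro j hj
    have := hE.pow (k - 1 - j) (by omega)
    rw [← this]
    congr 1
    omega
  obtain ⟨m', r1, r2, r3, r4, r5⟩ := exec_forLt (P := popBody p q) (n := 1600)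
    (f := lit 6 * (lit 12 * get 7 (var 2) + lit 1) * (lit 12 * get 7 (var 2 - lit 1) + lit 1))
    hX hs.bdd (x := 3) (by omega) (by simp [l1, l2, l3]) (Nat.le_of_ble_eq_true rfl) hN
    (fun J m' => Frame [3] [5] [] m m' ∧ (∀ z, -Z ≤ m'.arr 5 z ∧ m'.arr 5 z ≤ 0) ∧
      (∀ (r : ℤ) (t : ℕ), t ≤ k → t ≠ i + 1 →
        m'.arr 5 (r * (k + 1) + t) = m.arr 5 (r * (k + 1) + t)) ∧
      ∀ r, MinCell Z (Cand p q Z M w w' n n' α β f f' J r) (m'.arr 5 (r * (k + 1) + (i + 1 : ℕ))))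
    (fun j _ m' h => by
      have h7 := h.1.2.1 7 (by simp)
      have h2 := h.1.1 2 (by simp)
      simp [h7, h2, hreg2, e7, hL.num])
    (fun J hJ m₁ h h3 hb₁ => by
      obtain ⟨hF, hc, hold, hmin⟩ := h
      have a12 := hF.2.1 12 (by simp)
      have a0 := hF.2.1 0 (by simp)
      have a6 := hF.2.1 6 (by simp)
      have a7 := hF.2.1 7 (by simp)
      have a8 := hF.2.1 8 (by simp)
      obtain ⟨r, s, ε, μ, α', β', hcomb, m', hex, hm'⟩ := exec_popBody (Z := Z) (M := M) (w := w)
        (w' := w') (α := α) (β := β) (n := n) (n' := n') (e := e) (e' := e') (d := d) (j₀ := j₀)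
        (i := i) (k := k) hX hb₁ hq
        hE.lt hE.lit_le ((hF.1 0 (by simp)).trans hE.reg0) ((hF.1 1 (by simp)).trans hs.reg1)
        ((hF.1 2 (by simp)).trans hreg2) h3 (by rw [a0, (hE.coeff _ _ hα).1])
        (by rw [a0, (hE.coeff _ _ hi).1]) (by rw [hF.2.1 2 (by simp)]; exact hE.len)
        (by rw [hF.2.1 10 (by simp)]; exact hE.rank) (by rw [a6, hL.id]) (by rw [a6, e6])
        (by rw [a7, hL.num]) (by rw [a7, e7]) (by rw [a8, e8]) (by rw [a12, hE.pow k le_rfl])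
        (by rw [a12, hwX j₀ (by omega)]) (by rw [a12, hwX i hik]) (by rw [hZ, keyShift, hM])
        hE.shift_le (by positivity) (by positivity) (by positivity) hc
      have g1 : m₁.arr 5 (r * (k + 1) + e) = f r := hold r e (by omega) (by omega)
      have g2 : m₁.arr 5 (s * (k + 1) + e') = f' s := hold s e' (by omega) (by omega)
      rw [g1, g2] at hm'
      have hcast : ((i : ℤ) + 1) = ((i + 1 : ℕ) : ℤ) := by push_cast; ring
      rw [hcast] at hm'
      rcases hm' with ⟨h4, h5, h6, rfl⟩ | ⟨h4, rfl⟩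
      · have hget : ∀ (r' : ℤ) (t : ℕ), t ≤ k → ¬ (r' = r + μ ∧ t = i + 1) →
            (m₁.setArr 5 ((r + μ) * (k + 1) + (i + 1 : ℕ))
              (candKey p q Z M w w' (f r) (f' s) α' β')).arr 5 (r' * (k + 1) + t) =
            m₁.arr 5 (r' * (k + 1) + t) := by
          intro r' t ht hne
          rw [Mem.setArr_arr, if_pos rfl, Function.update_of_ne]
          exact fun h => hne (addr_injective ht (by omega) h)
        refine ⟨_, hex, h3, (hF.setArr (by simp)).setReg (by simp), fun z => ?_,
          fun r' t ht hne => ?_, fun r' => ?_⟩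
        · rw [Mem.setReg_arr, Mem.setArr_arr, if_pos rfl, Function.update_apply]
          split_ifs with hz
          · refine ⟨?_, by linarith [(hc ((r + μ) * (k + 1) + (i + 1 : ℕ))).2]⟩
            have k1 := (hs.cells (r * (k + 1) + e)).1
            have k2 := (hs.cells (s * (k + 1) + e')).1
            have k3 : 0 ≤ M * (aLen p q α' + 1) + w * zrank α' := by positivity
            have k4 : 0 ≤ M * (aLen p q β' + 1) + w' * zrank β' := by positivity
            simp only [candKey, hf, hf']
            linarith
          · exact hc z
        · rw [Mem.setReg_arr, hget r' t ht (fun h => hne h.2)]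
          exact hold r' t ht hne
        · rw [Mem.setReg_arr]
          by_cases hr' : r' = r + μ
          · subst hr'
            rw [Mem.setArr_arr, if_pos rfl, Function.update_self]
            have := (hmin (r + μ)).insert_of_lt
              (κ₀ := candKey p q Z M w w' (f r) (f' s) α' β' + Z) (by simpa using h6)
            rw [add_sub_cancel_right] at this
            refine this.congr fun κ => ?_
            rw [cand_succ hcomb, ← sub_eq_iff_eq_add]
            simp [h4, h5]
          · rw [hget r' _ (by omega) (fun h => hr' h.1)]
            refine (hmin r').congr fun κ => ?_
            rw [cand_succ hcomb]
            simp [hr']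
      · refine ⟨_, hex, h3, hF.setReg (by simp), hc, hold, fun r' => ?_⟩
        rw [Mem.setReg_arr]
        by_cases hv : |α'| < (p : ℤ) ∧ |β'| < (q : ℤ) ∧ r' = r + μ
        · obtain ⟨v1, v2, rfl⟩ := hv
          have := (hmin (r + μ)).insert_of_le
            (κ₀ := candKey p q Z M w w' (f r) (f' s) α' β' + Z) (by simpa using h4 v1 v2)
          refine this.congr fun κ => ?_
          rw [cand_succ hcomb, ← sub_eq_iff_eq_add]
          simp [v1, v2]
        · refine (hmin r').congr fun κ => ?_
          rw [cand_succ hcomb]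
          tauto)
    ⟨Frame.refl.setReg (by simp), hs.cells, fun _ _ _ _ => rfl, fun r => by
      rw [Mem.setReg_arr, hs.fresh r (i + 1) (by omega) (by omega)]
      exact minCell_empty _ fun κ ⟨j, hj, _⟩ => by omega⟩
  refine ⟨m', r1.mono ?_, r2, r3, r4, fun r => ?_⟩
  · simp only [cost_mul, cost_add, cost_sub, cost_get, cost_var, cost_lit]
    have h1 : 1 ≤ (12 * n + 1) * (12 * n' + 1) := Nat.one_le_iff_ne_zero.2 (by positivity)
    have h2 : 6 * (12 * n' + 1) * (12 * n + 1) = 6 * ((12 * n + 1) * (12 * n' + 1)) := by ring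
    rw [h2]
    omega
  · refine MinCell.nest (f := f) (f' := f') (by positivity) (by positivity) (by positivity)
      (keyShift_nonneg q k) hαp hL.bound hL'.bound hL.tab hL'.tab ((r5 r).congr fun κ => ?_)
    constructor
    · rintro ⟨j, hj, r₁, s, ε, μ, α', β', hc, h1, h2, h3, h4⟩
      obtain ⟨g1, g2, g3, g4⟩ := comb_window (by positivity) hc (by positivity)
        (by exact_mod_cast hj)
      obtain rfl := hc.β_eq
      obtain rfl := hc.α_eq
      obtain rfl := hc.μ_eq
      exact ⟨r₁, s, ε, j % 2, g1, g2, g3, g4, h1, h2, h3, h4⟩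
    · rintro ⟨r₁, s, ε, δ, g1, g2, g3, g4, h1, h2, h3, h4⟩
      obtain ⟨j, hj, hc⟩ := comb_exists (p := p) (q := q) (α := α) (β := β) g1 g2 g3 g4
      exact ⟨j, by exact_mod_cast hj, r₁, s, ε, _, _, _, hc, h1, h2, h3, h4⟩

end ScanLoop

section Visit

open Ex

variable {p q k : ℕ} {X : ℤ} {l : List (ℤ × Dir)} {i d : ℕ} {m : Mem}

lemma Env.lits (h : Env p q k X l m) :
    12 ≤ X ∧ 1 ≤ X ∧ (k : ℤ) + 1 ≤ X ∧ 14 * (q : ℤ) ≤ X := by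
  have hq : 1 ≤ q := by have := h.lt; omega
  obtain ⟨l1, l2, l3, l4, l5, l6, l7, l8, l9, l10⟩ := lit_bounds hq h.lt h.lit_le
  refine ⟨l1, l3, ?_, l10⟩
  have := h.count_le
  nlinarith

lemma Env.lt_of_getElem? (h : Env p q k X l m) {x : ℤ × Dir} (hi : l[i]? = some x) : i < k := by
  rw [← h.length_eq]
  exact (List.getElem?_eq_some_iff.1 hi).1

lemma exZ_eval (h : Env p q k X l m) : (exZ q).eval m = keyShift q k := by
  simp [exZ, exM, h.reg0, h.pow k le_rfl, keyShift]

/-- At a letter `T`, a table for the empty valley is put on the stack: its only exponent is `0`,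
with key `0`. -/
lemma exec_push {α : ℤ} (hs : ScanState p q k X l i d m) (hi : l[i]? = some (α, Dir.T)) :
    ∃ m', Exec X (scanStep p q) m 200 m' ∧ ScanState p q k X l (i + 1) (d + 1) m' ∧
      Level q k m' (d + 1) (i + 1) 0 0 (fun r κ => r = 0 ∧ κ = 0) ∧
      m'.arr 8 ((d + 1 : ℕ) : ℤ) = i ∧ Keep k i (d + 1) (d + 1) m m' := by
  have hE := hs.env
  have hX := hE.two_le
  have hik := hE.lt_of_getElem? hi
  obtain ⟨l12, l1, lk, l14⟩ := hE.lits
  have hd := hs.depth_le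
  have hZ0 := keyShift_nonneg q k
  have hZ := hE.shift_le
  have hθ : m.arr 1 i = -1 := (hE.coeff _ _ hi).2
  have e1 := exec_put (b := 8) (e := var 2 + lit 1) (f := var 1) (j := (d : ℤ) + 1) (v := i) hX
    hs.bdd (by simp [l1]) (by simp) (by simp) (by simp) (by simp [hs.reg2]) (by simp [hs.reg1])
    (by rw [Nat.abs_cast]; omega)
  have e2 := exec_put (b := 6) (e := var 2 + lit 1) (f := var 1 + lit 1) (j := (d : ℤ) + 1)
    (v := (i : ℤ) + 1) hX e1.bdd (by simp [l1]) (by simp) (by simp [l1]) (by simp)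
    (by simp [hs.reg2]) (by simp [hs.reg1]) (by rw [abs_of_nonneg (by positivity)]; omega)
  have e3 := exec_put (b := 7) (e := var 2 + lit 1) (f := lit 0) (j := (d : ℤ) + 1)
    (v := 0) hX e2.bdd (by simp [l1]) (by simp) (by simp; omega) (by simp)
    (by simp [hs.reg2]) (by simp) (by simp; omega)
  have e4 := exec_put (b := 5) (e := var 1 + lit 1) (f := lit 0 - exZ q) (j := (i : ℤ) + 1)
    (v := -keyShift q k) hX e3.bdd (by simp [l1]) (by simp)
    (by simp [exZ, exM, l1, l14, abs_of_nonneg]; omega) (Nat.le_of_ble_eq_true rfl)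
    (by simp [hs.reg1]) (by
      simp [exZ, exM, Mem.setArr_arr, hE.reg0, hE.pow k le_rfl, keyShift])
    (by rw [abs_neg, abs_of_nonneg hZ0]; exact hZ)
  have e5 := exec_assign (x := 2) (e := var 2 + lit 1) (v := (d : ℤ) + 1) hX e4.bdd (by omega)
    (by simp [l1]) (by simp) (by simp [hs.reg2]) (by rw [abs_of_nonneg (by positivity)]; omega)
  have e6 := exec_ite (e := get 1 (var 1)) (f := lit 0) (Q := pop p q) hX hs.bdd (by simp)
    (by simp) (by simp; omega) (by simp) (fun _ => e1.seq (e2.seq (e3.seq (e4.seq e5))))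
    (fun hc => absurd (by simp [hs.reg1, hθ]) hc)
  have e7 := e6.seq (exec_assign (x := 1) (e := var 1 + lit 1) (v := (i : ℤ) + 1) hX e6.bdd
    (by omega) (by simp [l1]) (by simp) (by simp [hs.reg1])
    (by rw [abs_of_nonneg (by positivity)]; omega))
  refine ⟨_, e7.mono (Nat.le_of_ble_eq_true rfl), ?_, ?_, ?_, ?_⟩
  rotate_left 3
  · have hF : Frame [1, 2, 3] [5, 6, 7, 8] [] m _ :=
      ((((((Frame.refl (R := [1, 2, 3]) (A := [5, 6, 7, 8]) (m := m)).setArr (b := 8)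
        (j := (d : ℤ) + 1) (v := i) (by simp)).setArr (b := 6) (j := (d : ℤ) + 1)
        (v := (i : ℤ) + 1) (by simp)).setArr (b := 7) (j := (d : ℤ) + 1) (v := 0)
        (by simp)).setArr (b := 5) (j := (i : ℤ) + 1) (v := -keyShift q k) (by simp)).setReg (x := 2)
        (v := (d : ℤ) + 1) (by simp)).setReg (x := 1) (v := (i : ℤ) + 1) (by simp)
    refine ⟨hF, fun x hx => ?_, fun x hx => ?_, fun r t ht => ?_⟩
    · have : ¬ (x : ℤ) = d + 1 := by omega
      simp [Mem.setArr_arr, this]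
    · have : ¬ (x : ℤ) = d + 1 := by omega
      simp [Mem.setArr_arr, this]
    · have : ¬ r * (k + 1) + t = (i : ℤ) + 1 := fun h => by
        have := addr_injective (k := k) (r := r) (r' := 0) (t := t) (t' := i + 1) (by omega)
          (by omega) (by push_cast; rw [h]; ring)
        omega
      simp [Mem.setArr_arr, this]
  · refine ⟨hE.frame (R := [1, 2, 3]) (A := [5, 6, 7, 8]) (o := []) ?_ (by simp) (by simp), e7.bdd,
      by simp, by simp, by omega, fun z => ?_, fun r t h1 h2 => ?_⟩
    · exact ((((((Frame.refl).setArr (by simp)).setArr (by simp)).setArr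
        (by simp)).setArr (by simp)).setReg (by simp)).setReg (by simp)
    · have := hs.cells z
      simp [Mem.setArr_arr, Function.update_apply]
      split_ifs <;> omega
    · have : ¬ r * (k + 1) + t = (i : ℤ) + 1 := fun h => by
        have := addr_injective (k := k) (r := r) (r' := 0) (t := t) (t' := i + 1) (by omega)
          (by omega) (by push_cast; rw [h]; ring)
        omega
      simp [Mem.setArr_arr, this, hs.fresh r t (by omega) h2]
  · refine ⟨by simp [Mem.setArr_arr],
      by simp [Mem.setArr_arr], le_rfl, fun r => ?_, ?_⟩
    · by_cases hr : r = 0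
      · subst hr
        refine ⟨?_, .inr ⟨0, ⟨rfl, rfl⟩, ?_⟩, fun κ hκ => ?_⟩
        · simp [Mem.setArr_arr]; omega
        · simp [Mem.setArr_arr]
        · simp [Mem.setArr_arr, hκ.2]
      · have : ¬ r * (k + 1) + (i + 1 : ℕ) = (i : ℤ) + 1 := fun h => by
          have := addr_injective (k := k) (r := r) (r' := 0) (t := i + 1) (t' := i + 1) (by omega)
            (by omega) (by rw [h]; push_cast; ring)
          exact hr this.1
        have h0 := hs.fresh r (i + 1) (by omega) (by omega)
        have h1 : MinCell (keyShift q k) (fun κ => r = 0 ∧ κ = 0)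
            (m.arr 5 (r * (k + 1) + (i + 1 : ℕ))) := by
          rw [h0]
          exact minCell_empty _ fun κ h => hr h.1
        convert h1 using 1
        simp only [Mem.setReg_arr, Mem.setArr_arr, Function.update_apply, if_true]
        rw [if_neg this]
        simp
    · rintro r κ ⟨rfl, rfl⟩
      simp
  · simp [Mem.setArr_arr]

/-- At a letter `t`, the table for the inner valley is removed from the stack, and the table below
it is replaced by the combined one. -/
lemma exec_pop {e e' n n' b b' j₀ : ℕ} {S S' : ℤ → ℤ → Prop} {α β : ℤ} (hdvd : p ∣ q)
    (hs : ScanState p q k X l i (d + 1) m) (hL : Level q k m d e n b S)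
    (hL' : Level q k m (d + 1) e' n' b' S') (he : e ≤ i) (he' : e' ≤ i) (hb : b + b' + 1 ≤ i)
    (hi : l[i]? = some (β, Dir.t)) (hj₀ : j₀ < i) (hα : l[j₀]? = some (α, Dir.T))
    (hpos : m.arr 8 ((d + 1 : ℕ) : ℤ) = j₀) (hαp : |α| < (p : ℤ)) (hβq : |β| < (q : ℤ)) :
    ∃ m', Exec X (scanStep p q) m (13000 * ((12 * n + 1) * (12 * n' + 1))) m' ∧
      ScanState p q k X l (i + 1) d m' ∧
      Level q k m' d (i + 1) (n + max n' 1) (b + b' + 2) (Nest p q ((2 * q) ^ k)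
        ((2 * q) ^ (k - 1 - j₀)) ((2 * q) ^ (k - 1 - i)) α β S S') ∧
      Keep k i d (d + 2) m m' := by
  have hE := hs.env
  have hX := hE.two_le
  have hik := hE.lt_of_getElem? hi
  obtain ⟨l12, l1, lk, l14⟩ := hE.lits
  have hd := hs.depth_le
  have hn := hL.num_le
  have hn' := hL'.num_le
  have hθ : m.arr 1 i = 1 := (hE.coeff _ _ hi).2
  obtain ⟨m₁, e1, hF, hc, hold, hmin⟩ := exec_popLoop hs hL hL' he he' (by omega) hi hj₀ hα hpos hαp
  have h2 : m₁.reg 2 = (d : ℤ) + 1 := by rw [hF.1 2 (by simp), hs.reg2]; push_cast; ring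
  have h1 : m₁.reg 1 = i := by rw [hF.1 1 (by simp), hs.reg1]
  have a7 : m₁.arr 7 d = n := by rw [hF.2.1 7 (by simp), hL.num]
  have a7' : m₁.arr 7 ((d : ℤ) + 1) = n' := by
    have := hL'.num
    push_cast at this
    rw [hF.2.1 7 (by simp), this]
  -- the integer quotient `1 / (n' + 1)` is `1` for `n' = 0` and `0` otherwise
  have hmax : (n : ℤ) + n' + 1 / (n' + 1) = (n + max n' 1 : ℕ) := by
    rcases Nat.eq_zero_or_pos n' with rfl | h
    · simp
    · rw [Int.ediv_eq_zero_of_lt (by omega) (by omega), max_eq_left h]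
      push_cast; ring
  have e2 := exec_put (b := 7) (e := var 2 - lit 1) (f := get 7 (var 2 - lit 1) + get 7 (var 2) +
    lit 1 / (get 7 (var 2) + lit 1)) (j := d) (v := (n + max n' 1 : ℕ)) hX e1.bdd
    (by simp [l1]) (by simp) (by simp [l1]) (by simp) (by simp [h2])
    (by simp only [eval_add, eval_get, eval_sub, eval_var, eval_lit, eval_div, h2,
      add_sub_cancel_right, a7, a7']; exact hmax) (by rw [Nat.abs_cast]; omega)
  have e3 := exec_put (b := 6) (e := var 2 - lit 1) (f := var 1 + lit 1) (j := (d : ℤ))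
    (v := (i : ℤ) + 1) hX e2.bdd (by simp [l1]) (by simp) (by simp [l1]) (by simp)
    (by simp [h2]) (by simp [h1]) (by rw [abs_of_nonneg (by positivity)]; omega)
  have e4 := exec_assign (x := 2) (e := var 2 - lit 1) (v := (d : ℤ)) hX e3.bdd (by omega)
    (by simp [l1]) (by simp) (by simp [h2]) (by rw [abs_of_nonneg (by positivity)]; omega)
  have e5 := exec_ite (e := get 1 (var 1)) (f := lit 0) (P := push q) hX hs.bdd (by simp)
    (by simp) (by simp; omega) (by simp) (fun hc => absurd hc (by simp [hs.reg1, hθ]))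
    (fun _ => e1.seq (e2.seq (e3.seq e4)))
  have e6 := e5.seq (exec_assign (x := 1) (e := var 1 + lit 1) (v := (i : ℤ) + 1) hX e5.bdd
    (by omega) (by simp [l1]) (by simp) (by simp [h1])
    (by rw [abs_of_nonneg (by positivity)]; omega))
  have hF' : Frame [1, 2, 3] [5, 6, 7, 8] [] m ((((m₁.setArr 7 d (n + max n' 1 : ℕ)).setArr 6 d
      ((i : ℤ) + 1)).setReg 2 d).setReg 1 ((i : ℤ) + 1)) :=
    ((((hF.mono (by simp) (by simp)).setArr (by simp)).setArr (by simp)).setReg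
      (by simp)).setReg (by simp)
  have htab : ((((m₁.setArr 7 d (n + max n' 1 : ℕ)).setArr 6 d ((i : ℤ) + 1)).setReg 2 d).setReg 1
      ((i : ℤ) + 1)).arr 5 = m₁.arr 5 := by
    simp [Mem.setArr_arr]
  refine ⟨_, e6.mono ?_, ⟨hE.frame hF' (by simp) (by simp), e6.bdd, by simp, by simp, by omega, ?_,
    fun r t h3 h4 => ?_⟩, ⟨by simp [Mem.setArr_arr], by
      simp [Mem.setArr_arr], by omega, ?_, ?_⟩, ⟨hF', fun x hx => ?_,
    fun x hx => ?_, fun r t ht => ?_⟩⟩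
  · have : 1 ≤ (12 * n + 1) * (12 * n' + 1) := Nat.one_le_iff_ne_zero.2 (by positivity)
    simp only [cost_add, cost_sub, cost_get, cost_var, cost_lit, cost_div]
    omega
  · rw [htab]; exact hc
  · rw [htab, hold r t h4 (by omega)]
    exact hs.fresh r t (by omega) h4
  · rw [htab]; exact hmin
  · have hq : (2 * q : ℤ) ^ k = (2 * q) ^ (k - 1) * (2 * q) := by
      rw [← pow_succ]; congr 1; omega
    have h1q : (1 : ℤ) ≤ 2 * q := by have := hE.lt; omega
    refine hL.bound.nest hE.lt hdvd hL'.bound (by positivity) (by positivity) (by positivity) ?_ ?_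
      hαp hβq
    · rw [hq]
      exact mul_le_mul_of_nonneg_right (pow_le_pow_right₀ h1q (by omega)) (by omega)
    · rw [hq]
      exact mul_le_mul_of_nonneg_right (pow_le_pow_right₀ h1q (by omega)) (by omega)
  · have : ¬ (x : ℤ) = d := by omega
    have g6 := congrFun (hF.2.1 6 (by simp)) x
    have g7 := congrFun (hF.2.1 7 (by simp)) x
    simp [Mem.setArr_arr, this, g6, g7]
  · have g8 := congrFun (hF.2.1 8 (by simp)) x
    simp [Mem.setArr_arr, g8]
  · rw [htab]
    exact hold r t (by omega) (by omega)

/-- A bound for the number of combinations that are considered in a valley, for a prefix with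
number `n`. -/
def combCount : Valley → ℕ → ℕ
  | .nil, _ => 0
  | .node _ U _ W, n =>
    1 + combCount U 0 + (12 * n + 1) * (12 * U.size + 1) + combCount W (n + max U.size 1)

/-- The number of combinations is `O(s (k + s))` for a valley with `k` letters. -/
lemma combCount_le (V : Valley) (n : ℕ) : combCount V n ≤
    6 * V.pairs.length * (n + V.size + 1) + 144 * V.size * (n + V.size) := by
  induction V generalizing n with
  | nil => simp [combCount]
  | node α U β W ihU ihW =>
    have h1 := ihU 0
    have h2 := ihW (n + max U.size 1)
    simp only [combCount, Valley.pairs, Valley.size, List.length_cons, List.length_append]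
    generalize combCount U 0 = cU at *
    generalize combCount W (n + max U.size 1) = cW at *
    generalize U.pairs.length = lU at *
    generalize W.pairs.length = lW at *
    generalize hu : max U.size 1 = u' at *
    have hu1 : U.size ≤ u' := by omega
    have hu2 : 1 ≤ u' := by omega
    generalize U.size = u at *
    generalize W.size = w at *
    have g1 : lU * (u + 1) ≤ lU * (n + (u' + w) + 1) := Nat.mul_le_mul_left _ (by omega)
    have g2 : u * u ≤ u' * u' := Nat.mul_le_mul hu1 hu1
    have g3 : n * u ≤ n * u' := Nat.mul_le_mul_left _ hu1
    have g4 : 0 ≤ u' * w := Nat.zero_le _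
    nlinarith

lemma loop_guard (hs : ScanState p q k X l i d m) (hik : i < k) {n : ℕ} {m' : Mem}
    (h : Exec X (scanStep p q) m n m') :
    LoopTo X (var 1) (var 0) (scanStep p q) m (n + 5) m' :=
  (loopTo_step hs.env.two_le hs.bdd (e := var 1) (f := var 0) (by simp) (by simp) (by simp)
    (by simp) (by simp [hs.reg1, hs.env.reg0, hik]) h).mono (by simp only [cost_var]; omega)

/-- The scan of a valley that starts at position `i` extends the topmost table by the bounded
representations of the valley. -/
lemma loopTo_valley (hdvd : p ∣ q) (V : Valley) : ∀ {i d e n b : ℕ} {m : Mem} {S : ℤ → ℤ → Prop}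
    {rest : List (ℤ × Dir)}, ScanState p q k X l i d m → Level q k m d e n b S → e ≤ i → b ≤ i →
    l.drop i = V.pairs ++ rest → (∀ x ∈ V.pairs, Bounded p q x) →
    ∃ m' e', LoopTo X (var 1) (var 0) (scanStep p q) m (13005 * combCount V n) m' ∧
      ScanState p q k X l (i + V.pairs.length) d m' ∧
      Level q k m' d e' (n + V.size) (b + V.pairs.length)
        (Extend p q ((2 * q) ^ k) ((2 * q) ^ (k - i - V.pairs.length)) S V) ∧
      e' ≤ i + V.pairs.length ∧ Keep k i d (d + 1) m m' := by
  induction V with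
  | nil =>
    intro i d e n b m S rest hs hL he hb hl hV
    refine ⟨m, e, LoopTo.refl.mono (by simp), hs, ?_, he, Keep.refl⟩
    have : Extend p q ((2 * q) ^ k) ((2 * q) ^ (k - i - Valley.nil.pairs.length)) S .nil = S := by
      funext r κ
      exact propext (extend_nil _ _ _ _ _)
    rw [this]
    exact hL
  | node α U β W ihU ihW =>
    intro i d e n b m S rest hs hL he hb hl hV
    have hl0 : l[i]? = some (α, Dir.T) := by
      have : (l.drop i)[0]? = some (α, Dir.T) := by rw [hl]; simp [Valley.pairs]
      simpa using this
    have hl1 : l.drop (i + 1) = U.pairs ++ (β, Dir.t) :: (W.pairs ++ rest) := by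
      rw [← List.drop_drop, hl]; simp [Valley.pairs]
    have hl2 : l[i + 1 + U.pairs.length]? = some (β, Dir.t) := by
      have : (l.drop (i + 1))[U.pairs.length]? = some (β, Dir.t) := by rw [hl1]; simp
      simpa [add_assoc] using this
    have hl3 : l.drop (i + 1 + U.pairs.length + 1) = W.pairs ++ rest := by
      rw [add_assoc, add_assoc, ← add_assoc 1, ← List.drop_drop, ← add_assoc] at *
      rw [show 1 + U.pairs.length + 1 = 1 + (U.pairs.length + 1) by ring, ← List.drop_drop,
        hl1]
      simp
    have hbα : |α| < (p : ℤ) := (hV (α, Dir.T) (by simp [Valley.pairs])).2 rfl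
    have hbβ : |β| < (q : ℤ) := (hV (β, Dir.t) (by simp [Valley.pairs])).1
    have hik := hs.env.lt_of_getElem? hl0
    obtain ⟨m₁, x1, s1, L1, p1, k1⟩ := exec_push hs hl0
    have hL₁ := hL.keep k1 (by omega) he
    obtain ⟨m₂, e₂, x2, s2, L2, he2, k2⟩ := ihU s1 L1 le_rfl (by omega) hl1
      (fun x hx => hV x (by simp [Valley.pairs, hx]))
    have hL₂ := hL₁.keep k2 (by omega) (by omega)
    have hik2 := s2.env.lt_of_getElem? hl2
    obtain ⟨m₃, x3, s3, L3, k3⟩ := exec_pop (α := α) hdvd s2 hL₂ L2 (by omega) he2 (by omega) hl2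
      (j₀ := i) (by omega) hl0 (by rw [k2.pos (d + 1) (by omega), p1]) hbα hbβ
    obtain ⟨m₄, e₄, x4, s4, L4, he4, k4⟩ := ihW s3 L3 le_rfl (by omega) hl3
      (fun x hx => hV x (by simp [Valley.pairs, hx]))
    have hlen : (Valley.node α U β W).pairs.length = U.pairs.length + W.pairs.length + 2 := by
      simp [Valley.pairs]; omega
    have hi4 : i + 1 + U.pairs.length + 1 + W.pairs.length =
        i + (Valley.node α U β W).pairs.length := by omega
    have hlk : i + (Valley.node α U β W).pairs.length ≤ k := by
      have := congrArg List.length hl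
      rw [List.length_drop, List.length_append, hs.env.length_eq] at this
      omega
    refine ⟨m₄, e₄, ?_, hi4 ▸ s4, ?_, by omega, ?_⟩
    · refine ((loop_guard hs hik x1).trans (x2.trans ((loop_guard s2 hik2 x3).trans x4))).mono ?_
      have : 1 ≤ (12 * n + 1) * (12 * U.size + 1) := Nat.one_le_iff_ne_zero.2 (by positivity)
      simp only [combCount, zero_add, mul_add]
      omega
    · have h1 : n + max (0 + U.size) 1 + W.size = n + (Valley.node α U β W).size := by
        simp [Valley.size]; omega
      have h2 : b + (0 + U.pairs.length) + 2 + W.pairs.length =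
          b + (Valley.node α U β W).pairs.length := by omega
      have h3 : Extend p q ((2 * q) ^ k) ((2 * q) ^ (k - i -
          (Valley.node α U β W).pairs.length)) S (.node α U β W) = Extend p q ((2 * q) ^ k)
          ((2 * q) ^ (k - (i + 1 + U.pairs.length + 1) - W.pairs.length))
          (Nest p q ((2 * q) ^ k) ((2 * q) ^ (k - 1 - i))
            ((2 * q) ^ (k - 1 - (i + 1 + U.pairs.length))) α β S
            (Extend p q ((2 * q) ^ k) ((2 * q) ^ (k - (i + 1) - U.pairs.length))
              (fun r κ => r = 0 ∧ κ = 0) U)) W := by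
        funext r κ
        have g1 : k - i - (Valley.node α U β W).pairs.length +
            (U.pairs.length + W.pairs.length + 1) = k - 1 - i := by omega
        have g2 : k - i - (Valley.node α U β W).pairs.length + W.pairs.length =
            k - 1 - (i + 1 + U.pairs.length) := by omega
        have g3 : k - i - (Valley.node α U β W).pairs.length + (W.pairs.length + 1) =
            k - (i + 1) - U.pairs.length := by omega
        have g4 : k - i - (Valley.node α U β W).pairs.length =
            k - (i + 1 + U.pairs.length + 1) - W.pairs.length := by omega
        rw [extend_node, ← pow_add, ← pow_add, ← pow_add, g1, g2, g3, g4]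
      rw [← h1, ← h2, h3]
      exact L4
    · exact (((k1.trans k2 (d₀ := d) (c₀ := d + 1) (by omega) (by omega) (by omega) (by omega)
        (by omega)).trans k3 (d₀ := d) (c₀ := d + 1) (by omega) (by omega) (by omega) (by omega)
        (by omega))).trans k4 (by omega) (by omega) (by omega) (by omega) (by omega)

end Visit

section Powers

open Ex

variable {p q k : ℕ} {X : ℤ} {l : List (ℤ × Dir)} {m : Mem}

/-! ### The table of the normal forms of powers of the generator -/

/-- The quotient `m` in a word `t a^(p m) T a^(z - q m)`, for `z` in register `6`. -/
def exQuot (q : ℕ) (c : ℤ) : Ex := var 6 / lit q + lit c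

/-- The length of the word for the quotient `⌊z / q⌋ + c`. -/
def exHopLen (p q : ℕ) (c : ℤ) : Ex :=
  get 2 (lit p * exQuot q c) + get 2 (var 6 - lit q * exQuot q c) + lit 2

/-- The key of the word for the quotient `⌊z / q⌋ + c`, as in `wordKey_hopWord`. -/
def exHopKey (p q : ℕ) (c : ℤ) : Ex :=
  (get 4 (lit p * exQuot q c) + lit 3 * get 3 (get 2 (lit p * exQuot q c))) * lit 4 *
    get 3 (get 2 (var 6 - lit q * exQuot q c)) + get 4 (var 6 - lit q * exQuot q c)

/-- Compute the length and the key of the normal form for the exponent in register `6`. -/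
def hop (p q : ℕ) : Prog :=
  .ite (exHopKey p q 1) (exHopKey p q 0)
    (.seq (.put 4 (var 6) (exHopKey p q 1)) (.put 2 (var 6) (exHopLen p q 1)))
    (.seq (.put 4 (var 6) (exHopKey p q 0)) (.put 2 (var 6) (exHopLen p q 0)))

/-- The arrays `2` and `4` hold the length and the key of the normal form of `a ^ x`. -/
def GoodAt (p q : ℕ) (m : Mem) (x : ℤ) : Prop :=
  m.arr 2 x = aLen p q x ∧ m.arr 4 x = wordKey (aNf p q x)

lemma two_mul_le_of_dvd (hpq : p < q) (hdvd : p ∣ q) : 2 * p ≤ q := by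
  obtain ⟨e, rfl⟩ := hdvd
  have : 2 ≤ e := by
    by_contra hc
    have : e = 0 ∨ e = 1 := by omega
    rcases this with rfl | rfl <;> omega
  nlinarith

/-- The normal form of `a ^ z` refers only to exponents of smaller absolute value. -/
lemma hop_arguments (h2 : 2 * p ≤ q) (hq : 1 ≤ q) {z c : ℤ} (hz : 3 * (q : ℤ) + 1 ≤ |z|)
    (hc : c = 0 ∨ c = 1) : |p * (z / q + c)| < |z| ∧ |z - q * (z / q + c)| < |z| := by
  have hq' : (0 : ℤ) < q := by omega
  have e1 := Int.mul_ediv_add_emod z q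
  have e2 := Int.emod_nonneg z hq'.ne'
  have e3 := Int.emod_lt_of_pos z hq'
  generalize hm : z / q = m at *
  have e4 : |z - q * (m + c)| ≤ q := by
    have : z - q * (m + c) = z % q - q * c := by linarith
    rw [this, abs_le]
    rcases hc with rfl | rfl <;> omega
  refine ⟨?_, by omega⟩
  have e5 : |(q : ℤ) * (m + c)| ≤ |z| + q := by
    have : (q : ℤ) * (m + c) = z - (z - q * (m + c)) := by ring
    rw [this]
    exact (abs_sub z _).trans (by linarith)
  rw [abs_mul, Nat.abs_cast] at e5 ⊢
  have h2' : 2 * (p : ℤ) ≤ q := by exact_mod_cast h2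
  have := mul_le_mul_of_nonneg_right h2' (abs_nonneg (m + c))
  linarith

lemma aLen_le_abs (x : ℤ) : (aLen p q x : ℤ) ≤ |x| := by
  rw [Int.abs_eq_natAbs]
  exact_mod_cast aLen_le_natAbs x

/-- If the tables are correct for all smaller absolute values, then `hop` makes them correct for
`z`. -/
lemma exec_hop (h2 : 2 * p ≤ q) (hp : 1 ≤ p) {B : ℕ} {z : ℤ} (hX : 2 ≤ X) (hm : m.Bdd X)
    (hlit : 14 * (q : ℤ) * q ≤ X) (hB : 2 * 4 ^ B ≤ X) (h6 : m.reg 6 = z)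
    (hz : 3 * (q : ℤ) + 1 ≤ |z|) (hzB : |z| ≤ B) (hpow : ∀ i ≤ B, m.arr 3 i = 4 ^ i)
    (hgood : ∀ x, |x| < |z| → GoodAt p q m x) :
    ∃ m', Exec X (hop p q) m 300 m' ∧ Frame [] [2, 4] [] m m' ∧ GoodAt p q m' z ∧
      ∀ x, x ≠ z → GoodAt p q m x → GoodAt p q m' x := by
  have hpq : p < q := by omega
  have hq : 1 ≤ q := by omega
  obtain ⟨l1, l2, l3, l4, l5, l6, l7, l8, l9, l10⟩ := lit_bounds hq hpq hlit
  have elen : ∀ c : ℤ, c = 0 ∨ c = 1 → ∀ y, (exHopLen p q c).eval (m.setArr 4 z y) =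
      (hopWord p q z (z / q + c)).length := by
    intro c hc y
    obtain ⟨a1, a2⟩ := hop_arguments h2 hq hz hc
    have g1 := (hgood _ a1).1
    have g2 := (hgood _ a2).1
    rw [hopWord_length]
    simp [exHopLen, exQuot, h6, Mem.setArr_arr, g1, g2]
  have ekey : ∀ c : ℤ, c = 0 ∨ c = 1 → (exHopKey p q c).eval m =
      wordKey (hopWord p q z (z / q + c)) := by
    intro c hc
    obtain ⟨a1, a2⟩ := hop_arguments h2 hq hz hc
    have g1 := hgood _ a1
    have g2 := hgood _ a2
    have b1 := aLen_le_abs (p := p) (q := q) (p * (z / q + c))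
    have b2 := aLen_le_abs (p := p) (q := q) (z - q * (z / q + c))
    have w1 := hpow (aLen p q (p * (z / q + c))) (by omega)
    have w2 := hpow (aLen p q (z - q * (z / q + c))) (by omega)
    rw [wordKey_hopWord]
    simp [exHopKey, exQuot, h6, g1.1, g1.2, g2.1, g2.2, w1, w2]
  have adk : ∀ c : ℤ, c = 0 ∨ c = 1 → (exHopKey p q c).Admissible X := by
    intro c hc
    have : |c| ≤ X := by rcases hc with rfl | rfl <;> simp <;> omega
    simp [exHopKey, exQuot, this, l4, l6, l7]
    omega
  have adl : ∀ c : ℤ, c = 0 ∨ c = 1 → (exHopLen p q c).Admissible X := by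
    intro c hc
    have : |c| ≤ X := by rcases hc with rfl | rfl <;> simp <;> omega
    simp [exHopLen, exQuot, this, hX, l6, l7]
  have sk : ∀ c : ℤ, (exHopKey p q c).size ≤ 200 := fun c => Nat.le_of_ble_eq_true rfl
  have sl : ∀ c : ℤ, (exHopLen p q c).size ≤ 200 := fun c => Nat.le_of_ble_eq_true rfl
  have ck : ∀ c : ℤ, (exHopKey p q c).cost ≤ 80 := fun c => Nat.le_of_ble_eq_true rfl
  have cl : ∀ c : ℤ, (exHopLen p q c).cost ≤ 50 := fun c => Nat.le_of_ble_eq_true rfl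
  have hlen : (aLen p q z : ℤ) ≤ B := (aLen_le_abs z).trans hzB
  have hpowB : (4 : ℤ) ^ aLen p q z ≤ 4 ^ B := pow_le_pow_right₀ (by norm_num) (by omega)
  have hwk := wordKey_bounds (aNf p q z)
  rw [aNf_length] at hwk
  have hBX : (B : ℤ) ≤ X := by
    have h1 : B < 4 ^ B := Nat.lt_pow_self (by norm_num)
    have h2 : (B : ℤ) < 4 ^ B := by exact_mod_cast h1
    linarith [(by positivity : (0 : ℤ) < 4 ^ B)]
  have hpos : (0 : ℤ) < 4 ^ aLen p q z := by positivity
  have store : ∀ c : ℤ, c = 0 ∨ c = 1 → wordKey (aNf p q z) =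
      wordKey (hopWord p q z (z / q + c)) ∧ aLen p q z = (hopWord p q z (z / q + c)).length →
      Exec X (.seq (.put 4 (var 6) (exHopKey p q c)) (.put 2 (var 6) (exHopLen p q c))) m 138
        ((m.setArr 4 z (wordKey (aNf p q z))).setArr 2 z (aLen p q z)) := by
    intro c hc h
    have e1 := exec_put (b := 4) (e := var 6) (j := z) hX hm (by simp) (by simp) (adk c hc) (sk c)
      (by simp [h6]) ((ekey c hc).trans h.1.symm) (by rw [abs_of_nonneg] <;> linarith)
    exact (e1.seq (exec_put (b := 2) (e := var 6) (j := z) (v := aLen p q z) hX e1.bdd (by simp)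
      (by simp) (adl c hc) (sl c) (by simp [h6]) (by rw [elen c hc, h.2])
      (by rw [Nat.abs_cast]; omega))).mono (by
        have := ck c
        have := cl c
        simp only [cost_var]
        omega)
  have hc := aNf_hop hp hpq (n := z) (by omega)
  refine ⟨(m.setArr 4 z (wordKey (aNf p q z))).setArr 2 z (aLen p q z),
    (exec_ite hX hm (adk 1 (.inr rfl)) (sk 1) (adk 0 (.inl rfl)) (sk 0)
      (fun h => store 1 (.inr rfl) (hc.1 ?_)) (fun h => store 0 (.inl rfl) ?_)).mono ?_,
    (Frame.refl.setArr (by simp)).setArr (by simp), ⟨?_, ?_⟩, fun x hx hg => ⟨?_, ?_⟩⟩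
  · simpa only [ekey 1 (.inr rfl), ekey 0 (.inl rfl), add_zero] using h
  · have := hc.2 (by simpa only [ekey 1 (.inr rfl), ekey 0 (.inl rfl), add_zero] using h)
    rwa [add_zero]
  · have := ck 0
    have := ck 1
    omega
  · simp [Mem.setArr_arr]
  · simp [Mem.setArr_arr]
  · simp [Mem.setArr_arr, Function.update_of_ne hx, hg.1]
  · simp [Mem.setArr_arr, Function.update_of_ne hx, hg.2]

/-- Extend the tables of lengths and keys from the exponents up to `3 q` by `12 p n` in both
directions, where `n` is the number in cell `0` of array `7`. -/
def extendPowers (p q : ℕ) : Prog :=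
  .forLt 5 (lit (12 * p) * get 7 (lit 0))
    (.seq (.assign 6 (lit (3 * q + 1) + var 5)) (.seq (hop p q)
      (.seq (.assign 6 (lit 0 - var 6)) (hop p q))))

/-- All exponents `p (r' - r)` with `|r|, |r'| ≤ 6 n` are covered by the extended tables. -/
lemma exec_extendPowers (h2 : 2 * p ≤ q) (hp : 1 ≤ p) {n : ℕ} (hX : 2 ≤ X) (hm : m.Bdd X)
    (hlit : 14 * (q : ℤ) * q ≤ X) (hB : 2 * 4 ^ (3 * q + 12 * p * n) ≤ X) (h7 : m.arr 7 0 = n)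
    (hpow : ∀ i ≤ 3 * q + 12 * p * n, m.arr 3 i = 4 ^ i)
    (hgood : ∀ x : ℤ, |x| ≤ 3 * q → GoodAt p q m x) :
    ∃ m', Exec X (extendPowers p q) m (700 * (12 * p * n + 1)) m' ∧
      Frame [5, 6] [2, 4] [] m m' ∧
      ∀ x : ℤ, |x| ≤ 3 * q + 12 * p * n → GoodAt p q m' x := by
  have hpq : p < q := by omega
  have hq : 1 ≤ q := by omega
  obtain ⟨l1, l2, l3, l4, l5, l6, l7, l8, l9, l10⟩ := lit_bounds hq hpq hlit
  have hpq' : (p : ℤ) < q := by exact_mod_cast hpq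
  have hq' : (1 : ℤ) ≤ q := by exact_mod_cast hq
  have hBX : ((3 * q + 12 * p * n : ℕ) : ℤ) ≤ X := by
    have h1 : 3 * q + 12 * p * n < 4 ^ (3 * q + 12 * p * n) := Nat.lt_pow_self (by norm_num)
    have h2 : ((3 * q + 12 * p * n : ℕ) : ℤ) < 4 ^ (3 * q + 12 * p * n) := by exact_mod_cast h1
    linarith [(by positivity : (0 : ℤ) < 4 ^ (3 * q + 12 * p * n))]
  obtain ⟨m', r1, r2, r3⟩ := exec_forLt (N := 12 * p * n) (x := 5)
    (f := lit (12 * p) * get 7 (lit 0)) (n := 630)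
    (P := .seq (.assign 6 (lit (3 * q + 1) + var 5)) (.seq (hop p q)
      (.seq (.assign 6 (lit 0 - var 6)) (hop p q)))) hX hm (by omega)
    (by simp [abs_of_nonneg]; omega) (by simp) (by push_cast at hBX ⊢; omega)
    (fun J m' => Frame [5, 6] [2, 4] [] m m' ∧
      ∀ x : ℤ, |x| ≤ 3 * q + J → GoodAt p q m' x)
    (fun j _ m' h => by simp [h.1.2.1 7 (by simp), h7])
    (fun J hJ m₁ hI h5 hb => by
      obtain ⟨hF, hg⟩ := hI
      have hJ' : (J : ℤ) < 12 * p * n := by exact_mod_cast hJ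
      push_cast at hBX
      have habs : |3 * (q : ℤ) + 1 + J| = 3 * q + 1 + J := abs_of_nonneg (by positivity)
      have e1 := exec_assign (x := 6) (e := lit (3 * q + 1) + var 5) (v := 3 * q + 1 + J) hX hb
        (by omega) (by simp [abs_of_nonneg, (by positivity : (0 : ℤ) ≤ 3 * q + 1)]; omega) (by simp)
        (by simp [h5]) (by rw [habs]; omega)
      obtain ⟨m₂, e2, f2, g2, k2⟩ := exec_hop (z := 3 * q + 1 + J) (B := 3 * q + 12 * p * n) h2 hp hX
        e1.bdd hlit hB (by simp) (by rw [habs]; omega) (by rw [habs]; push_cast; omega)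
        (fun i hi => by rw [Mem.setReg_arr, hF.2.1 3 (by simp)]; exact hpow i hi)
        (fun x hx => hg x (by omega))
      have e3 := exec_assign (x := 6) (e := lit 0 - var 6) (v := -(3 * q + 1 + J)) hX e2.bdd
        (by omega) (by simp; omega) (by simp) (by simp [f2.1 6 (by simp)])
        (by rw [abs_neg, habs]; omega)
      obtain ⟨m₄, e4, f4, g4, k4⟩ := exec_hop (z := -(3 * q + 1 + J)) (B := 3 * q + 12 * p * n) h2 hp
        hX e3.bdd hlit hB (by simp) (by rw [abs_neg, habs]; omega)
        (by rw [abs_neg, habs]; push_cast; omega)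
        (fun i hi => by
          rw [Mem.setReg_arr, f2.2.1 3 (by simp), Mem.setReg_arr, hF.2.1 3 (by simp)]
          exact hpow i hi)
        (fun x hx => k2 x (by rintro rfl; rw [abs_neg] at hx; omega)
          (hg x (by rw [abs_neg] at hx; omega)))
      refine ⟨m₄, (e1.seq (e2.seq (e3.seq e4))).mono ?_, ?_, ?_, fun x hx => ?_⟩
      · simp only [cost_add, cost_sub, cost_lit, cost_var]; omega
      · rw [f4.1 5 (by simp)]
        simp [f2.1 5 (by simp), h5]
      · exact (((((hF.setReg (by simp)).trans (f2.mono (by simp) (by simp))).setReg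
          (by simp)).trans (f4.mono (by simp) (by simp)))).setReg (by simp)
      · push_cast at hx
        by_cases hx1 : x = -(3 * q + 1 + J)
        · subst hx1; exact g4
        · by_cases hx2 : x = 3 * q + 1 + J
          · subst hx2
            exact k4 _ hx1 g2
          · refine k4 x hx1 (k2 x hx2 (hg x ?_))
            by_contra hc
            have : |x| = 3 * q + 1 + J := by omega
            rcases abs_eq (by positivity) |>.1 this with h | h
            · exact hx2 h
            · exact hx1 h)
    ⟨Frame.refl.setReg (by simp), fun x hx => hgood x (by push_cast at hx; linarith)⟩
  refine ⟨m', r1.mono ?_, r2, fun x hx => r3 x (by push_cast; exact hx)⟩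
  exact Nat.mul_le_mul_right _ (by simp only [cost_mul, cost_get, cost_lit]; omega)

/-! ### The complete scan -/

/-- Scan the valley, starting with the table for the empty valley at depth `0`. -/
def scan (p q : ℕ) : Prog :=
  .seq (.put 5 (lit 0) (lit 0 - exZ q)) (.loop (var 1) (var 0) (scanStep p q))

/-- The exponents and keys of the bounded representations of `V`. -/
def RepKey (p q k : ℕ) (V : Valley) (r κ : ℤ) : Prop :=
  ∃ V', Valley.Rep p q V r V' ∧ κ = listKey p q ((2 * q) ^ k) 1 V'.pairs

/-- After the scan, the only table left on the stack holds the minimal keys of the bounded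
representations of `V`. -/
lemma exec_scan (hdvd : p ∣ q) (V : Valley) (hE : Env p q k X V.pairs m) (hm : m.Bdd X)
    (h1 : m.reg 1 = 0) (h2 : m.reg 2 = 0) (h5 : ∀ z, m.arr 5 z = 0) (h6 : m.arr 6 0 = 0)
    (h7 : m.arr 7 0 = 0) (hV : ∀ x ∈ V.pairs, Bounded p q x) :
    ∃ m' e, Exec X (scan p q) m (13005 * combCount V 0 + 30) m' ∧
      Frame [1, 2, 3] [5, 6, 7, 8] [] m m' ∧ m'.arr 6 0 = (e : ℕ) ∧ m'.arr 7 0 = V.size ∧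
      V.size ≤ k ∧
      (∀ r, MinCell (keyShift q k) (RepKey p q k V r) (m'.arr 5 (r * (k + 1) + e))) ∧
      KeyBound q ((2 * q) ^ k) k V.size (RepKey p q k V) := by
  have hX := hE.two_le
  obtain ⟨l12, l1, lk, l14⟩ := hE.lits
  have hZ0 := keyShift_nonneg q k
  have e1 := exec_put (b := 5) (e := lit 0) (f := lit 0 - exZ q) (j := 0) (v := -keyShift q k) hX hm
    (by simp; omega) (by simp) (by simp [exZ, exM, l1, l14, abs_of_nonneg]; omega)
    (Nat.le_of_ble_eq_true rfl) (by simp) (by simp [exZ_eval hE])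
    (by rw [abs_neg, abs_of_nonneg hZ0]; exact hE.shift_le)
  have hF₁ : Frame [1, 2, 3] [5, 6, 7, 8] [] m (m.setArr 5 0 (-keyShift q k)) :=
    Frame.refl.setArr (by simp)
  have hs : ScanState p q k X V.pairs 0 0 (m.setArr 5 0 (-keyShift q k)) := by
    refine ⟨hE.frame hF₁ (by simp) (by simp), e1.bdd, by simp [h1], by simp [h2], le_rfl,
      fun z => ?_, fun r t ht htk => ?_⟩
    · simp [Mem.setArr_arr, Function.update_apply, h5]
      split_ifs <;> omega
    · have : ¬ r * (k + 1) + t = (0 : ℤ) := fun h => by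
        have := addr_injective (k := k) (r := r) (r' := 0) (t := t) (t' := 0) (by omega)
          (by omega) (by push_cast; rw [h]; ring)
        omega
      simp [Mem.setArr_arr, Function.update_of_ne this, h5]
  have hL : Level q k (m.setArr 5 0 (-keyShift q k)) 0 0 0 0 (fun r κ => r = 0 ∧ κ = 0) := by
    refine ⟨by simp [Mem.setArr_arr, h6], by simp [Mem.setArr_arr, h7], le_rfl, fun r => ?_, ?_⟩
    · by_cases hr : r = 0
      · subst hr
        refine ⟨?_, .inr ⟨0, ⟨rfl, rfl⟩, ?_⟩, fun κ hκ => ?_⟩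
        · simp [Mem.setArr_arr]; omega
        · simp [Mem.setArr_arr]
        · simp [Mem.setArr_arr, hκ.2]
      · have : ¬ r * (k + 1) + ((0 : ℕ) : ℤ) = (0 : ℤ) := fun h => by
          have := addr_injective (k := k) (r := r) (r' := 0) (t := 0) (t' := 0) (by omega)
            (by omega) (by rw [h]; push_cast; ring)
          exact hr this.1
        have h0 : (m.setArr 5 0 (-keyShift q k)).arr 5 (r * (k + 1) + ((0 : ℕ) : ℤ)) = 0 := by
          simp only [Mem.setArr_arr, if_true, Function.update_of_ne this, h5]
        rw [h0]
        exact minCell_empty _ fun κ h => hr h.1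
    · rintro r κ ⟨rfl, rfl⟩
      simp
  obtain ⟨m', e, x2, s2, L2, he, k2⟩ := loopTo_valley (rest := []) hdvd V hs hL le_rfl le_rfl
    (by simp) hV
  have hlen : 0 + V.pairs.length = k := by rw [zero_add, hE.length_eq]
  rw [hlen] at s2
  have hdone := exec_loop_done (P := scanStep p q) hX s2.bdd (e := var 1) (f := var 0) (by simp)
    (by simp) (by simp) (by simp) (by simp [s2.reg1, s2.env.reg0])
  have hS : Extend p q ((2 * q) ^ k) ((2 * q) ^ (k - 0 - V.pairs.length))
      (fun r κ => r = 0 ∧ κ = 0) V = RepKey p q k V := by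
    funext r κ
    apply propext
    rw [show k - 0 - V.pairs.length = 0 by omega, pow_zero]
    constructor
    · rintro ⟨_, _, r₂, V', ⟨rfl, rfl⟩, h1, rfl, rfl⟩
      exact ⟨V', by simpa using h1, by simp⟩
    · rintro ⟨V', h1, rfl⟩
      exact ⟨0, 0, r, V', ⟨rfl, rfl⟩, h1, by simp, by simp⟩
  rw [hS, hlen, zero_add] at L2
  refine ⟨m', e, (e1.seq (x2 _ _ hdone)).mono ?_, hF₁.trans k2.frame, L2.id, L2.num, L2.num_le,
    L2.tab, L2.bound⟩
  have : (exZ q).cost ≤ 15 := Nat.le_of_ble_eq_true rfl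
  simp only [cost_lit, cost_sub, cost_var]
  omega

end Powers

section Output

open Ex

variable {p q k e n : ℕ} {X : ℤ} {V : Valley} {m : Mem}

/-! ### The output -/

/-- Write the letters of the normal form of `a ^ x`, for `x` in register `13`. -/
def emitPower : Prog :=
  .forLt 12 (get 2 (var 13))
    (.write (get 4 (var 13) / get 3 (get 2 (var 13) - lit 1 - var 12) % lit 4))

/-- The cell of the final table for the exponent `r`. -/
def exCell (r : Ex) : Ex := get 5 (exAddr r (get 6 (lit 0)))

/-- The exponent with number `x` in the window of the final table. -/
def exWindow (x : Ex) : Ex := x - lit 6 * get 7 (lit 0)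

/-- The exponent `p (r' - r)` that remains if a bounded representation for `r'` is used for `r`. -/
def exDiff (p : ℕ) : Ex := lit p * (var 8 - var 7)

/-- The shifted key of the whole word: the remaining power of `a` adds its length to the norm. -/
def exTotal (p : ℕ) : Ex := exCell (exWindow (var 8)) + exM * get 2 (exDiff p)

/-- Find the best bounded representation for the exponent with number `var 7`: the shifted key is
put into register `9`, and the exponent of the remaining power of `a` into register `10`. -/
def findBest (p : ℕ) : Prog :=
  .seq (.assign 9 (lit 0)) (.seq (.assign 10 (lit 0))
    (.forLt 8 (lit 12 * get 7 (lit 0) + lit 1)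
      (.ite (exTotal p) (var 9) (.seq (.assign 9 (exTotal p)) (.assign 10 (exDiff p))) .skip)))

/-- Write the word that is encoded in the registers `9` and `10`. -/
def emitWord (q : ℕ) : Prog :=
  .seq (.forLt 11 (var 0)
    (.seq (.assign 13 (get 11 ((var 9 + exZ q) / get 12 (var 0 - lit 1 - var 11) % lit (2 * q))))
      (.seq emitPower (.write ((lit 1 - get 1 (var 11)) / lit 2)))))
    (.seq (.assign 13 (var 10)) emitPower)

/-- For each exponent with a bounded representation, output `ρ`, the length of `V_ρ`, and `V_ρ`. -/
def output (p q : ℕ) : Prog :=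
  .forLt 7 (lit 12 * get 7 (lit 0) + lit 1)
    (.ite (exCell (exWindow (var 7))) (lit 0)
      (.seq (findBest p) (.seq (.write (lit p * exWindow (var 7)))
        (.seq (.write ((var 9 + exZ q) / exM)) (emitWord q)))) .skip)

/-- The code of a word in the output. -/
def wordCode (v : List Letter) : List ℤ := v.map fun x => (x.rank : ℤ)

/-- What the output part of the program relies on. -/
structure OutEnv (p q k : ℕ) (X : ℤ) (V : Valley) (e n : ℕ) (m : Mem) : Prop where
  env : Env p q k X V.pairs m
  id : m.arr 6 0 = e
  num : m.arr 7 0 = n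
  num_le : n ≤ k
  pow_le : 2 * 4 ^ (3 * q + 12 * p * n) ≤ X
  pow_four : ∀ i ≤ 3 * q + 12 * p * n, m.arr 3 i = 4 ^ i
  good : ∀ x : ℤ, |x| ≤ 3 * q + 12 * p * n → GoodAt p q m x
  inv : ∀ x : ℤ, |x| < (q : ℤ) → m.arr 11 (zrank x) = x
  tab : ∀ r, MinCell (keyShift q k) (RepKey p q k V r) (m.arr 5 (r * (k + 1) + e))
  bound : KeyBound q ((2 * q) ^ k) k n (RepKey p q k V)

lemma OutEnv.frame (h : OutEnv p q k X V e n m) {R : List ℕ} {o : List ℤ} {m' : Mem}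
    (hf : Frame R [] o m m') (hR : 0 ∉ R) : OutEnv p q k X V e n m' where
  env := h.env.frame hf hR (by simp)
  id := by rw [hf.2.1 _ (by simp)]; exact h.id
  num := by rw [hf.2.1 _ (by simp)]; exact h.num
  num_le := h.num_le
  pow_le := h.pow_le
  pow_four := by rw [hf.2.1 _ (by simp)]; exact h.pow_four
  good x hx := by
    have := h.good x hx
    exact ⟨by rw [hf.2.1 _ (by simp)]; exact this.1, by rw [hf.2.1 _ (by simp)]; exact this.2⟩
  inv := by rw [hf.2.1 _ (by simp)]; exact h.inv
  tab := by rw [hf.2.1 _ (by simp)]; exact h.tab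
  bound := h.bound

lemma OutEnv.exponent_le (h : OutEnv p q k X V e n m) : (3 * q + 12 * p * n : ℤ) ≤ X := by
  have h1 : 3 * q + 12 * p * n < 4 ^ (3 * q + 12 * p * n) := Nat.lt_pow_self (by norm_num)
  have h2 : ((3 * q + 12 * p * n : ℕ) : ℤ) < 4 ^ (3 * q + 12 * p * n) := by exact_mod_cast h1
  have h3 := h.pow_le
  push_cast at h2
  linarith [(by positivity : (0 : ℤ) < 4 ^ (3 * q + 12 * p * n))]

lemma exec_emitPower (h : OutEnv p q k X V e n m) (hm : m.Bdd X) {x : ℤ} (h13 : m.reg 13 = x)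
    (hx : |x| ≤ 3 * q + 12 * p * n) :
    ∃ m', Exec X emitPower m (60 * (aLen p q x + 1)) m' ∧
      Frame [12] [] (wordCode (aNf p q x)) m m' := by
  obtain ⟨l12, l1, lk, l14⟩ := h.env.lits
  have hlen := aLen_le_abs (p := p) (q := q) x
  have hlen' : aLen p q x ≤ 3 * q + 12 * p * n := by
    have := hlen.trans hx
    exact_mod_cast this
  have hg := h.good x hx
  obtain ⟨m', r1, r2⟩ := exec_forLt (x := 12) (f := get 2 (var 13)) (N := aLen p q x) (n := 30)
    (P := .write (get 4 (var 13) / get 3 (get 2 (var 13) - lit 1 - var 12) % lit 4))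
    h.env.two_le hm (by omega) (by simp) (by simp) (hlen.trans (hx.trans h.exponent_le))
    (fun J m' => Frame [12] [] (wordCode ((aNf p q x).take J)) m m')
    (fun j _ m' hF => by simp [hF.1 13 (by simp), hF.2.1 2 (by simp), h13, hg.1])
    (fun J hJ m₁ hF h12 hb => by
      have hJ' : J < (aNf p q x).length := by rwa [aNf_length]
      have hdig := wordKey_digit (aNf p q x) hJ'
      have e4 : m₁.arr 3 ((aLen p q x : ℤ) - 1 - J) = 4 ^ (aLen p q x - 1 - J) := by
        rw [hF.2.1 3 (by simp), ← h.pow_four _ (by omega)]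
        congr 1
        omega
      have ew := exec_write (e := get 4 (var 13) / get 3 (get 2 (var 13) - lit 1 - var 12) % lit 4)
        (v := ((aNf p q x)[J].rank : ℤ)) h.env.two_le hb (by simp [l1]; omega) (by simp) (by
          rw [← hdig, aNf_length]
          simp [hF.1 13 (by simp), hF.2.1 2 (by simp), hF.2.1 4 (by simp), h13, hg.1, hg.2, h12, e4])
      refine ⟨_, ew.mono (Nat.le_of_ble_eq_true rfl), h12, ?_⟩
      have := (hF.write (v := ((aNf p q x)[J].rank : ℤ))).setReg (x := 12) (v := (J : ℤ) + 1)
        (by simp)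
      rw [List.take_succ_eq_append_getElem hJ', wordCode, List.map_append]
      exact this)
    (Frame.refl.setReg (by simp))
  refine ⟨m', r1.mono (Nat.mul_le_mul_right _ (Nat.le_of_ble_eq_true rfl)), ?_⟩
  rwa [List.take_of_length_le (by rw [aNf_length])] at r2

/-- The value of `findBest` after the exponents with numbers below `J` have been considered. -/
def BestAt (p q : ℕ) (M : ℤ) (f : ℤ → ℤ) (n : ℕ) (r : ℤ) (J : ℕ) (c y : ℤ) : Prop :=
  c ≤ 0 ∧ (c = 0 ∨ ∃ j < J, c = f ((j : ℕ) - 6 * n) + M * aLen p q (p * (j - 6 * n - r)) ∧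
    y = p * (j - 6 * n - r)) ∧
    ∀ j < J, c ≤ f ((j : ℕ) - 6 * n) + M * aLen p q (p * (j - 6 * n - r))

/-- All exponents of the final table are tried. -/
lemma exec_findBest (h : OutEnv p q k X V e n m) (hm : m.Bdd X) {i : ℕ} (h7 : m.reg 7 = i)
    (hi : i ≤ 12 * n) :
    ∃ m' c y, Exec X (findBest p) m (200 * (12 * n + 2)) m' ∧ Frame [8, 9, 10] [] [] m m' ∧
      m'.reg 9 = c ∧ m'.reg 10 = y ∧
      BestAt p q ((2 * q) ^ k) (fun r => m.arr 5 (r * (k + 1) + e)) n (i - 6 * n) (12 * n + 1) c y := by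
  obtain ⟨l12, l1, lk, l14⟩ := h.env.lits
  have hX := h.env.two_le
  have hpX : (p : ℤ) ≤ X := by have := h.env.lt; omega
  have hZ := h.env.shift_le
  have hcell : ∀ r : ℤ, -keyShift q k ≤ m.arr 5 (r * (k + 1) + e) := fun r =>
    (h.tab r).neg_le (keyShift_nonneg q k) fun κ hκ => (h.bound r κ hκ).2.1
  have hcount := h.env.count_le
  have hn := h.num_le
  have e1 := exec_assign (x := 9) (e := lit 0) (v := 0) hX hm (by omega) (by simp; omega) (by simp)
    (by simp) (by simp; omega)
  have e2 := exec_assign (x := 10) (e := lit 0) (v := 0) hX e1.bdd (by omega) (by simp; omega)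
    (by simp) (by simp) (by simp; omega)
  obtain ⟨m', r1, r2, r3⟩ := exec_forLt (x := 8) (f := lit 12 * get 7 (lit 0) + lit 1)
    (N := 12 * n + 1) (n := 150)
    (P := .ite (exTotal p) (var 9) (.seq (.assign 9 (exTotal p)) (.assign 10 (exDiff p))) .skip)
    hX e2.bdd (by omega) (by simp [l1, l12]; omega) (by simp) (by push_cast; nlinarith)
    (fun J m' => Frame [8, 9, 10] [] [] m m' ∧
      BestAt p q ((2 * q) ^ k) (fun r => m.arr 5 (r * (k + 1) + e)) n (i - 6 * n) J
        (m'.reg 9) (m'.reg 10))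
    (fun j _ m' hI => by simp [hI.1.2.1 7 (by simp), h.num])
    (fun J hJ m₁ hI h8 hb => by
      obtain ⟨hF, hc, hval, hmin⟩ := hI
      have h7' : m₁.reg 7 = i := by rw [hF.1 7 (by simp), h7]
      have hE := h.frame hF (by simp)
      have hdiff : (exDiff p).eval m₁ = p * (J - 6 * n - (i - 6 * n)) := by
        simp [exDiff, h8, h7']
      have hJi : |(p : ℤ) * (J - 6 * n - (i - 6 * n))| ≤ 12 * p * n := by
        rw [abs_mul, Nat.abs_cast]
        have : |(J : ℤ) - 6 * n - (i - 6 * n)| ≤ 12 * n := by rw [abs_le]; omega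
        have := mul_le_mul_of_nonneg_left this (by omega : (0 : ℤ) ≤ p)
        linarith
      have hlen := (hE.good (p * (J - 6 * n - (i - 6 * n))) (by linarith)).1
      have htot : (exTotal p).eval m₁ = m.arr 5 (((J : ℤ) - 6 * n) * (k + 1) + e) +
          (2 * q) ^ k * aLen p q (p * (J - 6 * n - (i - 6 * n))) := by
        have hp := hE.env.pow k le_rfl
        rw [exTotal, eval_add, eval_mul, eval_get, hdiff, hlen]
        simp [exCell, exWindow, exAddr, exM, hE.num, hE.id, hE.env.reg0, h8, hp,
          hF.2.1 5 (by simp)]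
      have s1 : (exTotal p).size ≤ 200 := Nat.le_of_ble_eq_true rfl
      have a2 : (exDiff p).Admissible X := by simp [exDiff, hpX]
      have a1 : (exTotal p).Admissible X := by
        simp [exTotal, exCell, exWindow, exAddr, exM, a2, l1]; omega
      have c1 : (exTotal p).cost ≤ 50 := Nat.le_of_ble_eq_true rfl
      have c2 : (exDiff p).cost ≤ 10 := Nat.le_of_ble_eq_true rfl
      by_cases hlt : (exTotal p).eval m₁ < (var 9).eval m₁
      · have hlt' := hlt
        rw [htot, eval_var] at hlt'
        have e3 := exec_assign (x := 9) hX hb (by omega) a1 s1 htot (by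
          have := hcell ((J : ℤ) - 6 * n)
          have g : (0 : ℤ) ≤ (2 * q) ^ k * aLen p q (p * (J - 6 * n - (i - 6 * n))) := by positivity
          rw [abs_le]
          constructor <;> linarith)
        have e4 := exec_assign (x := 10) (e := exDiff p) (v := p * (J - 6 * n - (i - 6 * n))) hX
          e3.bdd (by omega) a2 (Nat.le_of_ble_eq_true rfl) (by simp [exDiff, h8, h7'])
          (hJi.trans (by have := h.exponent_le; omega))
        have e5 := exec_ite (Q := .skip) (e := exTotal p) (f := var 9) hX hb a1 s1 (by simp)
          (by simp) (fun _ => e3.seq e4) (fun hc => absurd hlt hc)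
        refine ⟨_, e5.mono (by simp only [cost_var]; omega), by simp [h8],
          ((hF.setReg (by simp)).setReg (by simp)).setReg (by simp), ?_⟩
        simp only [Mem.setReg_reg]
        norm_num at hlt' ⊢
        refine ⟨by linarith, .inr ⟨J, by omega, by norm_num, by norm_num⟩, fun j hj => ?_⟩
        rcases Nat.lt_succ_iff_lt_or_eq.1 hj with hj | rfl
        · have := hmin j hj
          norm_num at this ⊢
          linarith
        · norm_num
      · have hge := not_lt.1 hlt
        rw [htot, eval_var] at hge
        have e5 := exec_ite (P := .seq (.assign 9 (exTotal p)) (.assign 10 (exDiff p))) (n := 1)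
          (e := exTotal p) (f := var 9) hX hb a1 s1 (by simp)
          (by simp) (fun hc => absurd hc hlt) (fun _ => exec_skip hb)
        refine ⟨_, e5.mono (by simp only [cost_var]; omega), h8, hF.setReg (by simp), ?_⟩
        simp only [Mem.setReg_reg]
        norm_num
        refine ⟨hc, hval.imp_right fun ⟨j, hj, h⟩ => ⟨j, by omega, h⟩, fun j hj => ?_⟩
        rcases Nat.lt_succ_iff_lt_or_eq.1 hj with hj | rfl
        · exact hmin j hj
        · exact hge)
    ⟨((Frame.refl.setReg (by simp)).setReg (by simp)).setReg (by simp), by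
      simp only [Mem.setReg_reg]
      norm_num
      exact ⟨le_rfl, .inl rfl, fun j hj => by omega⟩⟩
  refine ⟨m', _, _, (e1.seq (e2.seq r1)).mono ?_, r2, rfl, rfl, r3⟩
  simp only [cost_add, cost_mul, cost_get, cost_lit]
  omega

lemma digitCode_eq_numeral (B : ℤ) (l : List (ℤ × Dir)) :
    digitCode B l = numeral B (l.map fun x => (zrank x.1 : ℤ)) := by
  induction l with
  | nil => rfl
  | cons x l ih => simp [digitCode, numeral, ih]

lemma expand_attach_single (l : List (ℤ × Dir)) (y : ℤ) : (attach l (single y)).expand p q =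
    (l.flatMap fun x => aNf p q x.1 ++ [x.2.letter]) ++ aNf p q y := by
  induction l with
  | nil => rfl
  | cons x l ih => simp [expand, ih, aNf]

/-- The integers are decoded from the digits of the key, and the letters `t`, `T` are those of the
input. -/
lemma exec_emitWord (h : OutEnv p q k X V e n m) (hm : m.Bdd X) {l : List (ℤ × Dir)} {c y N : ℤ}
    (hl : ∀ x ∈ l, Bounded p q x) (hdir : l.map Prod.snd = V.pairs.map Prod.snd)
    (h9 : m.reg 9 = c) (h10 : m.reg 10 = y)
    (hc : c + keyShift q k = (2 * q) ^ k * N + digitCode (2 * q) l)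
    (hy : |y| ≤ 12 * p * n) :
    ∃ m', Exec X (emitWord q) m ((60 * q + 200) * (k + 1) + 60 * (12 * p * n + 1) + 10) m' ∧
      Frame [11, 12, 13] [] (wordCode ((attach l (single y)).expand p q)) m m' := by
  obtain ⟨l12, l1, lk, l14⟩ := h.env.lits
  have hX := h.env.two_le
  have hqX : (q : ℤ) ≤ X := by omega
  have hlen : l.length = k := by
    rw [← h.env.length_eq]; simpa using congrArg List.length hdir
  obtain ⟨m', r1, r2⟩ := exec_forLt (x := 11) (f := var 0) (N := k) (n := 60 * q + 100)
    (P := .seq (.assign 13 (get 11 ((var 9 + exZ q) / get 12 (var 0 - lit 1 - var 11) % lit (2 * q))))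
      (.seq emitPower (.write ((lit 1 - get 1 (var 11)) / lit 2))))
    hX hm (by omega) (by simp) (by simp) (by omega)
    (fun J m' => Frame [11, 12, 13] [] (wordCode
      ((l.take J).flatMap fun x => aNf p q x.1 ++ [x.2.letter])) m m')
    (fun j _ m' hF => by simp [hF.1 0 (by simp), h.env.reg0])
    (fun J hJ m₁ hF h11 hb => by
      have hE := h.frame hF (by simp)
      have hJ' : J < l.length := by omega
      have hbd := hl _ (List.getElem_mem hJ')
      have hpw : m₁.arr 12 ((k : ℤ) - 1 - J) = (2 * q) ^ (k - 1 - J) := by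
        rw [← hE.env.pow _ (by omega)]
        congr 1
        omega
      have hdig : (c + keyShift q k) / (2 * q) ^ (k - 1 - J) % (2 * q) = (zrank l[J].1 : ℤ) := by
        have := numeral_digit (B := 2 * q) (l := l.map fun x => (zrank x.1 : ℤ)) (by
          intro d hd
          obtain ⟨x, hx, rfl⟩ := List.mem_map.1 hd
          exact ⟨by positivity, zrank_lt (hl x hx).1⟩) N (j := J) (by simpa using hJ')
        simp only [List.length_map, hlen, List.getElem_map, ← digitCode_eq_numeral] at this
        rw [hc, mul_comm, this]
      have e1 := exec_assign (x := 13) (v := l[J].1) hX hb (by omega)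
        (e := get 11 ((var 9 + exZ q) / get 12 (var 0 - lit 1 - var 11) % lit (2 * q)))
        (by simp [exZ, exM, l1, l14, abs_of_nonneg]; omega) (Nat.le_of_ble_eq_true rfl) (by
          simp only [eval_get, eval_mod, eval_div, eval_add, eval_sub, eval_var, eval_lit,
            exZ_eval hE.env, hE.env.reg0, h11, hpw, hF.1 9 (by simp), h9]
          rw [hdig]
          exact hE.inv _ hbd.1) (by have := hbd.1; omega)
      obtain ⟨m₂, e2, f2⟩ := exec_emitPower (hE.frame ((Frame.refl (R := [13])).setReg (by simp))
        (by simp)) e1.bdd (x := l[J].1) (by simp) (by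
          have := hbd.1
          have : (0 : ℤ) ≤ 12 * p * n := by positivity
          omega)
      have hsign : m₁.arr 1 J = l[J].2.sign := by
        have hJV : J < V.pairs.length := by rw [h.env.length_eq]; exact hJ
        have h1 := (hE.env.coeff J _ (List.getElem?_eq_getElem hJV)).2
        have h2 : l[J].2 = V.pairs[J].2 := by
          have := List.getElem_of_eq hdir (i := J) (by simpa using hJ')
          simpa using this
        rw [h1, h2]
      have e3 := exec_write (e := (lit 1 - get 1 (var 11)) / lit 2)
        (v := (l[J].2.letter.rank : ℤ)) hX e2.bdd (by simp [l1]; omega) (by simp) (by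
          simp only [eval_div, eval_sub, eval_lit, eval_get, eval_var, f2.1 11 (by simp),
            f2.2.1 1 (by simp), Mem.setReg_arr, Mem.setReg_reg]
          norm_num
          rw [h11, hsign]
          cases l[J].2 <;> rfl)
      refine ⟨_, (e1.seq (e2.seq e3)).mono ?_, ?_, ?_⟩
      · have g1 : (get 11 ((var 9 + exZ q) / get 12 (var 0 - lit 1 - var 11) % lit (2 * q))).cost ≤
          50 := Nat.le_of_ble_eq_true rfl
        have g2 := aLen_le_abs (p := p) (q := q) l[J].1
        have g3 := hbd.1
        have g4 : ((lit 1 - get 1 (var 11)) / lit 2).cost ≤ 20 := Nat.le_of_ble_eq_true rfl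
        omega
      · show m₂.reg 11 = J
        rw [f2.1 11 (by simp)]
        simpa using h11
      · have := (((hF.setReg (x := 13) (v := l[J].1) (by simp)).trans
          (f2.mono (by simp) (by simp))).write (v := (l[J].2.letter.rank : ℤ))).setReg (x := 11)
            (v := (J : ℤ) + 1) (by simp)
        rw [List.take_succ_eq_append_getElem hJ', List.flatMap_append, wordCode, List.map_append]
        simpa [wordCode] using this)
    (Frame.refl.setReg (by simp))
  rw [List.take_of_length_le (by omega)] at r2
  have hE := h.frame r2 (by simp)
  have hyX : |y| ≤ X := hy.trans (by have := h.exponent_le; omega)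
  have e4 := exec_assign (x := 13) (e := var 10) (v := y) hX r1.bdd (by omega) (by simp) (by simp)
    (by simp [r2.1 10 (by simp), h10]) hyX
  obtain ⟨m₅, e5, f5⟩ := exec_emitPower (hE.frame ((Frame.refl (R := [13])).setReg (by simp))
    (by simp)) e4.bdd (x := y) (by simp) (by omega)
  refine ⟨m₅, (r1.seq (e4.seq e5)).mono ?_, ?_⟩
  · have g2 := aLen_le_abs (p := p) (q := q) y
    have g3 : aLen p q y ≤ 12 * p * n := by
      have := g2.trans hy
      exact_mod_cast this
    have g4 : ((var 0).cost + (60 * q + 100) + 12) * (k + 1) ≤ (60 * q + 200) * (k + 1) :=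
      Nat.mul_le_mul_right _ (by simp only [cost_var]; omega)
    have g5 : 60 * (aLen p q y + 1) ≤ 60 * (12 * p * n + 1) := by omega
    have g6 : (var 10).cost + 2 ≤ 10 := Nat.le_of_ble_eq_true rfl
    linarith
  · have := (r2.setReg (x := 13) (v := y) (by simp)).trans (f5.mono (R' := [11, 12, 13]) (A' := [])
      (by simp) (by simp))
    rw [expand_attach_single, wordCode, List.map_append]
    exact this

end Output

section OutputLoop

open Ex

variable {p q k e n : ℕ} {X : ℤ} {V : Valley} {m : Mem}

/-- The shift exceeds all keys, so that empty cells can be told from others. -/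
lemma OutEnv.key_lt (h : OutEnv p q k X V e n m) {r κ : ℤ} (hκ : RepKey p q k V r κ) :
    κ < keyShift q k := by
  have h1 := (h.bound r κ hκ).2.2
  have hq := h.env.lt
  have hM : (0 : ℤ) < (2 * q) ^ k := pow_pos (by omega) _
  have hZ : keyShift q k = 14 * q * ((2 * q) ^ k * (k + 1)) := by rw [keyShift]; ring
  have h2 : ((q : ℤ) + 1) * (2 * q) ^ k * k ≤ (q + 1) * ((2 * q) ^ k * (k + 1)) := by
    rw [mul_assoc]
    exact mul_le_mul_of_nonneg_left (mul_le_mul_of_nonneg_left (by omega) hM.le) (by omega)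
  have h3 : ((q : ℤ) + 1) * ((2 * q) ^ k * (k + 1)) < 14 * q * ((2 * q) ^ k * (k + 1)) :=
    mul_lt_mul_of_pos_right (by omega) (by positivity)
  omega

/-- The nonempty cells of the final table are those of the range. -/
lemma OutEnv.cell_neg_iff (h : OutEnv p q k X V e n m) (r : ℤ) :
    m.arr 5 (r * (k + 1) + e) < 0 ↔ ∃ V', V.Rep p q r V' := by
  obtain ⟨h1, h2, h3⟩ := h.tab r
  constructor
  · intro hc
    obtain hc' | ⟨κ, ⟨V', hV', -⟩, -⟩ := h2
    · omega
    · exact ⟨V', hV'⟩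
  · rintro ⟨V', hV'⟩
    have hκ : RepKey p q k V r _ := ⟨V', hV', rfl⟩
    have := h3 _ hκ
    have := h.key_lt hκ
    omega

lemma OutEnv.abs_le (h : OutEnv p q k X V e n m) {r : ℤ} {V' : Valley} (hr : V.Rep p q r V') :
    |r| ≤ 6 * n :=
  (h.bound r _ ⟨V', hr, rfl⟩).1

/-- The best bounded representation found by `findBest` spells the peak normal form. -/
lemma BestAt.exists_pnf (h : OutEnv p q k X V e n m) (hdvd : p ∣ q)
    (hV : V.toZWord.BrittonReduced p q) {i : ℕ} (hi : i ≤ 12 * n)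
    (hcell : m.arr 5 (((i : ℤ) - 6 * n) * (k + 1) + e) < 0) {c y : ℤ}
    (hB : BestAt p q ((2 * q) ^ k) (fun r => m.arr 5 (r * (k + 1) + e)) n (i - 6 * n)
      (12 * n + 1) c y) :
    ∃ (l : List (ℤ × Dir)) (N : ℕ), (∀ x ∈ l, Bounded p q x) ∧
      l.map Prod.snd = V.pairs.map Prod.snd ∧
      c + keyShift q k = (2 * q) ^ k * N + digitCode (2 * q) l ∧ |y| ≤ 12 * p * n ∧
      digitCode (2 * q) l < (2 * q) ^ k ∧
      pnf p q (V.toZWord.val p q * bsA p q ^ (-(p * ((i : ℤ) - 6 * n)))) =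
        (attach l (single y)).expand p q ∧
      ((attach l (single y)).expand p q).length = N := by
  obtain ⟨-, hval, hmin⟩ := hB
  have hp := h.env.pos
  have hpq := h.env.lt
  have hc : c < 0 := by
    have := hmin i (by omega)
    simp at this
    omega
  obtain hc' | ⟨j, hj, hcj, rfl⟩ := hval
  · omega
  set r : ℤ := i - 6 * n
  set r' : ℤ := j - 6 * n
  have hM : (0 : ℤ) < (2 * q) ^ k := pow_pos (by omega) _
  have hneg : m.arr 5 (r' * (k + 1) + e) < 0 := by
    have : (0 : ℤ) ≤ (2 * q) ^ k * aLen p q (p * (r' - r)) := by positivity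
    simp only at hcj
    omega
  obtain hz | ⟨κ, ⟨V', hV', rfl⟩, hκ⟩ := (h.tab r').2.1
  · omega
  have hbd := hV'.bounded hpq.le
  have hlen : V.pairs.length = k := h.env.length_eq
  have hlen' : V'.pairs.length = k := hV'.pairs_length.trans hlen
  have hbest := Valley.isBrittonPnf_of_minimal hp hpq hdvd hV hV' (r := r) (by
    intro r'' V'' hV''
    have h1 := abs_le.1 (h.abs_le hV'')
    have h2 := hmin (r'' + 6 * n).toNat (by omega)
    rw [show (((r'' + 6 * n).toNat : ℕ) : ℤ) = r'' + 6 * n by omega] at h2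
    have h3 := (h.tab r'').2.2 _ ⟨V'', hV'', rfl⟩
    simp only [listKey] at h2 h3 hκ hcj
    rw [show r'' + 6 * (n : ℤ) - 6 * n = r'' by ring] at h2
    rw [hlen, mul_add, mul_add]
    linarith)
  have hexp := hbest.expand_eq (by omega) (by omega)
  refine ⟨V'.pairs, pairsNorm p q V'.pairs + aLen p q (p * (r' - r)), hbd, hV'.map_snd, ?_, ?_, ?_,
    hexp.symm, ?_⟩
  · rw [hcj]
    simp only
    rw [hκ, listKey]
    push_cast
    ring
  · rw [abs_mul, Nat.abs_cast]
    have : |r' - r| ≤ 12 * n := by rw [_root_.abs_le]; omega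
    have := mul_le_mul_of_nonneg_left this (by omega : (0 : ℤ) ≤ p)
    linarith
  · have := digitCode_lt hbd
    rwa [hlen'] at this
  · rw [expand_length, norm_attach]
    rfl

/-- The peak normal form of `V a ^ (-ρ)`. -/
noncomputable def valleyNf (p q : ℕ) (V : Valley) (ρ : ℤ) : List Letter :=
  pnf p q (V.toZWord.val p q * bsA p q ^ (-ρ))

/-- The output lists the range in increasing order, with the normal forms `V_ρ`. -/
lemma exec_output (h : OutEnv p q k X V e n m) (hm : m.Bdd X) (hdvd : p ∣ q)
    (hV : V.toZWord.BrittonReduced p q) :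
    ∃ m' L, Exec X (output p q) m
        ((200 * (12 * n + 2) + (60 * q + 200) * (k + 1) + 60 * (12 * p * n + 1) + 200) *
          (12 * n + 2)) m' ∧
      L.Pairwise (· < ·) ∧ (∀ ρ : ℤ, ρ ∈ L ↔ ∃ (r : ℤ) (V' : Valley), ρ = p * r ∧ V.Rep p q r V') ∧
      Frame [7, 8, 9, 10, 11, 12, 13] [] (outputCode L (valleyNf p q V)) m m' := by
  obtain ⟨l12, l1, lk, l14⟩ := h.env.lits
  have hX := h.env.two_le
  have hp := h.env.pos
  have hpX : (p : ℤ) ≤ X := by have := h.env.lt; omega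
  have hcount := h.env.count_le
  have hn := h.num_le
  obtain ⟨m', r1, L, r2, r3, r4⟩ := exec_forLt (x := 7) (f := lit 12 * get 7 (lit 0) + lit 1)
    (N := 12 * n + 1)
    (n := 200 * (12 * n + 2) + (60 * q + 200) * (k + 1) + 60 * (12 * p * n + 1) + 100)
    (P := .ite (exCell (exWindow (var 7))) (lit 0)
      (.seq (findBest p) (.seq (.write (lit p * exWindow (var 7)))
        (.seq (.write ((var 9 + exZ q) / exM)) (emitWord q)))) .skip)
    hX hm (by omega) (by simp [l1, l12]; omega) (by simp) (by push_cast; nlinarith)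
    (fun J m' => ∃ L : List ℤ, L.Pairwise (· < ·) ∧
      (∀ ρ : ℤ, ρ ∈ L ↔ ∃ j < J, ρ = p * ((j : ℕ) - 6 * n) ∧ ∃ V', V.Rep p q (j - 6 * n) V') ∧
      Frame [7, 8, 9, 10, 11, 12, 13] [] (outputCode L (valleyNf p q V)) m m')
    (fun j _ m' hI => by
      obtain ⟨L, -, -, hF⟩ := hI
      simp [hF.2.1 7 (by simp), h.num])
    (fun J hJ m₁ hI h7 hb => by
      obtain ⟨L, hL1, hL2, hF⟩ := hI
      have hE := h.frame hF (by simp)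
      have hcell : (exCell (exWindow (var 7))).eval m₁ =
          m₁.arr 5 (((J : ℤ) - 6 * n) * (k + 1) + e) := by
        simp [exCell, exWindow, exAddr, hE.num, hE.id, hE.env.reg0, h7]
      have a1 : (exCell (exWindow (var 7))).Admissible X := by
        simp [exCell, exWindow, exAddr, l1]; omega
      have s1 : (exCell (exWindow (var 7))).size ≤ 200 := Nat.le_of_ble_eq_true rfl
      have c1 : (exCell (exWindow (var 7))).cost ≤ 40 := Nat.le_of_ble_eq_true rfl
      by_cases hlt : (exCell (exWindow (var 7))).eval m₁ < (lit 0).eval m₁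
      · have hneg := hlt
        rw [hcell, eval_lit] at hneg
        obtain ⟨m₂, c, y, e1, f1, h9, h10, hB⟩ := exec_findBest hE hb h7 (by omega)
        obtain ⟨l, N, g1, g2, g3, g4, g5, g6, g7⟩ := hB.exists_pnf hE hdvd hV (by omega) hneg
        have hE2 := hE.frame f1 (by simp)
        have hρX : |(p : ℤ) * (J - 6 * n)| ≤ X := by
          have := h.exponent_le
          rw [abs_mul, Nat.abs_cast]
          have : |(J : ℤ) - 6 * n| ≤ 12 * n := by rw [_root_.abs_le]; omega
          have := mul_le_mul_of_nonneg_left this (by omega : (0 : ℤ) ≤ p)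
          linarith
        have e2 := exec_write (e := lit p * exWindow (var 7)) (v := p * ((J : ℤ) - 6 * n)) hX e1.bdd
          (by simp [exWindow, hpX]; omega) (by simp [exWindow])
          (by simp [exWindow, hE2.num, f1.1 7 (by simp), h7])
        have f2 := f1.write (v := p * ((J : ℤ) - 6 * n))
        have hE3 := hE.frame f2 (by simp)
        have hM : (0 : ℤ) < (2 * q) ^ k := pow_pos (by have := h.env.lt; omega) _
        have e3 := exec_write (e := (var 9 + exZ q) / exM) (v := N) hX e2.bdd
          (by simp [exZ, exM, l1, l14, abs_of_nonneg]) (Nat.le_of_ble_eq_true rfl) (by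
            rw [eval_div, eval_add, exZ_eval hE3.env, exM, eval_get, eval_var, eval_var,
              hE3.env.reg0, hE3.env.pow k le_rfl]
            show (m₂.reg 9 + keyShift q k) / (2 * q) ^ k = N
            rw [h9, g3, add_comm, Int.add_mul_ediv_left _ _ hM.ne',
              Int.ediv_eq_zero_of_lt (digitCode_nonneg _) g5, zero_add])
        have f3 := f2.write (v := N)
        obtain ⟨m₄, e4, f4⟩ := exec_emitWord (hE.frame f3 (by simp)) e3.bdd g1 g2 h9 h10 g3 g4
        have e5 := exec_ite (Q := .skip) (e := exCell (exWindow (var 7))) (f := lit 0) hX hb a1 s1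
          (by simp; omega) (by simp) (fun _ => e1.seq (e2.seq (e3.seq e4)))
          (fun hc => absurd hlt hc)
        refine ⟨m₄, e5.mono ?_, ?_, L ++ [p * ((J : ℤ) - 6 * n)], ?_, ?_, ?_⟩
        · have c2 : (lit p * exWindow (var 7)).cost ≤ 20 := Nat.le_of_ble_eq_true rfl
          have c3 : ((var 9 + exZ q) / exM).cost ≤ 20 := Nat.le_of_ble_eq_true rfl
          have c4 : (lit 0).cost ≤ 1 := Nat.le_of_ble_eq_true rfl
          linarith
        · rw [f4.1 7 (by simp)]
          exact (f1.1 7 (by simp)).trans h7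
        · refine List.pairwise_append.2 ⟨hL1, List.pairwise_singleton _ _, fun a ha b hb => ?_⟩
          obtain ⟨j, hj, rfl, -⟩ := (hL2 a).1 ha
          rw [List.mem_singleton.1 hb]
          exact mul_lt_mul_of_pos_left (by omega) (by omega)
        · intro ρ
          rw [List.mem_append, hL2, List.mem_singleton]
          constructor
          · rintro (⟨j, hj, h⟩ | rfl)
            · exact ⟨j, by omega, h⟩
            · exact ⟨J, by omega, rfl, (hE.cell_neg_iff _).1 hneg⟩
          · rintro ⟨j, hj, rfl, h⟩
            rcases Nat.lt_succ_iff_lt_or_eq.1 hj with hj | rfl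
            · exact .inl ⟨j, hj, rfl, h⟩
            · exact .inr rfl
        · have := ((hF.trans (f3.mono (R' := [7, 8, 9, 10, 11, 12, 13]) (A' := []) (by simp)
            (by simp))).trans (f4.mono (R' := [7, 8, 9, 10, 11, 12, 13]) (A' := []) (by simp)
            (by simp))).setReg (x := 7) (v := (J : ℤ) + 1) (by simp)
          rw [← g7, ← g6] at this
          simpa [outputCode, valleyNf, wordCode] using this
      · have e5 := exec_ite (P := .seq (findBest p) (.seq (.write (lit p * exWindow (var 7)))
          (.seq (.write ((var 9 + exZ q) / exM)) (emitWord q)))) (n := 1)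
          (e := exCell (exWindow (var 7))) (f := lit 0) hX hb a1 s1 (by simp; omega)
          (by simp) (fun hc => absurd hc hlt) (fun _ => exec_skip hb)
        refine ⟨_, e5.mono ?_, h7, L, hL1, fun ρ => ?_, hF.setReg (by simp)⟩
        · have c4 : (lit 0).cost ≤ 1 := Nat.le_of_ble_eq_true rfl
          omega
        · rw [hL2]
          constructor
          · rintro ⟨j, hj, h⟩
            exact ⟨j, by omega, h⟩
          · rintro ⟨j, hj, h1, h2⟩
            rcases Nat.lt_succ_iff_lt_or_eq.1 hj with hj | rfl
            · exact ⟨j, hj, h1, h2⟩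
            · have := (hE.cell_neg_iff _).2 h2
              rw [hcell, eval_lit] at hlt
              exact absurd this hlt)
    ⟨[], List.Pairwise.nil, by simp, Frame.refl.setReg (by simp)⟩
  refine ⟨m', L, r1.mono ?_, r2, fun ρ => ?_, r4⟩
  · have c5 : (lit 12 * get 7 (lit 0) + lit 1).cost ≤ 20 := Nat.le_of_ble_eq_true rfl
    exact Nat.mul_le_mul_right _ (by omega)
  · rw [r3]
    constructor
    · rintro ⟨j, hj, rfl, V', h'⟩
      exact ⟨_, V', rfl, h'⟩
    · rintro ⟨r, V', rfl, h'⟩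
      have := _root_.abs_le.1 (h.abs_le h')
      have hj : (((r + 6 * n).toNat : ℕ) : ℤ) - 6 * n = r := by omega
      exact ⟨(r + 6 * n).toNat, by omega, by rw [hj], V', by rwa [hj]⟩

end OutputLoop

section Program

open Ex

variable {p q k K : ℕ} {X : ℤ} {V : Valley} {m : Mem}

/-! ### The whole program -/

/-- The addresses of the constant tables. -/
noncomputable def tableAddresses (q : ℕ) : List (ℕ × ℤ) :=
  (({2, 4, 10, 11} : Finset ℕ) ×ˢ Finset.Icc (-(3 * q : ℤ)) (3 * q)).toList

/-- The constant tables: geodesic lengths and normal forms of powers of `a`, and the position of an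
integer in the order of coefficients with its inverse. -/
noncomputable def table (p q b : ℕ) (i : ℤ) : ℤ :=
  if b = 2 then aLen p q i else if b = 4 then wordKey (aNf p q i) else if b = 10 then zrank i
  else Function.invFun zrank i.toNat

/-- The program. It sets up the constant tables and the powers of `2 q`, scans the valley, extends
the table of normal forms of powers of `a` as far as needed, and writes the output. -/
noncomputable def computeRange (p q : ℕ) : Prog :=
  .seq (.putAll (table p q) (tableAddresses q))
    (.seq (.powers 12 3 (2 * q) (var 0))
      (.seq (scan p q)
        (.seq (.powers 3 4 4 (lit (12 * p) * get 7 (lit 0) + lit (3 * q)))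
          (.seq (extendPowers p q) (output p q)))))

lemma mem_tableAddresses {b : ℕ} {i : ℤ} :
    (b, i) ∈ tableAddresses q ↔ (b = 2 ∨ b = 4 ∨ b = 10 ∨ b = 11) ∧ |i| ≤ 3 * q := by
  simp [tableAddresses, abs_le]

/-- A word size that suffices for inputs of length `k`, where `K` bounds the constant tables. -/
structure WordSize (p q k K : ℕ) (X : ℤ) : Prop where
  two_le : 2 ≤ X
  table_le : (K : ℤ) ≤ X
  lit_le : 14 * (q : ℤ) * q ≤ X
  litp_le : 12 * (p : ℤ) ≤ X
  count_le : 1100 * ((k : ℤ) + 1) ^ 2 ≤ X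
  shift_le : keyShift q k ≤ X
  pow_le : (2 * q : ℤ) ^ k * (2 * q) ≤ X
  pow_four_le : (4 : ℤ) ^ (3 * q + 12 * p * k) * 4 ≤ X

lemma le_two_pow_of_le {x e : ℕ} (h : x ≤ e) : x ≤ 2 ^ e :=
  h.trans Nat.lt_two_pow_self.le

/-- All bounds in `WordSize` are exponential in `k + 1`, so that `O(k + 1)` bits suffice. -/
lemma exists_wordSize (p q K : ℕ) : ∃ c : ℕ, ∀ k, WordSize p q k K (2 ^ (c * (k + 1))) := by
  refine ⟨K + 14 * q * q + 14 * q + 8 * q + 24 * p + 40, fun k => ?_⟩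
  set c := K + 14 * q * q + 14 * q + 8 * q + 24 * p + 40 with hc
  have hck : c ≤ c * (k + 1) := Nat.le_mul_of_pos_right _ (by omega)
  have hpow : ∀ e, e ≤ c * (k + 1) → 2 ^ e ≤ 2 ^ (c * (k + 1)) := fun e he =>
    Nat.pow_le_pow_right (by norm_num) he
  have hmul : ∀ d, d ≤ c → ∀ e, e ≤ d * (k + 1) → e ≤ c * (k + 1) := fun d hd e he =>
    he.trans (Nat.mul_le_mul_right _ hd)
  have hlin : ∀ x, x ≤ c → x ≤ 2 ^ (c * (k + 1)) := fun x hx => le_two_pow_of_le (hx.trans hck)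
  have hk : k + 1 ≤ 2 ^ (k + 1) := le_two_pow_of_le le_rfl
  have h2q : ∀ i, (2 * q) ^ i ≤ 2 ^ (2 * q * i) := fun i => by
    rw [pow_mul]
    exact Nat.pow_le_pow_left (le_two_pow_of_le le_rfl) _
  constructor
  · exact_mod_cast hlin 2 (by omega)
  · exact_mod_cast hlin K (by omega)
  · exact_mod_cast hlin (14 * q * q) (by omega)
  · exact_mod_cast hlin (12 * p) (by omega)
  · have : 1100 * (k + 1) ^ 2 ≤ 2 ^ (11 + 2 * (k + 1)) := by
      rw [pow_add, mul_comm 2, pow_mul]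
      exact Nat.mul_le_mul (by norm_num) (Nat.pow_le_pow_left hk _)
    exact_mod_cast this.trans (hpow _ (hmul 13 (by omega) _ (by omega)))
  · have : 14 * q * (2 * q) ^ k * (k + 1) ≤ 2 ^ (14 * q + 2 * q * k + (k + 1)) := by
      rw [pow_add, pow_add]
      exact Nat.mul_le_mul (Nat.mul_le_mul (le_two_pow_of_le le_rfl) (h2q k)) hk
    unfold keyShift
    exact_mod_cast this.trans (hpow _ (by nlinarith))
  · have := h2q (k + 1)
    rw [pow_succ] at this
    exact_mod_cast this.trans (hpow _ (by nlinarith))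
  · have : 4 ^ (3 * q + 12 * p * k) * 4 = 2 ^ (2 * (3 * q + 12 * p * k + 1)) := by
      rw [← pow_succ, pow_mul]
      norm_num
    exact_mod_cast this.le.trans (hpow _ (hmul (6 * q + 24 * p + 2) (by omega) _ (by nlinarith)))

lemma coeffs_attach (l : List (ℤ × Dir)) (u : ZWord) :
    (attach l u).coeffs = l.map Prod.fst ++ u.coeffs := by
  induction l with
  | nil => rfl
  | cons x l ih => simp [coeffs, ih]

lemma inputMem_reg_zero (V : Valley) : (inputMem V.toZWord).reg 0 = V.pairs.length := by
  simp [inputMem, Valley.toZWord, dirs]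

lemma inputMem_reg (V : Valley) {x : ℕ} (hx : x ≠ 0) : (inputMem V.toZWord).reg x = 0 := by
  simp [inputMem, hx]

lemma inputMem_arr (V : Valley) {b : ℕ} (hb : b ≠ 0) (hb' : b ≠ 1) (i : ℤ) :
    (inputMem V.toZWord).arr b i = 0 := by
  simp [inputMem, hb, hb']

lemma inputMem_coeff (V : Valley) (i : ℕ) (x : ℤ × Dir) (hi : V.pairs[i]? = some x) :
    (inputMem V.toZWord).arr 0 i = x.1 ∧ (inputMem V.toZWord).arr 1 i = x.2.sign := by
  obtain ⟨hlt, hx⟩ := List.getElem?_eq_some_iff.1 hi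
  constructor
  · simp [inputMem, Valley.toZWord, Valley.app, coeffs_attach, List.getElem?_append_left, hlt, hx]
  · simp [inputMem, Valley.toZWord, Valley.dirs_app, dirs, hlt, hx]

lemma abs_getD_le {l : List ℤ} {B : ℤ} (hB : 0 ≤ B) (h : ∀ x ∈ l, |x| ≤ B) (i : ℕ) :
    |l.getD i 0| ≤ B := by
  rw [List.getD_eq_getElem?_getD]
  cases hi : l[i]? with
  | none => simpa
  | some x => exact h x (List.mem_of_getElem? hi)

lemma inputMem_bdd (hX : 2 ≤ X) (hq : (q : ℤ) ≤ X) (hk : (V.pairs.length : ℤ) ≤ X)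
    (hV : ∀ x ∈ V.pairs, Bounded p q x) : (inputMem V.toZWord).Bdd X := by
  constructor
  · intro x _
    by_cases hx : x = 0
    · subst hx
      rw [inputMem_reg_zero, Nat.abs_cast]
      exact hk
    · rw [inputMem_reg V hx]
      simp; omega
  · intro b i
    simp only [inputMem]
    split_ifs
    · refine abs_getD_le (by omega) (fun x hx => ?_) _
      rw [Valley.toZWord, Valley.app, coeffs_attach, List.mem_append, List.mem_map] at hx
      rcases hx with ⟨y, hy, rfl⟩ | hx
      · have := (hV y hy).1
        omega
      · simp [coeffs] at hx
        subst hx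
        simp; omega
    · refine abs_getD_le (by omega) (fun x hx => ?_) _
      obtain ⟨θ, -, rfl⟩ := List.mem_map.1 hx
      cases θ <;> simp [Dir.sign] <;> omega
    all_goals simp; omega

/-- The number of steps is the sum over the parts of the program, in the order of execution. -/
lemma exec_computeRange (hp : 1 ≤ p) (hpq : p < q) (hdvd : p ∣ q)
    (hV : V.toZWord.BrittonReduced p q) (hb : ∀ x ∈ V.pairs, Bounded p q x)
    (hK : ∀ y ∈ tableAddresses q, |y.2| ≤ (K : ℤ) ∧ |table p q y.1 y.2| ≤ (K : ℤ))
    (hX : WordSize p q V.pairs.length K X) :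
    ∃ m' L, Exec X (computeRange p q) (inputMem V.toZWord)
        (3 * (tableAddresses q).length + 1 + (40 * (V.pairs.length + 1) +
          (13005 * combCount V 0 + 30 + (60 * (3 * q + 12 * p * V.size + 1) +
            (700 * (12 * p * V.size + 1) +
              (200 * (12 * V.size + 2) + (60 * q + 200) * (V.pairs.length + 1) +
                60 * (12 * p * V.size + 1) + 200) * (12 * V.size + 2)))))) m' ∧
      L.Pairwise (· < ·) ∧
      (∀ ρ : ℤ, ρ ∈ L ↔ ∃ (r : ℤ) (V' : Valley), ρ = p * r ∧ V.Rep p q r V') ∧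
      m'.out = outputCode L (valleyNf p q V) := by
  set k := V.pairs.length with hk
  have h2 := hX.two_le
  have hlit := hX.lit_le
  have hqX : 14 * (q : ℤ) ≤ X := by nlinarith
  have hkX : 1100 * ((k : ℤ) + 1) ≤ X := by have := hX.count_le; nlinarith
  have hm := inputMem_bdd h2 (by omega) (by omega : (V.pairs.length : ℤ) ≤ X) hb
  obtain ⟨m₁, e1, r1, o1, a1⟩ := exec_putAll h2 (table p q) (tableAddresses q)
    (fun y hy => ⟨(hK y hy).1.trans hX.table_le, (hK y hy).2.trans hX.table_le⟩) hm
  have a1' : ∀ b i, b ≠ 2 → b ≠ 4 → b ≠ 10 → b ≠ 11 →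
      m₁.arr b i = (inputMem V.toZWord).arr b i := fun b i h1 h2 h3 h4 => by
    rw [a1, if_neg]
    rw [mem_tableAddresses]
    omega
  have a1'' : ∀ b i, (b = 2 ∨ b = 4 ∨ b = 10 ∨ b = 11) → |i| ≤ 3 * (q : ℤ) →
      m₁.arr b i = table p q b i := fun b i h1 h2 => by
    rw [a1, if_pos (mem_tableAddresses.2 ⟨h1, h2⟩)]
  obtain ⟨m₂, e2, f2, p2⟩ := exec_powers (b := 12) (x := 3) (f := var 0) (N := k) (c := 2 * q) h2
    e1.bdd (by omega) (by omega) (by simp) (by simp)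
    (fun m' hf => by rw [eval_var, hf.1 0 (by simp), r1, inputMem_reg_zero]) hX.pow_le
  have hE : Env p q k X V.pairs m₂ :=
    { two_le := h2, pos := hp, lt := hpq, lit_le := hlit, count_le := hX.count_le,
      shift_le := hX.shift_le, length_eq := rfl,
      reg0 := by rw [f2.1 0 (by simp), r1, inputMem_reg_zero]
      coeff := fun i x hi => by
        rw [f2.2.1 0 (by simp), f2.2.1 1 (by simp), a1' 0 _ (by simp) (by simp) (by simp) (by simp),
          a1' 1 _ (by simp) (by simp) (by simp) (by simp)]
        exact inputMem_coeff V i x hi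
      len := fun x hx => by
        rw [f2.2.1 2 (by simp), a1'' 2 x (by simp) (by omega), table, if_pos rfl]
      rank := fun x hx => by
        rw [f2.2.1 10 (by simp), a1'' 10 x (by simp) (by omega)]
        simp [table]
      pow := p2 }
  obtain ⟨m₃, e, e3, f3, b1, b2, b3, b4, b5⟩ := exec_scan hdvd V hE e2.bdd
    (by rw [f2.1 1 (by simp), r1, inputMem_reg V (by simp)])
    (by rw [f2.1 2 (by simp), r1, inputMem_reg V (by simp)])
    (fun z => by rw [f2.2.1 5 (by simp), a1' 5 _ (by simp) (by simp) (by simp) (by simp),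
      inputMem_arr V (by simp) (by simp)])
    (by rw [f2.2.1 6 (by simp), a1' 6 _ (by simp) (by simp) (by simp) (by simp),
      inputMem_arr V (by simp) (by simp)])
    (by rw [f2.2.1 7 (by simp), a1' 7 _ (by simp) (by simp) (by simp) (by simp),
      inputMem_arr V (by simp) (by simp)]) hb
  set n := V.size
  have hE3 := hE.frame f3 (by simp) (by simp)
  have hle : (4 : ℤ) ^ (3 * q + 12 * p * n) * 4 ≤ X := le_trans
    (mul_le_mul_of_nonneg_right (pow_le_pow_right₀ (by norm_num)
      (by have := Nat.mul_le_mul_left (12 * p) b3; omega)) (by norm_num)) hX.pow_four_le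
  have hpos : (0 : ℤ) < 4 ^ (3 * q + 12 * p * n) := by positivity
  obtain ⟨m₄, e4, f4, p4⟩ := exec_powers (b := 3) (x := 4)
    (f := lit (12 * p) * get 7 (lit 0) + lit (3 * q)) (N := 3 * q + 12 * p * n) (c := 4) h2
    e3.bdd (by omega) (by norm_num) (by
      have := hX.litp_le
      have : |(12 * p : ℤ)| ≤ X := by rw [abs_of_nonneg (by positivity)]; exact this
      have : |(3 * q : ℤ)| ≤ X := by rw [abs_of_nonneg (by positivity)]; omega
      simp only [admissible_add, admissible_mul, admissible_lit, admissible_get, abs_zero]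
      refine ⟨⟨by assumption, by omega⟩, by assumption⟩) (by simp)
    (fun m' hf => by
      simp [hf.2.1 7 (by simp), b2]
      ring) hle
  have hE4 := hE3.frame f4 (by simp) (by simp)
  have g4 : ∀ x : ℤ, |x| ≤ 3 * q → GoodAt p q m₄ x := fun x hx => by
    constructor
    · rw [f4.2.1 2 (by simp), f3.2.1 2 (by simp), f2.2.1 2 (by simp), a1'' 2 x (by simp) hx, table,
        if_pos rfl]
    · rw [f4.2.1 4 (by simp), f3.2.1 4 (by simp), f2.2.1 4 (by simp), a1'' 4 x (by simp) hx]
      simp [table]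
  obtain ⟨m₅, e5, f5, g5⟩ := exec_extendPowers (two_mul_le_of_dvd hpq hdvd) hp (n := n) h2 e4.bdd
    hlit (by linarith) (by rw [f4.2.1 7 (by simp), b2]) p4 g4
  have hO : OutEnv p q k X V e n m₅ :=
    { env :=
        { two_le := h2, pos := hp, lt := hpq, lit_le := hlit, count_le := hX.count_le,
          shift_le := hX.shift_le, length_eq := rfl,
          reg0 := by rw [f5.1 0 (by simp)]; exact hE4.reg0
          coeff := by rw [f5.2.1 0 (by simp), f5.2.1 1 (by simp)]; exact hE4.coeff
          len := fun x hx => (g5 x (by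
            have : (0 : ℤ) ≤ 12 * p * n := by positivity
            omega)).1
          rank := by rw [f5.2.1 10 (by simp)]; exact hE4.rank
          pow := by rw [f5.2.1 12 (by simp)]; exact hE4.pow }
      id := by rw [f5.2.1 6 (by simp), f4.2.1 6 (by simp)]; exact b1
      num := by rw [f5.2.1 7 (by simp), f4.2.1 7 (by simp)]; exact b2
      num_le := b3
      pow_le := by linarith
      pow_four := by rw [f5.2.1 3 (by simp)]; exact p4
      good := g5
      inv := fun x hx => by
        have := zrank_lt hx
        rw [f5.2.1 11 (by simp), f4.2.1 11 (by simp), f3.2.1 11 (by simp), f2.2.1 11 (by simp),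
          a1'' 11 _ (by simp) (by rw [Nat.abs_cast]; omega)]
        simp only [table]
        norm_num
        exact Function.leftInverse_invFun zrank_injective x
      tab := by rw [f5.2.1 5 (by simp), f4.2.1 5 (by simp)]; exact b4
      bound := b5 }
  obtain ⟨m₆, L, e6, l1, l2, f6⟩ := exec_output hO e5.bdd hdvd hV
  have c2 : (var 0).cost + 30 ≤ 40 := Nat.le_of_ble_eq_true rfl
  have c4 : (lit (12 * p) * get 7 (lit 0) + lit (3 * q)).cost + 30 ≤ 60 :=
    Nat.le_of_ble_eq_true rfl
  refine ⟨m₆, L, e1.seq ((e2.mono (Nat.mul_le_mul_right _ c2)).seq (e3.seq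
    ((e4.mono (Nat.mul_le_mul_right _ c4)).seq (e5.seq e6)))), l1, l2, ?_⟩
  rw [f6.2.2, f5.2.2, f4.2.2, f3.2.2, f2.2.2, o1]
  simp [inputMem]

lemma length_le_pairsNorm (l : List (ℤ × Dir)) : l.length ≤ pairsNorm p q l := by
  rw [pairsNorm]
  induction l with
  | nil => simp
  | cons x l ih => simp at *; omega

/-- The number of steps is `O(s (N + s))`. Here `T` is the size of the constant tables, `k` the
number of letters, `n` the size of the valley, `s` the number of sinks, `N` the norm, and `cc` the
number of combinations. -/
lemma cost_le {T k n s N cc : ℕ} (hk : k ≤ N) (hn : n ≤ s) (hs : 1 ≤ s)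
    (hcc : cc ≤ 6 * k * (0 + n + 1) + 144 * n * (0 + n)) :
    3 * T + 1 + (40 * (k + 1) + (13005 * cc + 30 + (60 * (3 * q + 12 * p * n + 1) +
      (700 * (12 * p * n + 1) + (200 * (12 * n + 2) + (60 * q + 200) * (k + 1) +
        60 * (12 * p * n + 1) + 200) * (12 * n + 2))))) ≤
      (3 * T + 2000000 + 10000 * p + 2000 * q + 14 * (4000 + 120 * q + 1500 * p)) *
        (s * (N + s)) := by
  have h1 : N + s ≤ s * (N + s) := Nat.le_mul_of_pos_left _ hs
  set M := s * (N + s) with hM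
  have hcc' : cc ≤ 144 * M := by
    have h2 : k * (0 + n + 1) ≤ N * (2 * s) := Nat.mul_le_mul hk (by omega)
    have h3 : n * (0 + n) ≤ s * s := Nat.mul_le_mul hn (by omega)
    have h4 : M = s * N + s * s := by rw [hM]; ring
    nlinarith
  have hpn : p * n ≤ p * M := Nat.mul_le_mul_left _ (by omega)
  have hq : q ≤ q * M := Nat.le_mul_of_pos_right _ (by omega)
  have hT : T ≤ T * M := Nat.le_mul_of_pos_right _ (by omega)
  have hA : 200 * (12 * n + 2) + (60 * q + 200) * (k + 1) + 60 * (12 * p * n + 1) + 200 ≤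
      (4000 + 120 * q + 1500 * p) * (N + s) := by
    have h2 : q * (k + 1) ≤ q * (N + s) := Nat.mul_le_mul_left _ (by omega)
    have h3 : p * n ≤ p * (N + s) := Nat.mul_le_mul_left _ (by omega)
    nlinarith
  have hB : (200 * (12 * n + 2) + (60 * q + 200) * (k + 1) + 60 * (12 * p * n + 1) + 200) *
      (12 * n + 2) ≤ (4000 + 120 * q + 1500 * p) * (N + s) * (14 * s) :=
    Nat.mul_le_mul hA (by omega)
  have hB' : (4000 + 120 * q + 1500 * p) * (N + s) * (14 * s) =
      14 * (4000 + 120 * q + 1500 * p) * M := by rw [hM]; ring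
  rw [hB'] at hB
  nlinarith

end Program

theorem theorem7p5 (p q : ℕ) (hp : 1 ≤ p) (hpq : p < q) (hdvd : p ∣ q) :
    ∃ (P : Prog) (C : ℕ), ∀ V : ZWord, V.IsStandardValley p q →
      ∃ (L : List ℤ) (Vf : ℤ → List Letter) (n : ℕ) (m : Mem),
        -- `L` enumerates the range `R(V)` in increasing order
        (L.Pairwise (· < ·) ∧ ∀ ρ : ℤ, ρ ∈ L ↔ InRange p q V ρ) ∧
        -- on input `V`, the algorithm outputs the words `V_ρ`, within the time bound
        Run (2 ^ (C * (V.norm p q + 1))) P (inputMem V) n m ∧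
        m.out = outputCode L Vf ∧
        n ≤ C * (V.sinks * (V.norm p q + V.sinks)) ∧
        -- each `V_ρ` is in peak normal form, and `V = V_ρ ρ` in the group
        (∀ ρ : ℤ, InRange p q V ρ →
          pnf p q (wordVal p q (Vf ρ)) = Vf ρ ∧
          wordVal p q (Vf ρ) * bsA p q ^ ρ = V.val p q) ∧
        ∀ w : ZWord, (ZWord.cons 0 Dir.t w).BrittonReduced p q →
          IsMinWord p q (pnf p q ((V * w).val p q))
            {v | ∃ ρ : ℤ, InRange p q V ρ ∧ v = Vf ρ ++ pnf p q ((w.lmul ρ).val p q)} := by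
  have hp0 : p ≠ 0 := by omega
  have hq0 : q ≠ 0 := by omega
  -- `K` bounds the constant tables and their addresses
  obtain ⟨K, hK⟩ := ((tableAddresses q).toFinset.image fun y =>
    (|y.2| + |table p q y.1 y.2|).toNat).exists_le
  have hK' : ∀ y ∈ tableAddresses q, |y.2| ≤ (K : ℤ) ∧ |table p q y.1 y.2| ≤ (K : ℤ) := by
    intro y hy
    have := hK _ (Finset.mem_image_of_mem _ (List.mem_toFinset.2 hy))
    have h1 := abs_nonneg y.2
    have h2 := abs_nonneg (table p q y.1 y.2)
    omega
  obtain ⟨c, hc⟩ := exists_wordSize p q K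
  refine ⟨computeRange p q, 200 * c + (3 * (tableAddresses q).length + 2000000 + 10000 * p +
    2000 * q + 14 * (4000 + 120 * q + 1500 * p)), fun V₀ hV₀ => ?_⟩
  obtain ⟨V, rfl⟩ := hV₀.exists_valley
  have hb : ∀ x ∈ V.pairs, Bounded p q x := by
    have := hV₀.bounds
    change ∀ x ∈ V.toZWord.pairs, _ at this
    rw [Valley.toZWord, Valley.pairs_app, pairs_single, List.append_nil] at this
    exact this
  have hk : V.pairs.length ≤ V.toZWord.norm p q := by
    rw [Valley.toZWord, Valley.app, norm_attach]
    exact (length_le_pairsNorm _).trans (Nat.le_add_right _ _)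
  obtain ⟨m', L, hrun, hL1, hL2, hout⟩ := exec_computeRange hp hpq hdvd hV₀.reduced hb hK' (hc _)
  -- the initial memory is equivalent to itself
  obtain ⟨n, hn, m, ⟨-, -, hm⟩, r⟩ := hrun.2 _ ⟨fun _ _ => rfl, rfl, rfl⟩
  have hval : ∀ ρ, wordVal p q (valleyNf p q V ρ) = V.toZWord.val p q * bsA p q ^ (-ρ) :=
    fun ρ => wordVal_pnf hp0 hq0 _
  refine ⟨L, valleyNf p q V, n, m, ⟨hL1, fun ρ => by rw [hL2, Valley.inRange_iff]⟩, ?_,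
    by rw [hm, hout], ?_, fun ρ _ => ⟨by rw [hval]; rfl, by rw [hval]; group⟩, fun w hw => ⟨?_, ?_⟩⟩
  · refine r.mono ?_
    rw [← pow_mul]
    refine pow_le_pow_right₀ (by norm_num) ?_
    nlinarith [Nat.mul_le_mul_left c hk]
  · have hs := V.size_le_sinks
    refine (hn.trans (cost_le hk (by omega) (by omega) (combCount_le V 0))).trans
      (Nat.mul_le_mul_right _ (Nat.le_add_left _ _))
  · obtain ⟨r, V', h1, h2⟩ := Valley.exists_pnf_split hp hpq hdvd V hV₀.reduced hw
    exact ⟨p * r, Valley.inRange_iff.2 ⟨r, V', rfl, h1⟩, h2⟩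
  · rintro v' ⟨ρ, -, rfl⟩
    refine not_wordLt_pnf hp hpq.le ?_
    rw [wordVal_append, hval, wordVal_pnf hp0 hq0, Valley.toZWord_mul, Valley.val_app, val_lmul]
    group
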